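/- Let $a,b>0$, $\Omega=(0,a]\times(0,b]$, $\varphi=(\varphi_1,\varphi_2)\in(0,1)^2$, $\rho=(\rho_1,\rho_2)$ with $\rho_1,\rho_2>0$. Let $\hat E_f$ be the space of fuzzy numbers $z:\mathbb R\to[0,1]$ (normal, fuzzy convex, upper semicontinuous, compactly supported) with level sets $[z]^r=[\underline z_r,\overline z_r]$, $r\in[0,1]$, for which $r\mapsto[z]^r$ is continuous, with the metric $\mathbb D(p,q)=\sup_{0\le r\le1}\max\{|\underline p_r-\underline q_r|,|\overline p_r-\overline q_r|\}$. The gH-difference is: $p\ominus_{gH}q=w$ iff $p=q+w$ or $q=p+(-1)w$. The gH-partial derivatives are the $\mathbb D$-limits of $\frac1h\,[U(\cdot+h)\ominus_{gH}U(\cdot)]$; such a derivative is of type (i) if its $r$-levels are $[\partial\underline U_r,\partial\overline U_r]$ for all $r$, and of type (ii) if they are $[\partial\overline U_r,\partial\underline U_r]$ for all $r$. Write $\mathfrak D^2_{x,y}U=\frac{\partial}{\partial y}\frac{\partial U}{\partial x}$ for the mixed gH-derivative. Fuzzy integrals are taken levelwise, and for $\alpha\in(0,1)^2$ put $$\mathfrak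 I^{\alpha,\rho}_{0^+}U(x,y)=\frac{\rho_1^{1-\alpha_1}\rho_2^{1-\alpha_2}}{\Gamma(\alpha_1)\Gamma(\alpha_2)}\int_0^x\!\!\int_0^y\frac{s^{\rho_1-1}t^{\rho_2-1}}{(x^{\rho_1}-s^{\rho_1})^{1-\alpha_1}(y^{\rho_2}-t^{\rho_2})^{1-\alpha_2}}\,U(s,t)\,dt\,ds,$$ $$\mathfrak D^{\varphi,\rho}_{0^+}U(x,y)=x^{1-\rho_1}y^{1-\rho_2}\,\mathfrak D^2_{x,y}\big(\mathfrak I^{1-\varphi,\rho}_{0^+}U\big)(x,y),\qquad {}^C\mathfrak D^{\varphi,\rho}_{0^+}U=\mathfrak D^{\varphi,\rho}_{0^+}W,$$ where $W(x,y)=(U(x,y)+U(0,0))\ominus_{gH}(U(x,0)+U(0,y))$, which is the meaning given to $U(x,y)\ominus U(x,0)\ominus U(0,y)+U(0,0)$. Let $\upsilon:[0,a]\times[0,b]\to\hat E_f$ be absolutely continuous (in the sense of Carathéodory, with respect to $\mathbb D$: for every $\varepsilon>0$ there is $\delta>0$ such that every finite family of non-overlapping rectangles $[x_i,x_i']\times[y_i,y_i']\subseteq[0,a]\times[0,b]$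 of total area less than $\delta$ satisfies $\sum_i\mathbb D\big(\upsilon(x_i',y_i')+\upsilon(x_i,y_i),\,\upsilon(x_i,y_i')+\upsilon(x_i',y_i)\big)<\varepsilon$, and $\upsilon(\cdot,0)$, $\upsilon(0,\cdot)$ are absolutely continuous) and d-monotone on $\Omega$ (for all $r$ the map $(x,y)\mapsto\overline{\upsilon(x,y)}_r-\underline{\upsilon(x,y)}_r$ is nondecreasing in both variables, or for all $r$ it is nonincreasing in both variables). Suppose that $\mathfrak D^2_{x,y}\upsilon$ exists almost everywhere on $\Omega$ without switching: either at almost every point the types of $\upsilon$ (with respect to $x$) and of $\partial\upsilon/\partial x$ (with respect to $y$) are the same, or at almost every point they are different. Then for almost every $(x,y)\in\Omega$ the mixed fuzzy Caputo–Katugampola gH-derivative of $\upsilon$ exists in $\hat E_f$, the integrals below exist, and $${}^C\mathfrak D^{\varphi,\rho}_{0^+}\upsilon(x,y)=\mathfrak I^{1-\varphi,\rho}_{0^+}\big(x^{1-\rho_1}y^{1-\rho_2}\,\mathfrak D^2_{x,y}\upsilon\big)(x,y)=\frac{\rho_1^{\varphi_1}\rho_2^{\varphi_2}}{\Gamma(1-\varphi_1)\Gamma(1-\varphi_2)}\int_0^x\!\!\int_0^y\frac{\mathfrak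 D^2_{s,t}\upsilon(s,t)}{(x^{\rho_1}-s^{\rho_1})^{\varphi_1}(y^{\rho_2}-t^{\rho_2})^{\varphi_2}}\,dt\,ds.$$ If moreover $\mathfrak D^2_{x,y}\upsilon$ (after modification on a null set) is continuous and bounded on $\Omega$ with respect to $\mathbb D$, then this holds at every point $(x,y)\in\Omega$. -/

import Mathlib

open Set Filter Topology MeasureTheory

/-- A fuzzy number: a normal, fuzzy convex, upper semicontinuous function `ℝ → [0,1]` with compact
support. -/
@[ext]
structure FuzzyNumber where
  grade : ℝ → ℝ
  nonneg : ∀ x, 0 ≤ grade x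
  le_one : ∀ x, grade x ≤ 1
  normal : ∃ x, grade x = 1
  convex : ∀ x y t, 0 ≤ t → t ≤ 1 → min (grade x) (grade y) ≤ grade (t * x + (1 - t) * y)
  usc : UpperSemicontinuous grade
  compact : IsCompact (closure {x | 0 < grade x})

namespace FuzzyNumber

open scoped Pointwise

/-- The `r`-level set: `{x | u x ≥ r}` for `r > 0`, the closed support for `r = 0`. -/
def level (u : FuzzyNumber) (r : ℝ) : Set ℝ :=
  if r ≤ 0 then closure {x | 0 < u.grade x} else {x | r ≤ u.grade x}

/-- Left end point of the `r`-level set. -/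
noncomputable def lo (u : FuzzyNumber) (r : ℝ) : ℝ := sInf (u.level r)

/-- Right end point of the `r`-level set. -/
noncomputable def hi (u : FuzzyNumber) (r : ℝ) : ℝ := sSup (u.level r)

/-- Diameter of the `r`-level set. -/
noncomputable def diam (u : FuzzyNumber) (r : ℝ) : ℝ := u.hi r - u.lo r

theorem level_subset (u : FuzzyNumber) (r : ℝ) : u.level r ⊆ closure {x | 0 < u.grade x} := by
  unfold level
  split_ifs with h
  · exact subset_rfl
  · exact fun x hx => subset_closure (lt_of_lt_of_le (not_le.1 h) hx)

theorem isClosed_level (u : FuzzyNumber) (r : ℝ) : IsClosed (u.level r) := by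
  unfold level
  split_ifs with h
  · exact isClosed_closure
  · exact upperSemicontinuous_iff_isClosed_preimage.1 u.usc r

theorem isCompact_level (u : FuzzyNumber) (r : ℝ) : IsCompact (u.level r) :=
  u.compact.of_isClosed_subset (u.isClosed_level r) (u.level_subset r)

theorem level_nonempty (u : FuzzyNumber) {r : ℝ} (hr : r ≤ 1) : (u.level r).Nonempty := by
  obtain ⟨x, hx⟩ := u.normal
  refine ⟨x, ?_⟩
  unfold level
  split_ifs with h
  · exact subset_closure (by simp [hx])
  · simp [hx, hr]

theorem ordConnected_pos (u : FuzzyNumber) (r : ℝ) (x y z : ℝ) (hxy : x ≤ y) (hyz : y ≤ z) :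
    min (u.grade x) (u.grade z) ≤ u.grade y := by
  rcases eq_or_lt_of_le (hxy.trans hyz) with h | h
  · have : x = y := le_antisymm hxy (h ▸ hyz)
    subst this
    exact min_le_left _ _
  · have hne : z - x ≠ 0 := by linarith
    have h1 := u.convex x z ((z - y) / (z - x)) (div_nonneg (by linarith) (by linarith))
      ((div_le_one (by linarith)).2 (by linarith))
    have h2 : (z - y) / (z - x) * x + (1 - (z - y) / (z - x)) * z = y := by
      field_simp
      ring
    rwa [h2] at h1

theorem level_eq_Icc (u : FuzzyNumber) {r : ℝ} (h0 : 0 < r) (hr : r ≤ 1) :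
    u.level r = Icc (u.lo r) (u.hi r) := by
  have hc := u.isCompact_level r
  have hn := u.level_nonempty hr
  apply Subset.antisymm
  · exact fun x hx => ⟨csInf_le hc.bddBelow hx, le_csSup hc.bddAbove hx⟩
  · intro x hx
    have h1 : u.lo r ∈ u.level r := hc.sInf_mem hn
    have h2 : u.hi r ∈ u.level r := hc.sSup_mem hn
    have h3 := u.ordConnected_pos r _ _ _ hx.1 hx.2
    simp only [level, not_le.2 h0, if_false, mem_ofPred_eq] at h1 h2 ⊢
    exact (le_min h1 h2).trans h3

/-- The supremum metric `sup_{0 ≤ r ≤ 1} max (|p₋ - q₋|) (|p₊ - q₊|)`. -/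
noncomputable instance : Dist FuzzyNumber where
  dist p q := ⨆ r : Icc (0 : ℝ) 1, max |p.lo r - q.lo r| |p.hi r - q.hi r|

theorem dist_def (p q : FuzzyNumber) :
    dist p q = ⨆ r : Icc (0 : ℝ) 1, max |p.lo r - q.lo r| |p.hi r - q.hi r| := rfl

theorem exists_bound (u : FuzzyNumber) :
    ∃ C, ∀ r : Icc (0 : ℝ) 1, |u.lo r| ≤ C ∧ |u.hi r| ≤ C := by
  obtain ⟨C, hC⟩ := u.compact.isBounded.exists_norm_le
  refine ⟨C, fun r => ⟨?_, ?_⟩⟩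
  · exact hC _ (u.level_subset r ((u.isCompact_level r).sInf_mem (u.level_nonempty r.2.2)))
  · exact hC _ (u.level_subset r ((u.isCompact_level r).sSup_mem (u.level_nonempty r.2.2)))

theorem bddAbove_dist (p q : FuzzyNumber) :
    BddAbove (range fun r : Icc (0 : ℝ) 1 => max |p.lo r - q.lo r| |p.hi r - q.hi r|) := by
  obtain ⟨C, hC⟩ := p.exists_bound
  obtain ⟨C', hC'⟩ := q.exists_bound
  refine ⟨C + C', ?_⟩
  rintro _ ⟨r, rfl⟩
  exact max_le ((abs_sub _ _).trans (add_le_add (hC r).1 (hC' r).1))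
    ((abs_sub _ _).trans (add_le_add (hC r).2 (hC' r).2))

theorem le_dist (p q : FuzzyNumber) (r : Icc (0 : ℝ) 1) :
    max |p.lo r - q.lo r| |p.hi r - q.hi r| ≤ dist p q :=
  le_ciSup (bddAbove_dist p q) r

theorem grade_le_of_ends {p q : FuzzyNumber}
    (h : ∀ r : Icc (0 : ℝ) 1, p.lo r = q.lo r ∧ p.hi r = q.hi r) (x : ℝ) :
    p.grade x ≤ q.grade x := by
  rcases (p.nonneg x).eq_or_lt with h0 | h0
  · exact h0 ▸ q.nonneg x
  · have h1 := p.le_one x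
    have hl := h ⟨p.grade x, h0.le, h1⟩
    have hx : x ∈ p.level (p.grade x) := by simp [level, not_le.2 h0]
    rw [level_eq_Icc p h0 h1, hl.1, hl.2, ← level_eq_Icc q h0 h1] at hx
    simpa [level, not_le.2 h0] using hx

noncomputable instance : MetricSpace FuzzyNumber where
  dist_self p := by simp [dist_def]
  dist_comm p q := by
    simp only [dist_def]
    congr 1
    funext r
    rw [abs_sub_comm (p.lo r), abs_sub_comm (p.hi r)]
  dist_triangle p q s := by
    rw [dist_def p s]
    refine ciSup_le fun r => ?_
    have h1 := le_dist p q r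
    have h2 := le_dist q s r
    refine max_le ?_ ?_
    · have := abs_sub_le (p.lo r) (q.lo r) (s.lo r)
      linarith [(le_max_left _ _).trans h1, (le_max_left _ _).trans h2]
    · have := abs_sub_le (p.hi r) (q.hi r) (s.hi r)
      linarith [(le_max_right _ _).trans h1, (le_max_right _ _).trans h2]
  eq_of_dist_eq_zero {p q} h := by
    have hr : ∀ r : Icc (0 : ℝ) 1, p.lo r = q.lo r ∧ p.hi r = q.hi r := by
      intro r
      have h1 := le_dist p q r
      rw [h] at h1
      exact ⟨sub_eq_zero.1 (abs_nonpos_iff.1 ((le_max_left _ _).trans h1)),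
        sub_eq_zero.1 (abs_nonpos_iff.1 ((le_max_right _ _).trans h1))⟩
    ext x
    exact le_antisymm (grade_le_of_ends hr x)
      (grade_le_of_ends (fun r => ⟨(hr r).1.symm, (hr r).2.symm⟩) x)

/-- Membership of `u` in the space `Ê` of fuzzy numbers whose level map `r ↦ [u]^r` is continuous
on `[0,1]` for the Hausdorff metric. -/
def LevelContinuous (u : FuzzyNumber) : Prop :=
  ContinuousOn u.lo (Icc 0 1) ∧ ContinuousOn u.hi (Icc 0 1)

/-- Membership function of the sum (extension principle). -/
noncomputable def addGrade (u v : FuzzyNumber) (z : ℝ) : ℝ :=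
  ⨆ x : ℝ, min (u.grade x) (v.grade (z - x))

theorem bddAbove_addGrade (u v : FuzzyNumber) (z : ℝ) :
    BddAbove (range fun x : ℝ => min (u.grade x) (v.grade (z - x))) := by
  refine ⟨1, ?_⟩
  rintro _ ⟨x, rfl⟩
  exact (min_le_left _ _).trans (u.le_one x)

theorem addGrade_nonneg (u v : FuzzyNumber) (z : ℝ) : 0 ≤ addGrade u v z :=
  (le_min (u.nonneg 0) (v.nonneg (z - 0))).trans (le_ciSup (bddAbove_addGrade u v z) 0)

theorem le_addGrade_iff (u v : FuzzyNumber) (z : ℝ) {r : ℝ} (hr : 0 < r) :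
    r ≤ addGrade u v z ↔ ∃ x, r ≤ u.grade x ∧ r ≤ v.grade (z - x) := by
  constructor
  · intro h
    have husc : UpperSemicontinuous fun x : ℝ => min (u.grade x) (v.grade (z - x)) :=
      u.usc.inf (v.usc.comp (by fun_prop : Continuous fun x : ℝ => z - x))
    obtain ⟨x₀, hx₀⟩ := u.normal
    obtain ⟨m, -, hm⟩ := UpperSemicontinuousOn.exists_isMaxOn
      (s := closure {x | 0 < u.grade x}) ⟨x₀, subset_closure (by simp [hx₀])⟩ u.compact
      (husc.upperSemicontinuousOn _)
    have hle : addGrade u v z ≤ min (u.grade m) (v.grade (z - m)) := by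
      refine ciSup_le fun x => ?_
      by_cases hx : 0 < u.grade x
      · exact hm (subset_closure hx)
      · exact (min_le_left _ _).trans ((not_lt.1 hx).trans (le_min (u.nonneg _) (v.nonneg _)))
    exact ⟨m, le_min_iff.1 (h.trans hle)⟩
  · rintro ⟨x, h1, h2⟩
    exact (le_min h1 h2).trans (le_ciSup (bddAbove_addGrade u v z) x)

noncomputable instance : Add FuzzyNumber where
  add u v :=
    { grade := addGrade u v
      nonneg := addGrade_nonneg u v
      le_one := fun z => ciSup_le fun x => (min_le_left _ _).trans (u.le_one x)
      normal := by
        obtain ⟨x, hx⟩ := u.normal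
        obtain ⟨y, hy⟩ := v.normal
        refine ⟨x + y, le_antisymm
          (ciSup_le fun x => (min_le_left _ _).trans (u.le_one x)) ?_⟩
        exact (le_addGrade_iff u v _ one_pos).2 ⟨x, hx.ge, by simp [hy]⟩
      convex := by
        intro z₁ z₂ t h0 h1
        rcases le_or_gt (min (addGrade u v z₁) (addGrade u v z₂)) 0 with h | h
        · exact h.trans (addGrade_nonneg u v _)
        · obtain ⟨x₁, a₁, b₁⟩ := (le_addGrade_iff u v z₁ h).1 (min_le_left _ _)
          obtain ⟨x₂, a₂, b₂⟩ := (le_addGrade_iff u v z₂ h).1 (min_le_right _ _)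
          refine (le_addGrade_iff u v _ h).2 ⟨t * x₁ + (1 - t) * x₂,
            (le_min a₁ a₂).trans (u.convex _ _ t h0 h1), ?_⟩
          have := (le_min b₁ b₂).trans (v.convex _ _ t h0 h1)
          have e : t * z₁ + (1 - t) * z₂ - (t * x₁ + (1 - t) * x₂) =
              t * (z₁ - x₁) + (1 - t) * (z₂ - x₂) := by ring
          rw [e]
          exact this
      usc := by
        refine upperSemicontinuous_iff_isClosed_preimage.2 fun r => ?_
        rcases le_or_gt r 0 with h | h
        · convert isClosed_univ
          exact eq_univ_of_forall fun z => h.trans (addGrade_nonneg u v z)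
        · have : addGrade u v ⁻¹' Ici r = u.level r + v.level r := by
            ext z
            simp only [mem_preimage, mem_Ici, le_addGrade_iff u v z h, Set.mem_add, level,
              not_le.2 h, if_false, mem_ofPred_eq]
            constructor
            · rintro ⟨x, h1, h2⟩
              exact ⟨x, h1, z - x, h2, by ring⟩
            · rintro ⟨x, h1, y, h2, rfl⟩
              exact ⟨x, h1, by simpa using h2⟩
          rw [this]
          exact ((u.isCompact_level r).add (v.isCompact_level r)).isClosed
      compact := by
        have hK := u.compact.add v.compact
        refine hK.of_isClosed_subset isClosed_closure (closure_minimal ?_ hK.isClosed)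
        intro z hz
        obtain ⟨x, h1, h2⟩ := (le_addGrade_iff u v z hz).1 le_rfl
        exact ⟨x, subset_closure (lt_of_lt_of_le hz h1), z - x,
          subset_closure (lt_of_lt_of_le hz h2), by ring⟩ }

open Classical in
/-- Membership function of the scalar multiple (extension principle). -/
noncomputable def smulGrade (c : ℝ) (u : FuzzyNumber) (z : ℝ) : ℝ :=
  if c = 0 then (if z = 0 then 1 else 0) else u.grade (c⁻¹ * z)

noncomputable instance : SMul ℝ FuzzyNumber where
  smul c u :=
    { grade := smulGrade c u
      nonneg := fun z => by
        unfold smulGrade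
        split_ifs
        exacts [zero_le_one, le_rfl, u.nonneg _]
      le_one := fun z => by
        unfold smulGrade
        split_ifs
        exacts [le_rfl, zero_le_one, u.le_one _]
      normal := by
        by_cases hc : c = 0
        · exact ⟨0, by simp [smulGrade, hc]⟩
        · obtain ⟨x, hx⟩ := u.normal
          exact ⟨c * x, by simp [smulGrade, hc, hx]⟩
      convex := by
        intro x y t h0 h1
        by_cases hc : c = 0
        · by_cases hx : x = 0
          · by_cases hy : y = 0
            · simp [smulGrade, hc, hx, hy]
            · simp only [smulGrade, hc, hy, if_true, if_false]
              refine (min_le_right _ _).trans ?_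
              split_ifs <;> norm_num
          · simp only [smulGrade, hc, hx, if_true, if_false]
            refine (min_le_left _ _).trans ?_
            split_ifs <;> norm_num
        · simp only [smulGrade, hc, if_false]
          have e : c⁻¹ * (t * x + (1 - t) * y) = t * (c⁻¹ * x) + (1 - t) * (c⁻¹ * y) := by ring
          rw [e]
          exact u.convex (c⁻¹ * x) (c⁻¹ * y) t h0 h1
      usc := by
        by_cases hc : c = 0
        · have : smulGrade c u = ({0} : Set ℝ).indicator fun _ => (1 : ℝ) := by
            funext z
            simp [smulGrade, hc, indicator]
          rw [this]
          exact isClosed_singleton.upperSemicontinuous_indicator zero_le_one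
        · have : smulGrade c u = u.grade ∘ fun z => c⁻¹ * z := by
            funext z
            simp [smulGrade, hc]
          rw [this]
          exact u.usc.comp (by fun_prop)
      compact := by
        by_cases hc : c = 0
        · refine (isCompact_singleton (x := (0 : ℝ))).of_isClosed_subset isClosed_closure
            (closure_minimal ?_ isClosed_singleton)
          intro z hz
          by_contra h
          have h' : z ≠ 0 := h
          simp [smulGrade, hc, h'] at hz
        · have hK : IsCompact ((fun x : ℝ => c * x) '' closure {x | 0 < u.grade x}) :=
            u.compact.image (by fun_prop)
          refine hK.of_isClosed_subset isClosed_closure (closure_minimal ?_ hK.isClosed)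
          intro z hz
          simp only [smulGrade, hc, if_false, mem_ofPred_eq] at hz
          exact ⟨c⁻¹ * z, subset_closure hz, by field_simp⟩ }

/-- `w` is the generalized Hukuhara difference of `p` and `q`. -/
def IsGHDiff (p q w : FuzzyNumber) : Prop :=
  p = q + w ∨ q = p + (-1 : ℝ) • w

/-- `L` is the gH-derivative at `x` of `f : s → FuzzyNumber`: the gH-differences `f x' ⊖ f x` exist
for `x'` near `x` and `(f x' ⊖ f x) / (x' - x)` converges to `L`. -/
def HasGHDerivWithin (f : ℝ → FuzzyNumber) (s : Set ℝ) (x : ℝ) (L : FuzzyNumber) : Prop :=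
  ∃ w : ℝ → FuzzyNumber,
    (∀ᶠ x' in 𝓝[s \ {x}] x, IsGHDiff (f x') (f x) (w x')) ∧
    Tendsto (fun x' => (x' - x)⁻¹ • w x') (𝓝[s \ {x}] x) (𝓝 L)

/-- `L` is the gH-derivative and it is of type (i): `[L]^r = [(f₋)', (f₊)']`. -/
def HasGHDerivWithinI (f : ℝ → FuzzyNumber) (s : Set ℝ) (x : ℝ) (L : FuzzyNumber) : Prop :=
  HasGHDerivWithin f s x L ∧ ∀ r ∈ Icc (0 : ℝ) 1,
    HasDerivWithinAt (fun x' => (f x').lo r) (L.lo r) s x ∧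
    HasDerivWithinAt (fun x' => (f x').hi r) (L.hi r) s x

/-- `L` is the gH-derivative and it is of type (ii): `[L]^r = [(f₊)', (f₋)']`. -/
def HasGHDerivWithinII (f : ℝ → FuzzyNumber) (s : Set ℝ) (x : ℝ) (L : FuzzyNumber) : Prop :=
  HasGHDerivWithin f s x L ∧ ∀ r ∈ Icc (0 : ℝ) 1,
    HasDerivWithinAt (fun x' => (f x').hi r) (L.lo r) s x ∧
    HasDerivWithinAt (fun x' => (f x').lo r) (L.hi r) s x

/-- The half-open rectangle `(0,a] × (0,b]`. -/
def rect (a b : ℝ) : Set (ℝ × ℝ) := Ioc 0 a ×ˢ Ioc 0 b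

/-- `V t` is the gH-partial derivative `∂U/∂x` at `(x, t)`, for all `t` in a neighbourhood of `y`
in `(0,b]`. -/
def HasGHPartialX (a b : ℝ) (U : ℝ × ℝ → FuzzyNumber) (p : ℝ × ℝ) (V : ℝ → FuzzyNumber) : Prop :=
  ∀ᶠ t in 𝓝[Ioc 0 b] p.2, HasGHDerivWithin (fun x => U (x, t)) (Ioc 0 a) p.1 (V t)

/-- `L` is the mixed second order gH-derivative of `U : (0,a] × (0,b] → FuzzyNumber` at `p`, the
gH-derivative in `y` of `∂U/∂x`. -/
def HasMixedGHDeriv (a b : ℝ) (U : ℝ × ℝ → FuzzyNumber) (p : ℝ × ℝ) (L : FuzzyNumber) : Prop :=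
  ∃ V : ℝ → FuzzyNumber, HasGHPartialX a b U p V ∧ HasGHDerivWithin V (Ioc 0 b) p.2 L

/-- The mixed gH-derivative is of the first kind: `U` (in `x`) and `∂U/∂x` (in `y`) have the same
type of gH-differentiability at `p`. -/
def HasMixedGHDerivSame (a b : ℝ) (U : ℝ × ℝ → FuzzyNumber) (p : ℝ × ℝ) (L : FuzzyNumber) :
    Prop :=
  ∃ V : ℝ → FuzzyNumber, HasGHPartialX a b U p V ∧
    ((HasGHDerivWithinI (fun x => U (x, p.2)) (Ioc 0 a) p.1 (V p.2) ∧
        HasGHDerivWithinI V (Ioc 0 b) p.2 L) ∨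
      (HasGHDerivWithinII (fun x => U (x, p.2)) (Ioc 0 a) p.1 (V p.2) ∧
        HasGHDerivWithinII V (Ioc 0 b) p.2 L))

/-- The mixed gH-derivative is of the second kind: `U` (in `x`) and `∂U/∂x` (in `y`) have different
types of gH-differentiability at `p`. -/
def HasMixedGHDerivDiff (a b : ℝ) (U : ℝ × ℝ → FuzzyNumber) (p : ℝ × ℝ) (L : FuzzyNumber) :
    Prop :=
  ∃ V : ℝ → FuzzyNumber, HasGHPartialX a b U p V ∧
    ((HasGHDerivWithinI (fun x => U (x, p.2)) (Ioc 0 a) p.1 (V p.2) ∧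
        HasGHDerivWithinII V (Ioc 0 b) p.2 L) ∨
      (HasGHDerivWithinII (fun x => U (x, p.2)) (Ioc 0 a) p.1 (V p.2) ∧
        HasGHDerivWithinI V (Ioc 0 b) p.2 L))

/-- `U` is d-monotone: all level diameters are nondecreasing on the rectangle, or all are
nonincreasing. -/
def DMonotone (a b : ℝ) (U : ℝ × ℝ → FuzzyNumber) : Prop :=
  (∀ r ∈ Icc (0 : ℝ) 1, MonotoneOn (fun p => (U p).diam r) (rect a b)) ∨
  (∀ r ∈ Icc (0 : ℝ) 1, AntitoneOn (fun p => (U p).diam r) (rect a b))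

/-- Absolute continuity (in the sense of Carathéodory) on `[0,a] × [0,b]`: for all finite families
of non-overlapping rectangles `[p₁,q₁] × [p₂,q₂]` of small total area the sum of the mixed
increments is small, and the two restrictions to the axes are absolutely continuous. -/
def AbsCont (a b : ℝ) (U : ℝ × ℝ → FuzzyNumber) : Prop :=
  (∀ ε > 0, ∃ δ > 0, ∀ (n : ℕ) (p q : Fin n → ℝ × ℝ),
    (∀ i, 0 ≤ (p i).1 ∧ (p i).1 ≤ (q i).1 ∧ (q i).1 ≤ a ∧
      0 ≤ (p i).2 ∧ (p i).2 ≤ (q i).2 ∧ (q i).2 ≤ b) →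
    Pairwise (fun i j => Disjoint (Ioo (p i).1 (q i).1 ×ˢ Ioo (p i).2 (q i).2)
      (Ioo (p j).1 (q j).1 ×ˢ Ioo (p j).2 (q j).2)) →
    ∑ i, ((q i).1 - (p i).1) * ((q i).2 - (p i).2) < δ →
    ∑ i, dist (U (q i) + U (p i)) (U ((p i).1, (q i).2) + U ((q i).1, (p i).2)) < ε) ∧
  AbsolutelyContinuousOnInterval (fun x => U (x, 0)) 0 a ∧
  AbsolutelyContinuousOnInterval (fun y => U (0, y)) 0 b

/-- `w` is the Lebesgue integral of the fuzzy function `U` over `S ⊆ ℝ²`, defined levelwise. -/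
def HasFuzzyIntegral (S : Set (ℝ × ℝ)) (U : ℝ × ℝ → FuzzyNumber) (w : FuzzyNumber) : Prop :=
  ∀ r ∈ Icc (0 : ℝ) 1,
    IntegrableOn (fun q => (U q).lo r) S ∧ IntegrableOn (fun q => (U q).hi r) S ∧
    w.lo r = ∫ q in S, (U q).lo r ∧ w.hi r = ∫ q in S, (U q).hi r

/-- `w` is the mixed Katugampola fuzzy fractional integral of `U` of order `α = (α₁, α₂)` at
`p = (x, y)`. -/
def HasKatugampolaIntegral (α ρ : ℝ × ℝ) (U : ℝ × ℝ → FuzzyNumber) (p : ℝ × ℝ)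
    (w : FuzzyNumber) : Prop :=
  ∃ v : FuzzyNumber,
    HasFuzzyIntegral (Ioo 0 p.1 ×ˢ Ioo 0 p.2)
      (fun q => (q.1 ^ (ρ.1 - 1) * q.2 ^ (ρ.2 - 1) /
        ((p.1 ^ ρ.1 - q.1 ^ ρ.1) ^ (1 - α.1) * (p.2 ^ ρ.2 - q.2 ^ ρ.2) ^ (1 - α.2))) • U q) v ∧
    w = (ρ.1 ^ (1 - α.1) * ρ.2 ^ (1 - α.2) / (Real.Gamma α.1 * Real.Gamma α.2)) • v

/-- `K` is the mixed fuzzy Katugampola gH-fractional derivative of `U` of order `φ` at `p`. -/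
def HasKatugampolaDeriv (φ ρ : ℝ × ℝ) (a b : ℝ) (U : ℝ × ℝ → FuzzyNumber) (p : ℝ × ℝ)
    (K : FuzzyNumber) : Prop :=
  ∃ (J : ℝ × ℝ → FuzzyNumber) (L : FuzzyNumber),
    (∀ q ∈ rect a b, HasKatugampolaIntegral (1 - φ) ρ U q (J q)) ∧
    HasMixedGHDeriv a b J p L ∧
    K = (p.1 ^ (1 - ρ.1) * p.2 ^ (1 - ρ.2)) • L

/-- `K` is the mixed fuzzy Caputo-Katugampola gH-fractional derivative of `U` of order `φ` at `p`:
the Katugampola derivative of `W(x,y) = U(x,y) ⊖ U(x,0) ⊖ U(0,y) + U(0,0)`, where the right-hand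
side is read as the gH-difference of `U(x,y) + U(0,0)` and `U(x,0) + U(0,y)`. -/
def HasCaputoKatugampolaDeriv (φ ρ : ℝ × ℝ) (a b : ℝ) (U : ℝ × ℝ → FuzzyNumber) (p : ℝ × ℝ)
    (K : FuzzyNumber) : Prop :=
  ∃ W : ℝ × ℝ → FuzzyNumber,
    (∀ q ∈ rect a b, IsGHDiff (U q + U (0, 0)) (U (q.1, 0) + U (0, q.2)) (W q)) ∧
    HasKatugampolaDeriv φ ρ a b W p K

/-- With `D` the mixed gH-derivative of `U`, at the point `p = (x, y)` the Caputo-Katugampola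
gH-derivative of `U` exists in `Ê` and equals the Katugampola integral of order `1 - φ` of
`x ^ (1 - ρ₁) y ^ (1 - ρ₂) D`, which exists too and is given by the explicit double integral. -/
def CaputoKatugampolaFormula (φ ρ : ℝ × ℝ) (a b : ℝ) (U D : ℝ × ℝ → FuzzyNumber) (p : ℝ × ℝ) :
    Prop :=
  ∃ K : FuzzyNumber, K.LevelContinuous ∧
    HasCaputoKatugampolaDeriv φ ρ a b U p K ∧
    HasKatugampolaIntegral (1 - φ) ρ
      (fun q => (q.1 ^ (1 - ρ.1) * q.2 ^ (1 - ρ.2)) • D q) p K ∧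
    ∃ v : FuzzyNumber,
      HasFuzzyIntegral (Ioo 0 p.1 ×ˢ Ioo 0 p.2)
        (fun q => (1 / ((p.1 ^ ρ.1 - q.1 ^ ρ.1) ^ φ.1 * (p.2 ^ ρ.2 - q.2 ^ ρ.2) ^ φ.2)) • D q) v ∧
      K = (ρ.1 ^ φ.1 * ρ.2 ^ φ.2 / (Real.Gamma (1 - φ.1) * Real.Gamma (1 - φ.2))) • v

end FuzzyNumber

/-! For each level `r`, the end points of `υ` are real functions whose mixed increments over
rectangles are absolutely continuous, so these increments are integrals of an L¹ density. The
density is the limit of the increment quotients over dyadic cells: they form a martingale, and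
absolute continuity makes it uniformly integrable (`exists_density_of_nested_partitions`,
`MixedAbsCont.exists_density`). Iterated Lebesgue differentiation (`ae_hasMixedIntegralDeriv`) shows
that a mixed derivative existing almost everywhere equals this density, so the end points of `D` are
measurable and integrable without further assumptions.

A gH-derivative only determines the unordered pair of slopes of the end points. Monotone diameters
fix the order of the x-derivatives, and the constant kind (same or different types) then fixes the
order of the mixed derivatives. If the type at a point contradicts the order given by the diameters,
the level of the mixed derivative is a single point and the order is irrelevant. Hence the
gH-difference `W` in the Caputo derivative is the double integral of `D` over (0,x) × (0,y)
(`AbsCont.isGHDiff_integral`).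

The formula then rests on the fact that two kernels have the same total mass: in each variable ∫_s^x
σ^(ρ-1) (x^ρ - σ^ρ)^(-φ) dσ = (x^ρ - s^ρ)^(1-φ) / (ρ(1-φ)) = ∫_s^x σ^(ρ-1) (σ^ρ - s^ρ)^(-φ) dσ. By
Fubini, the Katugampola integral J of W (left kernel applied to ∫∫ D) is therefore the plain double
integral of G = `caputoDensity` (right kernel applied to `D`). The mixed derivative of J is G, and
the factor x^(1-ρ₁) y^(1-ρ₂) cancels the powers in G, leaving the claimed integral.

Increments of a fuzzy double integral are integrals over strips, hence Hukuhara differences, so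
gH-differentiability of J reduces to that of its end points (`FuzzyIntegrable.hasMixedGHDeriv`).
These are monotone in the level and the limit is continuous in it, so convergence at rational levels
suffices and only countably many null sets occur. When `D` is continuous and bounded, rescaling to
the unit square makes the end points of G continuous and bounded, and the fundamental theorem of
calculus replaces Lebesgue differentiation at every point. -/

/-! ### Uniform convergence from rational levels -/

/-- A family of functions monotone on `[0,1]` which converges at the rational points of `[0,1]` to
a continuous function converges uniformly. -/
theorem MonotoneOn.eventually_abs_sub_le {ι : Type*} {F : Filter ι} {f : ι → ℝ → ℝ} {g : ℝ → ℝ}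
    (hf : ∀ i, MonotoneOn (f i) (Icc 0 1)) (hg : ContinuousOn g (Icc 0 1))
    (h : ∀ q : ℚ, (q : ℝ) ∈ Icc (0 : ℝ) 1 → Tendsto (fun i => f i q) F (𝓝 (g q)))
    {ε : ℝ} (hε : 0 < ε) : ∀ᶠ i in F, ∀ r ∈ Icc (0 : ℝ) 1, |f i r - g r| ≤ ε := by
  obtain ⟨δ, hδ, hgδ⟩ := Metric.uniformContinuousOn_iff.1
    (isCompact_Icc.uniformContinuousOn_of_continuous hg) (ε / 2) (half_pos hε)
  -- A grid of mesh 1/(N+1) < δ with rational nodes: convergence at finitely many nodes costs ε/2,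
  -- the oscillation of `g` over a cell another ε/2, and monotonicity traps `f i r` between
  -- neighbouring nodes.
  obtain ⟨N, hN⟩ := exists_nat_one_div_lt hδ
  have hN0 : (0 : ℝ) < N + 1 := by positivity
  have hmem : ∀ k ∈ Finset.range (N + 2), ((k : ℝ) / (N + 1)) ∈ Icc (0 : ℝ) 1 := by
    intro k hk
    have : (k : ℝ) ≤ N + 1 := by exact_mod_cast Nat.lt_succ_iff.1 (Finset.mem_range.1 hk)
    exact ⟨by positivity, (div_le_one hN0).2 this⟩
  have hev : ∀ᶠ i in F, ∀ k ∈ Finset.range (N + 2),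
      |f i ((k : ℝ) / (N + 1)) - g ((k : ℝ) / (N + 1))| < ε / 2 := by
    refine (Finset.eventually_all _).2 fun k hk => ?_
    have h1 := h ((k : ℚ) / (N + 1)) (by push_cast; exact hmem k hk)
    push_cast at h1
    simpa [Real.dist_eq] using Metric.tendsto_nhds.1 h1 (ε / 2) (half_pos hε)
  filter_upwards [hev] with i hi r hr
  -- The node `r = 1` is treated apart, since the cell found by the floor would need a right
  -- neighbour beyond the grid.
  rcases hr.2.eq_or_lt with rfl | hr1
  · have := hi (N + 1) (by simp)
    push_cast at this
    rw [div_self hN0.ne'] at this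
    linarith
  · have hk1 : (⌊r * (N + 1)⌋₊ : ℝ) ≤ r * (N + 1) := Nat.floor_le (by have := hr.1; positivity)
    have hk2 : r * (N + 1) < ⌊r * (N + 1)⌋₊ + 1 := Nat.lt_floor_add_one _
    set k := ⌊r * (N + 1)⌋₊
    have hkN : k < N + 1 := by
      have : (k : ℝ) < (N + 1 : ℕ) := by push_cast; nlinarith
      exact_mod_cast this
    have m1 := hmem k (Finset.mem_range.2 (by omega))
    have m2 := hmem (k + 1) (Finset.mem_range.2 (by omega))
    have b1 := hi k (Finset.mem_range.2 (by omega))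
    have b2 := hi (k + 1) (Finset.mem_range.2 (by omega))
    have l1 : (k : ℝ) / (N + 1) ≤ r := (div_le_iff₀ hN0).2 hk1
    have l2 : r ≤ ((k + 1 : ℕ) : ℝ) / (N + 1) := (le_div_iff₀ hN0).2 (by push_cast; linarith)
    have l3 : ((k + 1 : ℕ) : ℝ) / (N + 1) - (k : ℝ) / (N + 1) < δ := by
      have : ((k + 1 : ℕ) : ℝ) / (N + 1) - (k : ℝ) / (N + 1) = 1 / (N + 1) := by
        push_cast; ring
      rw [this]; exact hN
    have c1 := hgδ _ m1 r hr (by rw [Real.dist_eq, abs_lt]; constructor <;> linarith)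
    have c2 := hgδ _ m2 r hr (by rw [Real.dist_eq, abs_lt]; constructor <;> linarith)
    rw [Real.dist_eq] at c1 c2
    have f1 := hf i m1 hr l1
    have f2 := hf i hr m2 l2
    rw [abs_lt] at b1 b2 c1 c2
    rw [abs_le]
    constructor <;> linarith

/-! ### End points of level sets, the supremum metric and gH-derivatives -/

namespace FuzzyNumber

open scoped Pointwise

theorem level_antitone (u : FuzzyNumber) {r s : ℝ} (h : r ≤ s) : u.level s ⊆ u.level r := by
  by_cases hr : r ≤ 0
  · intro x hx
    have := u.level_subset s hx
    simpa [level, hr] using this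
  · intro x hx
    have hs : ¬ s ≤ 0 := fun h' => hr (h.trans h')
    simp only [level, hr, hs, if_false, mem_ofPred_eq] at hx ⊢
    exact h.trans hx

theorem lo_mono (u : FuzzyNumber) {r s : ℝ} (h : r ≤ s) (hs : s ≤ 1) : u.lo r ≤ u.lo s :=
  csInf_le_csInf (u.isCompact_level r).bddBelow (u.level_nonempty hs) (u.level_antitone h)

theorem hi_anti (u : FuzzyNumber) {r s : ℝ} (h : r ≤ s) (hs : s ≤ 1) : u.hi s ≤ u.hi r :=
  csSup_le_csSup (u.isCompact_level r).bddAbove (u.level_nonempty hs) (u.level_antitone h)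

theorem lo_le_hi (u : FuzzyNumber) {r : ℝ} (h : r ≤ 1) : u.lo r ≤ u.hi r :=
  csInf_le_csSup (u.level_nonempty h) (u.isCompact_level r).bddBelow (u.isCompact_level r).bddAbove

theorem monotoneOn_lo (u : FuzzyNumber) : MonotoneOn u.lo (Icc 0 1) :=
  fun _ _ _ hs h => u.lo_mono h hs.2

theorem antitoneOn_hi (u : FuzzyNumber) : AntitoneOn u.hi (Icc 0 1) :=
  fun _ _ _ hs h => u.hi_anti h hs.2

theorem eq_of_ends {p q : FuzzyNumber}
    (h : ∀ r ∈ Icc (0 : ℝ) 1, p.lo r = q.lo r ∧ p.hi r = q.hi r) : p = q := by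
  ext x
  exact le_antisymm (grade_le_of_ends (fun r => h r r.2) x)
    (grade_le_of_ends (fun r => ⟨(h r r.2).1.symm, (h r r.2).2.symm⟩) x)

theorem smul_grade (u : FuzzyNumber) {c : ℝ} (hc : c ≠ 0) (z : ℝ) :
    (c • u).grade z = u.grade (c⁻¹ * z) := by
  change smulGrade c u z = _
  simp [smulGrade, hc]

theorem level_smul (u : FuzzyNumber) {c : ℝ} (hc : c ≠ 0) (r : ℝ) :
    (c • u).level r = c • u.level r := by
  by_cases hr : r ≤ 0
  · simp only [level, hr, if_true, ← closure_smul₀' hc]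
    congr 1
    ext z
    simp [mem_smul_set_iff_inv_smul_mem₀ hc, smul_grade u hc]
  · simp only [level, hr, if_false]
    ext z
    simp [mem_smul_set_iff_inv_smul_mem₀ hc, smul_grade u hc]

theorem lo_smul_of_pos (u : FuzzyNumber) {c : ℝ} (hc : 0 < c) (r : ℝ) :
    (c • u).lo r = c * u.lo r := by
  rw [lo, level_smul u hc.ne', Real.sInf_smul_of_nonneg hc.le]; rfl

theorem hi_smul_of_pos (u : FuzzyNumber) {c : ℝ} (hc : 0 < c) (r : ℝ) :
    (c • u).hi r = c * u.hi r := by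
  rw [hi, level_smul u hc.ne', Real.sSup_smul_of_nonneg hc.le]; rfl

theorem lo_smul_of_neg (u : FuzzyNumber) {c : ℝ} (hc : c < 0) (r : ℝ) :
    (c • u).lo r = c * u.hi r := by
  rw [lo, level_smul u hc.ne, Real.sInf_smul_of_nonpos hc.le]; rfl

theorem hi_smul_of_neg (u : FuzzyNumber) {c : ℝ} (hc : c < 0) (r : ℝ) :
    (c • u).hi r = c * u.lo r := by
  rw [hi, level_smul u hc.ne, Real.sSup_smul_of_nonpos hc.le]; rfl

theorem add_grade (u v : FuzzyNumber) (z : ℝ) : (u + v).grade z = addGrade u v z := rfl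

theorem level_add_of_pos (u v : FuzzyNumber) {r : ℝ} (hr : 0 < r) :
    (u + v).level r = u.level r + v.level r := by
  ext z
  simp only [level, not_le.2 hr, if_false, mem_ofPred_eq, add_grade, le_addGrade_iff u v z hr,
    Set.mem_add]
  constructor
  · rintro ⟨x, h1, h2⟩
    exact ⟨x, h1, z - x, h2, by ring⟩
  · rintro ⟨x, h1, y, h2, rfl⟩
    exact ⟨x, h1, by simpa using h2⟩

theorem support_add (u v : FuzzyNumber) :
    {z | 0 < (u + v).grade z} = {z | 0 < u.grade z} + {z | 0 < v.grade z} := by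
  ext z
  simp only [mem_ofPred_eq, add_grade, Set.mem_add]
  constructor
  · intro hz
    obtain ⟨x, h1, h2⟩ := (le_addGrade_iff u v z hz).1 le_rfl
    exact ⟨x, hz.trans_le h1, z - x, hz.trans_le h2, by ring⟩
  · rintro ⟨x, h1, y, h2, rfl⟩
    have := (le_addGrade_iff u v (x + y) (lt_min h1 h2)).2
      ⟨x, min_le_left _ _, by simp⟩
    exact (lt_min h1 h2).trans_le this

/-- The level at 0 is a closure rather than a superlevel set, so it needs its own argument: the sum
of two compact sets is closed, and addition is continuous. -/
theorem closure_support_add (u v : FuzzyNumber) :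
    closure {z | 0 < (u + v).grade z} =
      closure {z | 0 < u.grade z} + closure {z | 0 < v.grade z} := by
  rw [support_add]
  apply Subset.antisymm
  · exact closure_minimal (Set.add_subset_add subset_closure subset_closure)
      (u.compact.add v.compact).isClosed
  · rintro _ ⟨x, hx, y, hy, rfl⟩
    exact map_mem_closure₂ continuous_add hx hy fun a ha b hb => Set.add_mem_add ha hb

theorem level_add (u v : FuzzyNumber) (r : ℝ) :
    (u + v).level r = u.level r + v.level r := by
  by_cases hr : r ≤ 0
  · simpa only [level, hr, if_true] using closure_support_add u v
  · exact level_add_of_pos u v (not_le.1 hr)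

theorem lo_add (u v : FuzzyNumber) {r : ℝ} (hr : r ≤ 1) : (u + v).lo r = u.lo r + v.lo r := by
  rw [lo, level_add, csInf_add (u.level_nonempty hr) (u.isCompact_level r).bddBelow
    (v.level_nonempty hr) (v.isCompact_level r).bddBelow]; rfl

theorem hi_add (u v : FuzzyNumber) {r : ℝ} (hr : r ≤ 1) : (u + v).hi r = u.hi r + v.hi r := by
  rw [hi, level_add, csSup_add (u.level_nonempty hr) (u.isCompact_level r).bddAbove
    (v.level_nonempty hr) (v.isCompact_level r).bddAbove]; rfl

/-- A level-continuous fuzzy number with prescribed end points of its level sets. -/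
theorem exists_ofEnds {l h : ℝ → ℝ} (hl : MonotoneOn l (Icc 0 1)) (hh : AntitoneOn h (Icc 0 1))
    (hlh : l 1 ≤ h 1) (hlc : ContinuousOn l (Icc 0 1)) (hhc : ContinuousOn h (Icc 0 1)) :
    ∃ u : FuzzyNumber, ∀ r ∈ Icc (0 : ℝ) 1, u.lo r = l r ∧ u.hi r = h r := by
  have i0 : (0 : ℝ) ∈ Icc (0 : ℝ) 1 := by simp
  have i1 : (1 : ℝ) ∈ Icc (0 : ℝ) 1 := by simp
  have hle : ∀ r ∈ Icc (0 : ℝ) 1, l r ≤ h r := fun r hr =>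
    (hl hr i1 hr.2).trans (hlh.trans (hh hr i1 hr.2))
  -- The grade of `x` is the supremum of the levels whose prescribed interval contains `x`.
  -- Monotonicity makes `T x` downward closed and continuity makes it closed, so its supremum
  -- determines it up to the level 0.
  let T : ℝ → Set ℝ := fun x => {r ∈ Icc (0 : ℝ) 1 | l r ≤ x ∧ x ≤ h r}
  have hTb : ∀ x, BddAbove (T x) := fun x => ⟨1, fun r hr => hr.1.2⟩
  have hTdown : ∀ x r s, r ∈ Icc (0 : ℝ) 1 → r ≤ s → s ∈ T x → r ∈ T x := fun x r s hr hrs hs =>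
    ⟨hr, (hl hr hs.1 hrs).trans hs.2.1, hs.2.2.trans (hh hr hs.1 hrs)⟩
  have hTc : ∀ x, IsClosed (T x) := by
    intro x
    have e : T x = (Icc 0 1 ∩ l ⁻¹' Iic x) ∩ (Icc 0 1 ∩ h ⁻¹' Ici x) := by
      ext r
      simp only [T, mem_ofPred_eq, mem_inter_iff, mem_preimage, mem_Iic, mem_Ici]
      tauto
    rw [e]
    exact (hlc.preimage_isClosed_of_isClosed isClosed_Icc isClosed_Iic).inter
      (hhc.preimage_isClosed_of_isClosed isClosed_Icc isClosed_Ici)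
  have key : ∀ x r, r ∈ Ioc (0 : ℝ) 1 → (r ≤ sSup (T x) ↔ r ∈ T x) := by
    intro x r hr
    constructor
    · intro h1
      have hne : (T x).Nonempty := by
        -- The supremum of the empty set is 0 by convention, which is incompatible with `0 < r`.
        by_contra hn
        rw [not_nonempty_iff_eq_empty.1 hn, Real.sSup_empty] at h1
        exact absurd hr.1 (not_lt.2 h1)
      exact hTdown x r _ ⟨hr.1.le, hr.2⟩ h1 ((hTc x).csSup_mem hne (hTb x))
    · exact fun h1 => le_csSup (hTb x) h1
  have nonneg : ∀ x, 0 ≤ sSup (T x) := fun x => Real.sSup_nonneg fun r hr => hr.1.1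
  have le_one : ∀ x, sSup (T x) ≤ 1 := fun x => Real.sSup_le (fun r hr => hr.1.2) zero_le_one
  have hsupp : ∀ x, 0 < sSup (T x) → x ∈ Icc (l 0) (h 0) := fun x hx =>
    (hTdown x 0 _ i0 (nonneg x) ((key x _ ⟨hx, le_one x⟩).1 le_rfl)).2
  let u : FuzzyNumber :=
    { grade := fun x => sSup (T x)
      nonneg := nonneg
      le_one := le_one
      normal := ⟨l 1, le_antisymm (le_one _) ((key _ _ ⟨one_pos, le_rfl⟩).2 ⟨i1, le_rfl, hlh⟩)⟩
      convex := by
        intro x y t h0 h1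
        rcases le_or_gt (min (sSup (T x)) (sSup (T y))) 0 with hm | hm
        · exact hm.trans (nonneg _)
        · have hm1 := (min_le_left _ (sSup (T y))).trans (le_one x)
          have a := (key x _ ⟨hm, hm1⟩).1 (min_le_left _ _)
          have b := (key y _ ⟨hm, hm1⟩).1 (min_le_right _ _)
          exact (key _ _ ⟨hm, hm1⟩).2 ⟨a.1, by nlinarith [a.2.1, b.2.1], by nlinarith [a.2.2, b.2.2]⟩
      usc := by
        refine upperSemicontinuous_iff_isClosed_preimage.2 fun r => ?_
        rcases le_or_gt r 0 with hr | hr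
        · convert isClosed_univ
          exact eq_univ_of_forall fun z => hr.trans (nonneg z)
        · rcases le_or_gt r 1 with hr1 | hr1
          · have : (fun x => sSup (T x)) ⁻¹' Ici r = Icc (l r) (h r) := by
              ext x
              rw [mem_preimage, mem_Ici, key x r ⟨hr, hr1⟩]
              exact ⟨fun h => h.2, fun h => ⟨⟨hr.le, hr1⟩, h⟩⟩
            rw [this]
            exact isClosed_Icc
          · convert isClosed_empty
            exact eq_empty_of_forall_notMem fun z hz => absurd (hr1.trans_le hz) (not_lt.2 (le_one z))
      compact := isCompact_Icc.of_isClosed_subset isClosed_closure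
        (closure_minimal hsupp isClosed_Icc) }
  have hlev : ∀ r ∈ Ioc (0 : ℝ) 1, u.level r = Icc (l r) (h r) := by
    intro r hr
    ext x
    simp only [level, not_le.2 hr.1, if_false]
    exact (key x r hr).trans ⟨fun h => h.2, fun h => ⟨⟨hr.1.le, hr.2⟩, h⟩⟩
  have hlev0 : u.level 0 = closure {x | 0 < u.grade x} := by simp [level]
  have hnb : (𝓝[Ioc (0 : ℝ) 1] 0).NeBot := by
    rw [← mem_closure_iff_nhdsWithin_neBot, closure_Ioc zero_ne_one]; exact i0
  have hsub : closure {x | 0 < u.grade x} ⊆ Icc (l 0) (h 0) := closure_minimal hsupp isClosed_Icc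
  refine ⟨u, fun r hr => ?_⟩
  -- At `r = 0` the level is the closed support; its ends are reached as limits of the ends at
  -- levels r → 0+.
  rcases hr.1.eq_or_lt with rfl | hr0
  · constructor
    · refine le_antisymm ?_ ?_
      · refine ge_of_tendsto (f := l) (x := 𝓝[Ioc (0 : ℝ) 1] 0)
          ((hlc 0 i0).mono Ioc_subset_Icc_self) ?_
        filter_upwards [self_mem_nhdsWithin] with r hr
        refine csInf_le (u.isCompact_level 0).bddBelow (u.level_antitone hr.1.le ?_)
        rw [hlev r hr]
        exact ⟨le_rfl, hle r ⟨hr.1.le, hr.2⟩⟩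
      · exact le_csInf (u.level_nonempty zero_le_one) fun x hx => (hsub (hlev0 ▸ hx)).1
    · refine le_antisymm ?_ ?_
      · exact csSup_le (u.level_nonempty zero_le_one) fun x hx => (hsub (hlev0 ▸ hx)).2
      · refine le_of_tendsto (f := h) (x := 𝓝[Ioc (0 : ℝ) 1] 0)
          ((hhc 0 i0).mono Ioc_subset_Icc_self) ?_
        filter_upwards [self_mem_nhdsWithin] with r hr
        refine le_csSup (u.isCompact_level 0).bddAbove (u.level_antitone hr.1.le ?_)
        rw [hlev r hr]
        exact ⟨hle r ⟨hr.1.le, hr.2⟩, le_rfl⟩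
  · rw [lo, hi, hlev r ⟨hr0, hr.2⟩, csInf_Icc (hle r hr), csSup_Icc (hle r hr)]
    exact ⟨rfl, rfl⟩

instance : Nonempty FuzzyNumber := by
  obtain ⟨u, -⟩ := exists_ofEnds (l := fun _ => 0) (h := fun _ => 0) (monotone_const.monotoneOn _)
    (antitone_const.antitoneOn _) le_rfl continuousOn_const continuousOn_const
  exact ⟨u⟩

theorem abs_lo_sub_le (p q : FuzzyNumber) {r : ℝ} (hr : r ∈ Icc (0 : ℝ) 1) :
    |p.lo r - q.lo r| ≤ dist p q := (le_max_left _ _).trans (le_dist p q ⟨r, hr⟩)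

theorem abs_hi_sub_le (p q : FuzzyNumber) {r : ℝ} (hr : r ∈ Icc (0 : ℝ) 1) :
    |p.hi r - q.hi r| ≤ dist p q := (le_max_right _ _).trans (le_dist p q ⟨r, hr⟩)

theorem lipschitzWith_lo {r : ℝ} (hr : r ∈ Icc (0 : ℝ) 1) :
    LipschitzWith 1 fun u : FuzzyNumber => u.lo r :=
  LipschitzWith.of_dist_le_mul fun p q => by simpa [Real.dist_eq] using abs_lo_sub_le p q hr

theorem lipschitzWith_hi {r : ℝ} (hr : r ∈ Icc (0 : ℝ) 1) :
    LipschitzWith 1 fun u : FuzzyNumber => u.hi r :=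
  LipschitzWith.of_dist_le_mul fun p q => by simpa [Real.dist_eq] using abs_hi_sub_le p q hr

/-- Convergence of the end points at the rational levels to those of a level-continuous fuzzy
number implies convergence in the supremum metric. -/
theorem tendsto_of_ends {ι : Type*} {F : Filter ι} {w : ι → FuzzyNumber} {L : FuzzyNumber}
    (hL : L.LevelContinuous)
    (h : ∀ q : ℚ, (q : ℝ) ∈ Icc (0 : ℝ) 1 → Tendsto (fun i => (w i).lo q) F (𝓝 (L.lo q)) ∧
      Tendsto (fun i => (w i).hi q) F (𝓝 (L.hi q))) : Tendsto w F (𝓝 L) := by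
  refine Metric.tendsto_nhds.2 fun ε hε => ?_
  have h1 := MonotoneOn.eventually_abs_sub_le (fun i => (w i).monotoneOn_lo) hL.1
    (fun q hq => (h q hq).1) (half_pos hε)
  have h2 := MonotoneOn.eventually_abs_sub_le (fun i => (w i).antitoneOn_hi.neg) hL.2.neg
    (fun q hq => (h q hq).2.neg) (half_pos hε)
  filter_upwards [h1, h2] with i a b
  refine lt_of_le_of_lt ?_ (half_lt_self hε)
  have : Nonempty (Icc (0 : ℝ) 1) := ⟨⟨0, by simp⟩⟩
  refine ciSup_le fun r => max_le (a r r.2) ?_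
  have := b r r.2
  rw [abs_sub_comm]
  rw [Pi.neg_apply, neg_sub_neg] at this
  exact this

/-- Convergence in the supremum metric is uniform convergence of the end point functions, which
preserves continuity. This is what keeps gH-derivatives in Ê. -/
theorem LevelContinuous.of_tendsto {ι : Type*} {F : Filter ι} [F.NeBot] {w : ι → FuzzyNumber}
    {L : FuzzyNumber} (hw : ∀ᶠ i in F, (w i).LevelContinuous) (h : Tendsto w F (𝓝 L)) :
    L.LevelContinuous := by
  have hd : Tendsto (fun i => dist (w i) L) F (𝓝 0) := tendsto_iff_dist_tendsto_zero.1 h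
  constructor
  · refine TendstoUniformlyOn.continuousOn (F := fun i => (w i).lo) (p := F) ?_
      (hw.mono fun i hi => hi.1).frequently
    refine Metric.tendstoUniformlyOn_iff.2 fun ε hε => ?_
    filter_upwards [hd.eventually (gt_mem_nhds hε)] with i hi r hr
    rw [dist_comm, Real.dist_eq]
    exact (abs_lo_sub_le _ _ hr).trans_lt hi
  · refine TendstoUniformlyOn.continuousOn (F := fun i => (w i).hi) (p := F) ?_
      (hw.mono fun i hi => hi.2).frequently
    refine Metric.tendstoUniformlyOn_iff.2 fun ε hε => ?_
    filter_upwards [hd.eventually (gt_mem_nhds hε)] with i hi r hr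
    rw [dist_comm, Real.dist_eq]
    exact (abs_hi_sub_le _ _ hr).trans_lt hi

theorem LevelContinuous.smul {u : FuzzyNumber} (hu : u.LevelContinuous) {c : ℝ} (hc : c ≠ 0) :
    (c • u).LevelContinuous := by
  rcases hc.lt_or_gt with h | h
  · exact ⟨(continuousOn_const.mul hu.2).congr fun r _ => lo_smul_of_neg u h r,
      (continuousOn_const.mul hu.1).congr fun r _ => hi_smul_of_neg u h r⟩
  · exact ⟨(continuousOn_const.mul hu.1).congr fun r _ => lo_smul_of_pos u h r,
      (continuousOn_const.mul hu.2).congr fun r _ => hi_smul_of_pos u h r⟩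

theorem IsGHDiff.ends {p q w : FuzzyNumber} (h : IsGHDiff p q w) {r : ℝ} (hr : r ≤ 1) :
    (w.lo r = p.lo r - q.lo r ∧ w.hi r = p.hi r - q.hi r) ∨
      (w.lo r = p.hi r - q.hi r ∧ w.hi r = p.lo r - q.lo r) := by
  rcases h with rfl | rfl
  · left
    simp [lo_add _ _ hr, hi_add _ _ hr]
  · right
    simp [lo_add _ _ hr, hi_add _ _ hr, lo_smul_of_neg _ (neg_one_lt_zero (R := ℝ)),
      hi_smul_of_neg _ (neg_one_lt_zero (R := ℝ))]

theorem IsGHDiff.levelContinuous {p q w : FuzzyNumber} (h : IsGHDiff p q w)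
    (hp : p.LevelContinuous) (hq : q.LevelContinuous) : w.LevelContinuous := by
  rcases h with rfl | rfl
  · exact ⟨(hp.1.sub hq.1).congr fun r hr => by simp [lo_add _ _ hr.2],
      (hp.2.sub hq.2).congr fun r hr => by simp [hi_add _ _ hr.2]⟩
  · have e := neg_one_lt_zero (R := ℝ)
    exact ⟨(hp.2.sub hq.2).congr fun r hr => by simp [hi_add _ _ hr.2, hi_smul_of_neg _ e],
      (hp.1.sub hq.1).congr fun r hr => by simp [lo_add _ _ hr.2, lo_smul_of_neg _ e]⟩

/-- The two alternatives in the gH-difference and the two signs of `c` only permute the end points,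
and end points are always ordered; `min` and `max` absorb all four cases. -/
theorem IsGHDiff.smul_ends {p q w : FuzzyNumber} (h : IsGHDiff p q w) {r : ℝ} (hr : r ≤ 1)
    {c : ℝ} (hc : c ≠ 0) :
    (c • w).lo r = min (c * (p.lo r - q.lo r)) (c * (p.hi r - q.hi r)) ∧
      (c • w).hi r = max (c * (p.lo r - q.lo r)) (c * (p.hi r - q.hi r)) := by
  have hw := w.lo_le_hi hr
  rcases hc.lt_or_gt with h' | h'
  · have := mul_le_mul_of_nonpos_left hw h'.le
    rcases h.ends hr with ⟨h1, h2⟩ | ⟨h1, h2⟩ <;>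
    simp [lo_smul_of_neg _ h', hi_smul_of_neg _ h', ← h1, ← h2, this]
  · have := mul_le_mul_of_nonneg_left hw h'.le
    rcases h.ends hr with ⟨h1, h2⟩ | ⟨h1, h2⟩ <;>
    simp [lo_smul_of_pos _ h', hi_smul_of_pos _ h', ← h1, ← h2, this]

/-- This is all that gH-differentiability says about end points: which slope is the smaller may
change with `x'`, so neither end point need be differentiable without extra information. -/
theorem HasGHDerivWithin.tendsto_slope {f : ℝ → FuzzyNumber} {s : Set ℝ} {x : ℝ} {L : FuzzyNumber}
    (h : HasGHDerivWithin f s x L) {r : ℝ} (hr : r ∈ Icc (0 : ℝ) 1) :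
    Tendsto (fun x' => min (slope (fun z => (f z).lo r) x x') (slope (fun z => (f z).hi r) x x'))
        (𝓝[s \ {x}] x) (𝓝 (L.lo r)) ∧
      Tendsto (fun x' => max (slope (fun z => (f z).lo r) x x') (slope (fun z => (f z).hi r) x x'))
        (𝓝[s \ {x}] x) (𝓝 (L.hi r)) := by
  obtain ⟨w, hw, hL⟩ := h
  have hne : ∀ᶠ x' in 𝓝[s \ {x}] x, x' ∈ s \ {x} := self_mem_nhdsWithin
  constructor
  · refine (((lipschitzWith_lo hr).continuous.tendsto L).comp hL).congr' ?_
    filter_upwards [hw, hne] with x' h1 h2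
    simpa [slope] using (h1.smul_ends hr.2 (inv_ne_zero (sub_ne_zero.2 h2.2))).1
  · refine (((lipschitzWith_hi hr).continuous.tendsto L).comp hL).congr' ?_
    filter_upwards [hw, hne] with x' h1 h2
    simpa [slope] using (h1.smul_ends hr.2 (inv_ne_zero (sub_ne_zero.2 h2.2))).2

theorem HasGHDerivWithin.levelContinuous {f : ℝ → FuzzyNumber} {s : Set ℝ} {x : ℝ}
    {L : FuzzyNumber} (h : HasGHDerivWithin f s x L) [(𝓝[s \ {x}] x).NeBot]
    (hf : ∀ᶠ z in 𝓝[s] x, (f z).LevelContinuous) (hx : (f x).LevelContinuous) :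
    L.LevelContinuous := by
  obtain ⟨w, hw, hL⟩ := h
  refine LevelContinuous.of_tendsto ?_ hL
  have hne : ∀ᶠ x' in 𝓝[s \ {x}] x, x' ∈ s \ {x} := self_mem_nhdsWithin
  filter_upwards [hw, hf.filter_mono (nhdsWithin_mono x sdiff_subset), hne] with x' h1 h2 h3
  exact (h1.levelContinuous h2 hx).smul (inv_ne_zero (sub_ne_zero.2 h3.2))

/-- A function with Hukuhara-type increments has a gH-derivative as soon as its end points at
the rational levels have derivatives which are the end points of a level-continuous fuzzy number. -/
theorem hasGHDerivWithin_of_increments {f : ℝ → FuzzyNumber} {s : Set ℝ} {x : ℝ} {L : FuzzyNumber}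
    (hx : x ∈ s) (hinc : ∀ x₁ ∈ s, ∀ x₂ ∈ s, x₁ < x₂ → ∃ w, f x₂ = f x₁ + w)
    (hL : L.LevelContinuous)
    (hd : ∀ q : ℚ, (q : ℝ) ∈ Icc (0 : ℝ) 1 →
      HasDerivWithinAt (fun z => (f z).lo q) (L.lo q) s x ∧
      HasDerivWithinAt (fun z => (f z).hi q) (L.hi q) s x) : HasGHDerivWithin f s x L := by
  have e := neg_one_lt_zero (R := ℝ)
  have hex : ∀ x', ∃ w, x' ∈ s \ {x} → IsGHDiff (f x') (f x) w ∧ ∀ r ≤ 1,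
      ((x' - x)⁻¹ • w).lo r = slope (fun z => (f z).lo r) x x' ∧
      ((x' - x)⁻¹ • w).hi r = slope (fun z => (f z).hi r) x x' := by
    intro x'
    by_cases hx' : x' ∈ s \ {x}
    · rcases lt_or_gt_of_ne hx'.2 with h | h
      · obtain ⟨w, hw⟩ := hinc x' hx'.1 x hx h
        have hneg : (x' - x)⁻¹ < 0 := inv_lt_zero.2 (sub_neg.2 h)
        -- To the left of `x` the increment goes the other way, so the second alternative of the
        -- gH-difference applies; division by the negative `x' - x` swaps the end points back.
        refine ⟨(-1 : ℝ) • w, fun _ => ⟨Or.inr ?_, fun r hr => ?_⟩⟩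
        · rw [hw]
          refine eq_of_ends fun r hr => ?_
          simp [lo_add _ _ hr.2, hi_add _ _ hr.2, lo_smul_of_neg _ e, hi_smul_of_neg _ e]
        · rw [lo_smul_of_neg _ hneg, hi_smul_of_neg _ hneg, lo_smul_of_neg _ e, hi_smul_of_neg _ e]
          simp [slope, hw, lo_add _ _ hr, hi_add _ _ hr]
      · obtain ⟨w, hw⟩ := hinc x hx x' hx'.1 h
        have hpos : 0 < (x' - x)⁻¹ := inv_pos.2 (sub_pos.2 h)
        refine ⟨w, fun _ => ⟨Or.inl hw, fun r hr => ?_⟩⟩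
        rw [lo_smul_of_pos _ hpos, hi_smul_of_pos _ hpos]
        simp [slope, hw, lo_add _ _ hr, hi_add _ _ hr]
    · exact ⟨f x, fun h => absurd h hx'⟩
  choose w hw using hex
  have hne : ∀ᶠ x' in 𝓝[s \ {x}] x, x' ∈ s \ {x} := self_mem_nhdsWithin
  refine ⟨w, hne.mono fun x' h => (hw x' h).1, tendsto_of_ends hL fun q hq => ?_⟩
  constructor
  · refine (hasDerivWithinAt_iff_tendsto_slope.1 (hd q hq).1).congr' ?_
    exact hne.mono fun x' h => ((hw x' h).2 q hq.2).1.symm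
  · refine (hasDerivWithinAt_iff_tendsto_slope.1 (hd q hq).2).congr' ?_
    exact hne.mono fun x' h => ((hw x' h).2 q hq.2).2.symm

end FuzzyNumber

/-! ### Densities on nested partitions by martingale convergence -/

theorem MeasureTheory.setIntegral_preimage_eq_sum {X K : Type*} [MeasurableSpace X]
    {μ : Measure X} [MeasurableSpace K] [DiscreteMeasurableSpace K] {π : X → K}
    (hπ : Measurable π) {I : Finset K} (hI : ∀ᵐ x ∂μ, π x ∈ I) {h : X → ℝ} (hh : Integrable h μ)
    (A : Set K) [DecidablePred (· ∈ A)] :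
    ∫ x in π ⁻¹' A, h x ∂μ = ∑ k ∈ I with k ∈ A, ∫ x in π ⁻¹' {k}, h x ∂μ := by
  rw [← integral_biUnion_finset _ (fun k _ => hπ (MeasurableSet.of_discrete)) _
    (fun k _ => hh.integrableOn)]
  · refine setIntegral_congr_set ?_
    filter_upwards [hI] with x hx
    refine propext ?_
    change x ∈ π ⁻¹' A ↔ x ∈ ⋃ i ∈ Finset.filter (· ∈ A) I, π ⁻¹' {i}
    simp [hx]
  · intro i _ j _ hij
    exact Disjoint.preimage _ (by simpa using hij)

/-- An additive function on a nested sequence of finite partitions which is absolutely continuous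
with respect to a finite measure has an integrable density. -/
theorem MeasureTheory.exists_density_of_nested_partitions {X K : Type*} [MeasurableSpace X]
    {μ : Measure X} [IsFiniteMeasure μ] [MeasurableSpace K] [DiscreteMeasurableSpace K]
    [DecidableEq K]
    {π : ℕ → X → K} (hπ : ∀ n, Measurable (π n)) {par : K → K} (hpar : ∀ n x, par (π (n + 1) x) = π n x)
    {I : ℕ → Finset K} (hI : ∀ n, ∀ᵐ x ∂μ, π n x ∈ I n)
    {m v : ℕ → K → ℝ} (hm : ∀ n, ∀ k ∈ I n, μ.real (π n ⁻¹' {k}) = m n k)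
    (hm0 : ∀ n, ∀ k ∈ I n, 0 < m n k)
    (hv : ∀ n, ∀ k ∈ I n, v n k = ∑ j ∈ I (n + 1) with par j = k, v (n + 1) j)
    {M : ℝ} (hM : ∀ n, ∑ k ∈ I n, |v n k| ≤ M)
    (hac : ∀ ε > 0, ∃ δ > 0, ∀ n, ∀ S ⊆ I n, ∑ k ∈ S, m n k < δ → ∑ k ∈ S, |v n k| < ε) :
    ∃ f : X → ℝ, Integrable f μ ∧ ∀ n, ∀ k ∈ I n, ∫ x in π n ⁻¹' {k}, f x ∂μ = v n k := by
  classical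
  let ℱ : Filtration ℕ ‹MeasurableSpace X› :=
    { seq := fun n => MeasurableSpace.comap (π n) ⊤
      mono' := monotone_nat_of_le_succ fun n => by
        have : π n = par ∘ π (n + 1) := funext fun x => (hpar n x).symm
        rw [this, ← MeasurableSpace.comap_comp]
        exact MeasurableSpace.comap_mono le_top
      le' := fun n => by
        rintro s ⟨A, -, rfl⟩
        exact hπ n (MeasurableSet.of_discrete) }
  -- The candidate approximations of the density are the quotients of `v` by the mass, constant on
  -- the cells of stage `n`.
  let g : ℕ → K → ℝ := fun n k => if k ∈ I n then v n k / m n k else 0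
  let f : ℕ → X → ℝ := fun n x => g n (π n x)
  have hgm : ∀ n, StronglyMeasurable[ℱ n] (f n) := by
    intro n
    have h1 : Measurable[ℱ n] (f n) := by
      intro s _
      exact ⟨g n ⁻¹' s, trivial, rfl⟩
    exact h1.stronglyMeasurable
  have hfm : ∀ n, AEStronglyMeasurable (f n) μ := fun n =>
    ((hgm n).mono (ℱ.le n)).aestronglyMeasurable
  have hfint : ∀ n, Integrable (f n) μ := by
    intro n
    refine Integrable.of_bound (hfm n) (∑ k ∈ I n, |v n k / m n k|) (Eventually.of_forall fun x => ?_)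
    by_cases hx : π n x ∈ I n
    · simp only [f, g, hx, if_true, Real.norm_eq_abs]
      exact Finset.single_le_sum (f := fun k => |v n k / m n k|) (fun k _ => abs_nonneg _) hx
    · simp only [f, g, hx, if_false, norm_zero]
      exact Finset.sum_nonneg fun k _ => abs_nonneg _
  have hcell : ∀ n, ∀ k ∈ I n, ∀ φ : ℝ → ℝ, ∫ x in π n ⁻¹' {k}, φ (f n x) ∂μ =
      m n k * φ (v n k / m n k) := by
    intro n k hk φ
    rw [setIntegral_congr_fun (g := fun _ => φ (v n k / m n k)) (hπ n (MeasurableSet.of_discrete))]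
    · rw [setIntegral_const, hm n k hk, smul_eq_mul]
    · intro x hx
      have : π n x = k := hx
      simp [f, g, this, hk]
  have hcell' : ∀ n, ∀ k ∈ I n, ∫ x in π n ⁻¹' {k}, f n x ∂μ = v n k := by
    intro n k hk
    rw [hcell n k hk (fun x => x)]
    have := (hm0 n k hk).ne'
    field_simp
  have hcells : ∀ n, ∀ k ∈ I n, ∀ h : X → ℝ, Integrable h μ → ∫ x in π n ⁻¹' {k}, h x ∂μ =
      ∑ j ∈ I (n + 1) with par j = k, ∫ x in π (n + 1) ⁻¹' {j}, h x ∂μ := by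
    intro n k hk h hh
    have e : π n ⁻¹' {k} = π (n + 1) ⁻¹' {j | par j = k} := by
      ext x
      simp [hpar]
    rw [e, setIntegral_preimage_eq_sum (hπ (n + 1)) (hI (n + 1)) hh]
    rfl
  -- Additivity of `v` under refinement of cells is exactly the martingale property, tested on
  -- unions of cells.
  have hmart : Martingale f ℱ μ := by
    refine martingale_of_setIntegral_eq_succ hgm hfint fun n s hs => ?_
    obtain ⟨A, -, rfl⟩ := hs
    rw [setIntegral_preimage_eq_sum (hπ n) (hI n) (hfint n),
      setIntegral_preimage_eq_sum (hπ n) (hI n) (hfint (n + 1))]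
    refine Finset.sum_congr rfl fun k hk => ?_
    have hk' := (Finset.mem_filter.1 hk).1
    rw [hcell' n k hk', hcells n k hk' _ (hfint (n + 1)), hv n k hk']
    refine Finset.sum_congr rfl fun j hj => (hcell' (n + 1) j (Finset.mem_filter.1 hj).1).symm
  -- By Markov's inequality, the cells where the quotient is at least M/δ + 1 have total mass below
  -- δ, so absolute continuity bounds the integral over them by ε. The summand 1 makes the mass
  -- bound strict.
  have hui : UniformIntegrable f 1 μ := by
    refine uniformIntegrable_of le_rfl ENNReal.one_ne_top hfm fun ε hε => ?_
    obtain ⟨δ, hδ, hS⟩ := hac ε hε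
    have hM0 : 0 ≤ M := (Finset.sum_nonneg fun k _ => abs_nonneg _).trans (hM 0)
    have hCpos : 0 < M / δ + 1 := by positivity
    refine ⟨Real.toNNReal (M / δ + 1), fun n => ?_⟩
    let A : Set K := {k | M / δ + 1 ≤ |g n k|}
    have hset : {x | Real.toNNReal (M / δ + 1) ≤ ‖f n x‖₊} = π n ⁻¹' A := by
      ext x
      simp [A, f, Real.toNNReal_le_iff_le_coe]
    rw [hset, eLpNorm_indicator_eq_eLpNorm_restrict (hπ n (MeasurableSet.of_discrete)),
      eLpNorm_one_eq_lintegral_enorm,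
      ← ofReal_integral_norm_eq_lintegral_enorm (hfint n).integrableOn]
    refine ENNReal.ofReal_le_ofReal ?_
    rw [setIntegral_preimage_eq_sum (hπ n) (hI n) (hfint n).norm]
    have hval : ∀ k ∈ I n, ∫ x in π n ⁻¹' {k}, ‖f n x‖ ∂μ = |v n k| := by
      intro k hk
      rw [hcell n k hk (fun x => ‖x‖), Real.norm_eq_abs, abs_div, abs_of_pos (hm0 n k hk)]
      have := (hm0 n k hk).ne'
      field_simp
    rw [Finset.sum_congr rfl fun k hk => hval k (Finset.mem_filter.1 hk).1]
    refine (hS n _ (Finset.filter_subset _ _) ?_).le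
    have h1 : (M / δ + 1) * ∑ k ∈ I n with k ∈ A, m n k ≤ M := by
      rw [Finset.mul_sum]
      refine le_trans (Finset.sum_le_sum fun k hk => ?_)
        ((Finset.sum_le_sum_of_subset_of_nonneg (Finset.filter_subset (· ∈ A) (I n))
          fun k _ _ => abs_nonneg (v n k)).trans (hM n))
      obtain ⟨hk1, hk2⟩ := Finset.mem_filter.1 hk
      simp only [A, mem_ofPred_eq, g, hk1, if_true, abs_div, abs_of_pos (hm0 n k hk1)] at hk2
      exact (le_div_iff₀ (hm0 n k hk1)).1 hk2
    have h2 : 0 ≤ ∑ k ∈ I n with k ∈ A, m n k :=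
      Finset.sum_nonneg fun k hk => (hm0 n k (Finset.mem_filter.1 hk).1).le
    by_contra hcon
    have h3 := mul_le_mul_of_nonneg_left (not_lt.1 hcon) hCpos.le
    have h4 : (M / δ + 1) * δ = M + δ := by field_simp
    linarith
  obtain ⟨R, hR⟩ := hui.2.2
  -- A uniformly integrable martingale is closed by its limit: `f n` is the conditional expectation
  -- of the limit, which therefore has the right integral over every cell.
  have hlim := (Filtration.memLp_limitProcess_of_eLpNorm_bdd (ℱ := ℱ) hfm hR).integrable le_rfl
  refine ⟨_, hlim, fun n k hk => ?_⟩
  · have hae := hmart.ae_eq_condExp_limitProcess hui n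
    rw [← hcell' n k hk, ← setIntegral_condExp (ℱ.le n) hlim (s := π n ⁻¹' {k}) ⟨{k}, trivial, rfl⟩]
    exact integral_congr_ae (ae_restrict_of_ae (hae.mono fun x hx => hx.symm))

/-! ### Mixed increments on dyadic cells and their density -/

/-- The mixed increment of `F` over the rectangle `[p₁,q₁] × [p₂,q₂]`. -/
def mixedIncrement (F : ℝ × ℝ → ℝ) (p q : ℝ × ℝ) : ℝ := F q + F p - F (p.1, q.2) - F (q.1, p.2)

/-- Absolute continuity of the mixed increments of a real function on `[0,a] × [0,b]`. -/
def MixedAbsCont (a b : ℝ) (F : ℝ × ℝ → ℝ) : Prop :=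
  ∀ ε > 0, ∃ δ > 0, ∀ (n : ℕ) (p q : Fin n → ℝ × ℝ),
    (∀ i, 0 ≤ (p i).1 ∧ (p i).1 ≤ (q i).1 ∧ (q i).1 ≤ a ∧
      0 ≤ (p i).2 ∧ (p i).2 ≤ (q i).2 ∧ (q i).2 ≤ b) →
    Pairwise (fun i j => Disjoint (Ioo (p i).1 (q i).1 ×ˢ Ioo (p i).2 (q i).2)
      (Ioo (p j).1 (q j).1 ×ˢ Ioo (p j).2 (q j).2)) →
    ∑ i, ((q i).1 - (p i).1) * ((q i).2 - (p i).2) < δ →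
    ∑ i, |mixedIncrement F (p i) (q i)| < ε

theorem MixedAbsCont.exists_finset {a b : ℝ} {F : ℝ × ℝ → ℝ} (hF : MixedAbsCont a b F) {ε : ℝ}
    (hε : 0 < ε) : ∃ δ > 0, ∀ {ι : Type} (S : Finset ι) (p q : ι → ℝ × ℝ),
    (∀ i ∈ S, 0 ≤ (p i).1 ∧ (p i).1 ≤ (q i).1 ∧ (q i).1 ≤ a ∧
      0 ≤ (p i).2 ∧ (p i).2 ≤ (q i).2 ∧ (q i).2 ≤ b) →
    (∀ i ∈ S, ∀ j ∈ S, i ≠ j → Disjoint (Ioo (p i).1 (q i).1 ×ˢ Ioo (p i).2 (q i).2)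
      (Ioo (p j).1 (q j).1 ×ˢ Ioo (p j).2 (q j).2)) →
    ∑ i ∈ S, ((q i).1 - (p i).1) * ((q i).2 - (p i).2) < δ →
    ∑ i ∈ S, |mixedIncrement F (p i) (q i)| < ε := by
  obtain ⟨δ, hδ, h⟩ := hF ε hε
  refine ⟨δ, hδ, fun {ι} S p q h1 h2 h3 => ?_⟩
  have hsum : ∀ g : ι → ℝ, ∑ i, g (S.equivFin.symm i) = ∑ i ∈ S, g i := by
    intro g
    rw [← Finset.sum_coe_sort S g]
    exact Equiv.sum_comp S.equivFin.symm fun x : S => g x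
  have := h S.card (fun i => p (S.equivFin.symm i)) (fun i => q (S.equivFin.symm i))
    (fun i => h1 _ (S.equivFin.symm i).2)
    (fun i j hij => h2 _ (S.equivFin.symm i).2 _ (S.equivFin.symm j).2
      (fun he => hij (S.equivFin.symm.injective (Subtype.ext he))))
    (by rw [hsum fun i => ((q i).1 - (p i).1) * ((q i).2 - (p i).2)]; exact h3)
  rwa [hsum fun i => |mixedIncrement F (p i) (q i)|] at this

/-- The dyadic points of `[0,a]`. -/
noncomputable def dyadicPoint (a : ℝ) (n i : ℕ) : ℝ := a * i / 2 ^ n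

theorem dyadicPoint_zero (a : ℝ) (n : ℕ) : dyadicPoint a n 0 = 0 := by simp [dyadicPoint]

theorem dyadicPoint_succ_two_mul (a : ℝ) (n i : ℕ) :
    dyadicPoint a (n + 1) (2 * i) = dyadicPoint a n i := by
  simp only [dyadicPoint, pow_succ]; push_cast; field_simp

theorem dyadicPoint_mono {a : ℝ} (ha : 0 < a) (n : ℕ) : Monotone (dyadicPoint a n) := by
  intro i j hij
  have : (i : ℝ) ≤ j := by exact_mod_cast hij
  unfold dyadicPoint
  gcongr

theorem dyadicPoint_le {a : ℝ} (ha : 0 < a) {n i : ℕ} (h : i ≤ 2 ^ n) : dyadicPoint a n i ≤ a := by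
  have : (i : ℝ) ≤ 2 ^ n := by exact_mod_cast h
  rw [dyadicPoint, div_le_iff₀ (by positivity)]
  gcongr

theorem dyadicPoint_nonneg {a : ℝ} (ha : 0 < a) (n i : ℕ) : 0 ≤ dyadicPoint a n i := by
  unfold dyadicPoint; positivity

theorem dyadicPoint_succ_sub (a : ℝ) (n i : ℕ) :
    dyadicPoint a n (i + 1) - dyadicPoint a n i = a / 2 ^ n := by
  simp only [dyadicPoint]; push_cast; ring

/-- The index of the dyadic cell containing a point. -/
noncomputable def dyadicIndex (a : ℝ) (n : ℕ) (x : ℝ) : ℕ := ⌊x * 2 ^ n / a⌋₊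

theorem dyadicIndex_lt_iff {a x : ℝ} (ha : 0 < a) (hx : 0 ≤ x) {n i : ℕ} :
    dyadicIndex a n x < i ↔ x < dyadicPoint a n i := by
  rw [dyadicIndex, Nat.floor_lt (by positivity), dyadicPoint, div_lt_iff₀ ha,
    lt_div_iff₀ (by positivity), mul_comm (i : ℝ)]

theorem dyadicIndex_eq_iff {a x : ℝ} (ha : 0 < a) (hx : 0 ≤ x) {n i : ℕ} :
    dyadicIndex a n x = i ↔ x ∈ Ico (dyadicPoint a n i) (dyadicPoint a n (i + 1)) := by
  rw [mem_Ico, ← dyadicIndex_lt_iff ha hx, ← not_lt, ← dyadicIndex_lt_iff ha hx]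
  omega

theorem dyadicIndex_succ_div (a : ℝ) (n : ℕ) (x : ℝ) :
    dyadicIndex a (n + 1) x / 2 = dyadicIndex a n x := by
  rw [dyadicIndex, dyadicIndex, ← Nat.floor_div_ofNat]
  congr 1
  rw [pow_succ]
  ring

theorem dyadicIndex_lt {a x : ℝ} (ha : 0 < a) (hx : x ∈ Ico 0 a) (n : ℕ) :
    dyadicIndex a n x < 2 ^ n := by
  rw [dyadicIndex_lt_iff ha hx.1, dyadicPoint]
  push_cast
  rw [mul_div_cancel_right₀ _ (by positivity)]
  exact hx.2

theorem measurable_dyadicIndex (a : ℝ) (n : ℕ) : Measurable (dyadicIndex a n) :=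
  Nat.measurable_floor.comp (by fun_prop)

theorem tendsto_dyadicPoint_dyadicIndex {a x : ℝ} (ha : 0 < a) (hx : 0 ≤ x) :
    Tendsto (fun n => dyadicPoint a n (dyadicIndex a n x)) atTop (𝓝 x) ∧
      ∀ n, dyadicPoint a n (dyadicIndex a n x) ≤ x := by
  have h := fun n => (dyadicIndex_eq_iff ha hx (n := n)).1 rfl
  refine ⟨?_, fun n => (h n).1⟩
  have h0 : Tendsto (fun n : ℕ => x - a * (1 / 2) ^ n) atTop (𝓝 x) := by
    simpa using (((tendsto_pow_atTop_nhds_zero_of_lt_one (r := (1 / 2 : ℝ)) (by norm_num)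
      (by norm_num)).const_mul a).const_sub x)
  refine tendsto_of_tendsto_of_tendsto_of_le_of_le h0 tendsto_const_nhds (fun n => ?_)
    (fun n => (h n).1)
  have h1 := dyadicPoint_succ_sub a n (dyadicIndex a n x)
  have h2 := (h n).2
  have h3 : a * (1 / 2) ^ n = a / 2 ^ n := by
    rw [one_div, inv_pow]; rfl
  simp only [h3]
  linarith

/-- The mixed increment over a dyadic cell. -/
noncomputable def cellIncrement (a b : ℝ) (F : ℝ × ℝ → ℝ) (n : ℕ) (k : ℕ × ℕ) : ℝ :=
  mixedIncrement F (dyadicPoint a n k.1, dyadicPoint b n k.2)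
    (dyadicPoint a n (k.1 + 1), dyadicPoint b n (k.2 + 1))

/-- The indices of the dyadic cells of `[0,a] × [0,b]`. -/
def cellIndices (n : ℕ) : Finset (ℕ × ℕ) := Finset.range (2 ^ n) ×ˢ Finset.range (2 ^ n)

theorem mem_cellIndices {n : ℕ} {k : ℕ × ℕ} : k ∈ cellIndices n ↔ k.1 < 2 ^ n ∧ k.2 < 2 ^ n := by
  simp [cellIndices]

/-- A dyadic cell splits into four, and the values of `F` at corners that are not corners of the
parent cancel. This feeds the martingale property. -/
theorem cellIncrement_eq_sum (a b : ℝ) (F : ℝ × ℝ → ℝ) (n : ℕ) (k : ℕ × ℕ)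
    (hk : k ∈ cellIndices n) : cellIncrement a b F n k =
      ∑ j ∈ cellIndices (n + 1) with (j.1 / 2, j.2 / 2) = k, cellIncrement a b F (n + 1) j := by
  have hf : (cellIndices (n + 1)).filter (fun j => (j.1 / 2, j.2 / 2) = k) =
      ({2 * k.1, 2 * k.1 + 1} : Finset ℕ) ×ˢ ({2 * k.2, 2 * k.2 + 1} : Finset ℕ) := by
    ext ⟨i, j⟩
    rw [mem_cellIndices] at hk
    simp only [Finset.mem_filter, mem_cellIndices, Finset.mem_product, Finset.mem_insert,
      Finset.mem_singleton, Prod.ext_iff, pow_succ]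
    omega
  rw [hf, Finset.sum_product, Finset.sum_pair (by omega), Finset.sum_pair (by omega),
    Finset.sum_pair (by omega)]
  have e1 : ∀ i, 2 * i + 1 + 1 = 2 * (i + 1) := fun i => by ring
  simp only [cellIncrement, mixedIncrement, e1, dyadicPoint_succ_two_mul]
  ring

theorem sum_cellIncrement (a b : ℝ) (F : ℝ × ℝ → ℝ) (n i j : ℕ) :
    ∑ k ∈ Finset.range i ×ˢ Finset.range j, cellIncrement a b F n k =
      mixedIncrement F (0, 0) (dyadicPoint a n i, dyadicPoint b n j) := by
  rw [Finset.sum_product]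
  have h1 : ∀ i', ∑ j' ∈ Finset.range j, cellIncrement a b F n (i', j') =
      (F (dyadicPoint a n (i' + 1), dyadicPoint b n j) - F (dyadicPoint a n (i' + 1), 0)) -
      (F (dyadicPoint a n i', dyadicPoint b n j) - F (dyadicPoint a n i', 0)) := by
    intro i'
    have := Finset.sum_range_sub (fun j' => F (dyadicPoint a n (i' + 1), dyadicPoint b n j') -
      F (dyadicPoint a n i', dyadicPoint b n j')) j
    rw [dyadicPoint_zero] at this
    rw [show (F (dyadicPoint a n (i' + 1), dyadicPoint b n j) - F (dyadicPoint a n (i' + 1), 0)) -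
      (F (dyadicPoint a n i', dyadicPoint b n j) - F (dyadicPoint a n i', 0)) =
      F (dyadicPoint a n (i' + 1), dyadicPoint b n j) - F (dyadicPoint a n i', dyadicPoint b n j) -
      (F (dyadicPoint a n (i' + 1), 0) - F (dyadicPoint a n i', 0)) by ring, ← this]
    refine Finset.sum_congr rfl fun j' _ => ?_
    simp only [cellIncrement, mixedIncrement]
    ring
  simp only [h1]
  rw [Finset.sum_range_sub (fun i' => F (dyadicPoint a n i', dyadicPoint b n j) -
    F (dyadicPoint a n i', 0)), dyadicPoint_zero]
  simp only [mixedIncrement]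
  ring

theorem MixedAbsCont.exists_cells {a b : ℝ} (ha : 0 < a) (hb : 0 < b) {F : ℝ × ℝ → ℝ}
    (hF : MixedAbsCont a b F) {ε : ℝ} (hε : 0 < ε) : ∃ δ > 0, ∀ n, ∀ S ⊆ cellIndices n,
      ∑ _k ∈ S, a / 2 ^ n * (b / 2 ^ n) < δ → ∑ k ∈ S, |cellIncrement a b F n k| < ε := by
  obtain ⟨δ, hδ, h⟩ := hF.exists_finset hε
  refine ⟨δ, hδ, fun n S hS hsum => h S (fun k => (dyadicPoint a n k.1, dyadicPoint b n k.2))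
    (fun k => (dyadicPoint a n (k.1 + 1), dyadicPoint b n (k.2 + 1))) ?_ ?_ ?_⟩
  · intro k hk
    have hk' := mem_cellIndices.1 (hS hk)
    exact ⟨dyadicPoint_nonneg ha _ _, dyadicPoint_mono ha _ (Nat.le_succ _), dyadicPoint_le ha hk'.1,
      dyadicPoint_nonneg hb _ _, dyadicPoint_mono hb _ (Nat.le_succ _), dyadicPoint_le hb hk'.2⟩
  · intro k _ l _ hkl
    rw [Set.disjoint_prod]
    by_cases h1 : k.1 = l.1
    · exact Or.inr ((dyadicPoint_mono hb n).pairwise_disjoint_on_Ioo_succ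
        (fun h2 => hkl (Prod.ext h1 h2)))
    · exact Or.inl ((dyadicPoint_mono ha n).pairwise_disjoint_on_Ioo_succ h1)
  · simpa only [dyadicPoint_succ_sub] using hsum

/-- Absolute continuity implies bounded variation: cut the rectangle into 2^N vertical strips of
area below the δ belonging to ε = 1; each strip contributes less than 1. -/
theorem MixedAbsCont.exists_bound {a b : ℝ} (ha : 0 < a) (hb : 0 < b) {F : ℝ × ℝ → ℝ}
    (hF : MixedAbsCont a b F) : ∃ M, ∀ n, ∑ k ∈ cellIndices n, |cellIncrement a b F n k| ≤ M := by
  obtain ⟨δ, hδ, h⟩ := hF.exists_cells ha hb one_pos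
  obtain ⟨N, hN⟩ := exists_pow_lt_of_lt_one (show 0 < δ / (a * b) by positivity)
    (show (1 / 2 : ℝ) < 1 by norm_num)
  rw [lt_div_iff₀ (by positivity)] at hN
  -- The strips are unions of cells only for `n ≥ N`; the finitely many coarser stages are simply
  -- added to the bound.
  refine ⟨2 ^ N + ∑ n ∈ Finset.range N, ∑ k ∈ cellIndices n, |cellIncrement a b F n k|,
    fun n => ?_⟩
  have hnn : ∀ n, 0 ≤ ∑ k ∈ cellIndices n, |cellIncrement a b F n k| :=
    fun n => Finset.sum_nonneg fun k _ => abs_nonneg _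
  rcases lt_or_ge n N with hn | hn
  · have := Finset.single_le_sum (f := fun n => ∑ k ∈ cellIndices n, |cellIncrement a b F n k|)
      (fun n _ => hnn n) (Finset.mem_range.2 hn)
    have h2 : (0 : ℝ) ≤ 2 ^ N := by positivity
    linarith
  · obtain ⟨d, rfl⟩ := Nat.exists_eq_add_of_le hn
    have hmaps : ∀ k ∈ cellIndices (N + d), k.1 / 2 ^ d ∈ Finset.range (2 ^ N) := by
      intro k hk
      have := (mem_cellIndices.1 hk).1
      rw [Finset.mem_range, Nat.div_lt_iff_lt_mul (by positivity), ← pow_add]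
      exact this
    have hle : ∑ k ∈ cellIndices (N + d), |cellIncrement a b F (N + d) k| ≤ 2 ^ N := by
      -- The strip containing a cell is read off from `k.1 / 2 ^ d`.
      rw [← Finset.sum_fiberwise_of_maps_to hmaps]
      refine (Finset.sum_le_card_nsmul _ _ 1 fun K _ => (h (N + d) _ (Finset.filter_subset _ _)
        ?_).le).trans (by simp)
      have hcard : ((cellIndices (N + d)).filter fun k => k.1 / 2 ^ d = K).card ≤
          2 ^ d * 2 ^ (N + d) := by
        have hsub : ((cellIndices (N + d)).filter fun k => k.1 / 2 ^ d = K) ⊆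
            Finset.Ico (K * 2 ^ d) ((K + 1) * 2 ^ d) ×ˢ Finset.range (2 ^ (N + d)) := by
          intro k hk
          obtain ⟨hk1, hk2⟩ := Finset.mem_filter.1 hk
          rw [Finset.mem_product, Finset.mem_Ico, Finset.mem_range]
          refine ⟨?_, (mem_cellIndices.1 hk1).2⟩
          have hp : 0 < 2 ^ d := by positivity
          rw [← Nat.le_div_iff_mul_le hp, ← Nat.div_lt_iff_lt_mul hp]
          omega
        refine (Finset.card_le_card hsub).trans ?_
        rw [Finset.card_product, Nat.card_Ico, Finset.card_range, ← Nat.sub_mul,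
          Nat.add_sub_cancel_left, one_mul]
      rw [Finset.sum_const, nsmul_eq_mul]
      have hcard' : (((cellIndices (N + d)).filter fun k => k.1 / 2 ^ d = K).card : ℝ) ≤
          2 ^ d * 2 ^ (N + d) := by exact_mod_cast hcard
      refine lt_of_le_of_lt (mul_le_mul_of_nonneg_right hcard' (by positivity)) ?_
      refine lt_of_eq_of_lt ?_ hN
      rw [one_div, inv_pow, pow_add]
      field_simp
    have := Finset.sum_nonneg fun n (_ : n ∈ Finset.range N) => hnn n
    linarith

theorem MixedAbsCont.exists_dyadic_density {a b : ℝ} (ha : 0 < a) (hb : 0 < b) {F : ℝ × ℝ → ℝ}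
    (hF : MixedAbsCont a b F) : ∃ f : ℝ × ℝ → ℝ, IntegrableOn f (Ico 0 a ×ˢ Ico 0 b) ∧
      ∀ n i j, i ≤ 2 ^ n → j ≤ 2 ^ n →
        ∫ p in Ico 0 (dyadicPoint a n i) ×ˢ Ico 0 (dyadicPoint b n j), f p =
          mixedIncrement F (0, 0) (dyadicPoint a n i, dyadicPoint b n j) := by
  obtain ⟨M, hM⟩ := hF.exists_bound ha hb
  let π : ℕ → ℝ × ℝ → ℕ × ℕ := fun n p => (dyadicIndex a n p.1, dyadicIndex b n p.2)
  have hπ : ∀ n, Measurable (π n) := fun n =>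
    ((measurable_dyadicIndex a n).comp measurable_fst).prodMk
      ((measurable_dyadicIndex b n).comp measurable_snd)
  have hms : MeasurableSet (Ico (0 : ℝ) a ×ˢ Ico (0 : ℝ) b) := measurableSet_Ico.prod measurableSet_Ico
  have hI : ∀ n, ∀ᵐ p ∂(volume.restrict (Ico (0 : ℝ) a ×ˢ Ico (0 : ℝ) b)),
      π n p ∈ cellIndices n := fun n => by
    filter_upwards [ae_restrict_mem hms] with p hp
    exact mem_cellIndices.2 ⟨dyadicIndex_lt ha hp.1 n, dyadicIndex_lt hb hp.2 n⟩
  have : IsFiniteMeasure (volume.restrict (Ico (0 : ℝ) a ×ˢ Ico (0 : ℝ) b)) := by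
    refine ⟨?_⟩
    rw [Measure.restrict_apply_univ, Measure.volume_eq_prod, Measure.prod_prod]
    simp [ENNReal.mul_lt_top]
  have hm : ∀ n, ∀ k ∈ cellIndices n,
      (volume.restrict (Ico (0 : ℝ) a ×ˢ Ico (0 : ℝ) b)).real (π n ⁻¹' {k}) =
        a / 2 ^ n * (b / 2 ^ n) := by
    intro n k hk
    have hk' := mem_cellIndices.1 hk
    have e1 : π n ⁻¹' {k} ∩ Ico (0 : ℝ) a ×ˢ Ico (0 : ℝ) b =
        Ico (dyadicPoint a n k.1) (dyadicPoint a n (k.1 + 1)) ×ˢ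
          Ico (dyadicPoint b n k.2) (dyadicPoint b n (k.2 + 1)) := by
      ext ⟨x, y⟩
      simp only [π, mem_inter_iff, mem_preimage, mem_singleton_iff, mem_prod, Prod.ext_iff]
      constructor
      · rintro ⟨⟨h1, h2⟩, h3, h4⟩
        exact ⟨(dyadicIndex_eq_iff ha h3.1).1 h1, (dyadicIndex_eq_iff hb h4.1).1 h2⟩
      · rintro ⟨h1, h2⟩
        have h3 := (dyadicPoint_nonneg ha n k.1).trans h1.1
        have h4 := (dyadicPoint_nonneg hb n k.2).trans h2.1
        exact ⟨⟨(dyadicIndex_eq_iff ha h3).2 h1, (dyadicIndex_eq_iff hb h4).2 h2⟩,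
          ⟨h3, h1.2.trans_le (dyadicPoint_le ha hk'.1)⟩,
          ⟨h4, h2.2.trans_le (dyadicPoint_le hb hk'.2)⟩⟩
    rw [measureReal_def, Measure.restrict_apply (hπ n (MeasurableSet.of_discrete)), e1,
      Measure.volume_eq_prod, Measure.prod_prod, Real.volume_Ico, Real.volume_Ico,
      dyadicPoint_succ_sub, dyadicPoint_succ_sub, ENNReal.toReal_mul,
      ENNReal.toReal_ofReal (by positivity), ENNReal.toReal_ofReal (by positivity)]
  obtain ⟨f, hf, hfv⟩ := exists_density_of_nested_partitions
    (μ := volume.restrict (Ico (0 : ℝ) a ×ˢ Ico (0 : ℝ) b)) hπ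
    (par := fun k => (k.1 / 2, k.2 / 2))
    (fun n p => Prod.ext (dyadicIndex_succ_div a n p.1) (dyadicIndex_succ_div b n p.2))
    hI (m := fun n _ => a / 2 ^ n * (b / 2 ^ n)) (v := cellIncrement a b F)
    hm (fun n k _ => by positivity)
    (fun n k hk => cellIncrement_eq_sum a b F n k hk) hM (fun ε hε => hF.exists_cells ha hb hε)
  · refine ⟨f, hf, fun n i j hi hj => ?_⟩
    -- A dyadic rectangle with a corner at the origin is a union of cells, over which the increments
    -- telescope.
    have h1 := setIntegral_preimage_eq_sum (hπ n) (hI n) hf {k | k.1 < i ∧ k.2 < j}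
    rw [Measure.restrict_restrict (hπ n (MeasurableSet.of_discrete))] at h1
    have e1 : π n ⁻¹' {k | k.1 < i ∧ k.2 < j} ∩ Ico (0 : ℝ) a ×ˢ Ico (0 : ℝ) b =
        Ico 0 (dyadicPoint a n i) ×ˢ Ico 0 (dyadicPoint b n j) := by
      ext ⟨x, y⟩
      simp only [π, mem_inter_iff, mem_preimage, mem_ofPred_eq, mem_prod, mem_Ico]
      constructor
      · rintro ⟨⟨h1, h2⟩, ⟨h3, -⟩, h4, -⟩
        exact ⟨⟨h3, (dyadicIndex_lt_iff ha h3).1 h1⟩, h4, (dyadicIndex_lt_iff hb h4).1 h2⟩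
      · rintro ⟨⟨h1, h2⟩, h3, h4⟩
        exact ⟨⟨(dyadicIndex_lt_iff ha h1).2 h2, (dyadicIndex_lt_iff hb h3).2 h4⟩,
          ⟨h1, h2.trans_le (dyadicPoint_le ha hi)⟩, h3, h4.trans_le (dyadicPoint_le hb hj)⟩
    rw [e1] at h1
    rw [h1, ← sum_cellIncrement]
    have e2 : (cellIndices n).filter (· ∈ {k : ℕ × ℕ | k.1 < i ∧ k.2 < j}) =
        Finset.range i ×ˢ Finset.range j := by
      ext k
      simp only [Finset.mem_filter, mem_cellIndices, mem_ofPred_eq, Finset.mem_product,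
        Finset.mem_range]
      omega
    rw [e2]
    refine Finset.sum_congr rfl fun k hk => hfv n k (mem_cellIndices.2 ?_)
    rw [Finset.mem_product, Finset.mem_range, Finset.mem_range] at hk
    omega

/-- Two nested rectangles at the origin differ by two thin rectangles, [u,x] × [0,y] and [0,u] ×
[v,y], whose areas tend to 0. No continuity of `F` itself is used. -/
theorem MixedAbsCont.tendsto_mixedIncrement {a b : ℝ} {F : ℝ × ℝ → ℝ} (hF : MixedAbsCont a b F)
    {x y : ℝ} (hx : x ∈ Icc 0 a) (hy : y ∈ Icc 0 b) {u v : ℕ → ℝ} (hu : Tendsto u atTop (𝓝 x))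
    (hv : Tendsto v atTop (𝓝 y)) (hu' : ∀ n, u n ∈ Icc 0 x) (hv' : ∀ n, v n ∈ Icc 0 y) :
    Tendsto (fun n => mixedIncrement F (0, 0) (u n, v n)) atTop
      (𝓝 (mixedIncrement F (0, 0) (x, y))) := by
  refine Metric.tendsto_nhds.2 fun ε hε => ?_
  obtain ⟨δ, hδ, h⟩ := hF.exists_finset (half_pos hε)
  have hsingle : ∀ p q : ℝ × ℝ, (0 ≤ p.1 ∧ p.1 ≤ q.1 ∧ q.1 ≤ a ∧ 0 ≤ p.2 ∧ p.2 ≤ q.2 ∧ q.2 ≤ b) →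
      (q.1 - p.1) * (q.2 - p.2) < δ → |mixedIncrement F p q| < ε / 2 := by
    intro p q h1 h2
    simpa using h {()} (fun _ => p) (fun _ => q) (fun _ _ => h1)
      (fun i _ j _ hij => absurd (Subsingleton.elim i j) hij) (by simpa using h2)
  have l1 : Tendsto (fun n => (x - u n) * (y - 0)) atTop (𝓝 0) := by
    simpa using (hu.const_sub x).mul_const (y - 0)
  have l2 : Tendsto (fun n => (x - 0) * (y - v n)) atTop (𝓝 0) := by
    simpa using (hv.const_sub y).const_mul (x - 0)
  filter_upwards [l1.eventually (gt_mem_nhds hδ), l2.eventually (gt_mem_nhds hδ)] with n h1 h2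
  have hun := hu' n
  have hvn := hv' n
  have h2' : (u n - 0) * (y - v n) < δ := by
    refine lt_of_le_of_lt ?_ h2
    have := hun.2
    have := hvn.2
    gcongr
  have i1 := hsingle (u n, 0) (x, y) ⟨hun.1, hun.2, hx.2, le_rfl, hy.1, hy.2⟩ h1
  have i2 := hsingle (0, v n) (u n, y) ⟨le_rfl, hun.1, hun.2.trans hx.2, hvn.1, hvn.2, hy.2⟩ h2'
  rw [Real.dist_eq, abs_sub_comm]
  have e : mixedIncrement F (0, 0) (x, y) - mixedIncrement F (0, 0) (u n, v n) =
      mixedIncrement F (u n, 0) (x, y) + mixedIncrement F (0, v n) (u n, y) := by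
    simp only [mixedIncrement]; ring
  rw [e]
  exact (abs_add_le _ _).trans_lt (by linarith)

theorem Ioo_prod_ae_eq_Ico (x y : ℝ) :
    (Ioo 0 x ×ˢ Ioo 0 y : Set (ℝ × ℝ)) =ᵐ[volume] Ico 0 x ×ˢ Ico 0 y :=
  Measure.set_prod_ae_eq Ioo_ae_eq_Ico Ioo_ae_eq_Ico

theorem Ioo_prod_ae_eq_Ioc (x y : ℝ) :
    (Ioo 0 x ×ˢ Ioo 0 y : Set (ℝ × ℝ)) =ᵐ[volume] Ioc 0 x ×ˢ Ioc 0 y :=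
  Measure.set_prod_ae_eq Ioo_ae_eq_Ioc Ioo_ae_eq_Ioc

/-- A function with absolutely continuous mixed increments has a mixed density. -/
theorem MixedAbsCont.exists_density {a b : ℝ} (ha : 0 < a) (hb : 0 < b) {F : ℝ × ℝ → ℝ}
    (hF : MixedAbsCont a b F) : ∃ f : ℝ × ℝ → ℝ, IntegrableOn f (Ioo 0 a ×ˢ Ioo 0 b) ∧
      ∀ x ∈ Icc 0 a, ∀ y ∈ Icc 0 b,
        ∫ p in Ioo 0 x ×ˢ Ioo 0 y, f p = mixedIncrement F (0, 0) (x, y) := by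
  obtain ⟨f, hf, hfd⟩ := hF.exists_dyadic_density ha hb
  refine ⟨f, hf.congr_set_ae (Ioo_prod_ae_eq_Ico a b), fun x hx y hy => ?_⟩
  obtain ⟨hu, hu'⟩ := tendsto_dyadicPoint_dyadicIndex ha hx.1
  obtain ⟨hv, hv'⟩ := tendsto_dyadicPoint_dyadicIndex hb hy.1
  have h1 := hF.tendsto_mixedIncrement hx hy hu hv (fun n => ⟨dyadicPoint_nonneg ha _ _, hu' n⟩)
    (fun n => ⟨dyadicPoint_nonneg hb _ _, hv' n⟩)
  have hle : ∀ {a x : ℝ}, 0 < a → x ∈ Icc 0 a → ∀ n, dyadicIndex a n x ≤ 2 ^ n := by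
    intro a x ha hx n
    have h1 : x * 2 ^ n / a ≤ (2 ^ n : ℕ) := by
      push_cast
      rw [div_le_iff₀ ha, mul_comm]
      exact mul_le_mul_of_nonneg_left hx.2 (by positivity)
    exact Nat.floor_le_of_le h1
  -- Approximate the corner (x,y) from below by dyadic points: the integrals converge by dominated
  -- convergence, the increments by `tendsto_mixedIncrement`.
  refine tendsto_nhds_unique (f := fun n => ∫ p in Ico 0 (dyadicPoint a n (dyadicIndex a n x)) ×ˢ
    Ico 0 (dyadicPoint b n (dyadicIndex b n y)), f p) (l := atTop) ?_ ?_
  · have hms : ∀ s t : ℝ, MeasurableSet (Ico 0 s ×ˢ Ico 0 t : Set (ℝ × ℝ)) := fun s t =>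
      measurableSet_Ico.prod measurableSet_Ico
    simp only [← integral_indicator (hms _ _),
      ← integral_indicator (measurableSet_Ioo.prod (measurableSet_Ioo (a := (0 : ℝ) )) :
        MeasurableSet (Ioo 0 x ×ˢ Ioo 0 y))]
    have hint : Integrable ((Ico 0 a ×ˢ Ico 0 b).indicator f) := (integrable_indicator_iff (hms a b)).2 hf
    refine tendsto_integral_of_dominated_convergence
      (fun p => ‖(Ico 0 a ×ˢ Ico 0 b).indicator f p‖) (fun n => ?_) hint.norm (fun n => ?_) ?_
    · refine ((hf.mono_set ?_).integrable_indicator (hms _ _)).aestronglyMeasurable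
      exact prod_mono (Ico_subset_Ico_right ((hu' n).trans hx.2))
        (Ico_subset_Ico_right ((hv' n).trans hy.2))
    · refine Eventually.of_forall fun p => ?_
      refine norm_indicator_le_of_subset ?_ f p
      exact prod_mono (Ico_subset_Ico_right ((hu' n).trans hx.2))
        (Ico_subset_Ico_right ((hv' n).trans hy.2))
    · have hae : ∀ᵐ p : ℝ × ℝ, (Ioo 0 x ×ˢ Ioo 0 y).indicator f p =
          (Ico 0 x ×ˢ Ico 0 y).indicator f p := indicator_ae_eq_of_ae_eq_set (Ioo_prod_ae_eq_Ico x y)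
      filter_upwards [hae] with p hp
      rw [hp]
      by_cases hpm : p ∈ Ico 0 x ×ˢ Ico 0 y
      · refine tendsto_const_nhds.congr' ?_
        filter_upwards [hu.eventually (lt_mem_nhds hpm.1.2), hv.eventually (lt_mem_nhds hpm.2.2)]
          with n h1 h2
        rw [indicator_of_mem hpm, indicator_of_mem]
        exact ⟨⟨hpm.1.1, h1⟩, hpm.2.1, h2⟩
      · refine tendsto_const_nhds.congr fun n => ?_
        rw [indicator_of_notMem hpm, indicator_of_notMem]
        exact fun h => hpm ⟨⟨h.1.1, h.1.2.trans_le (hu' n)⟩, h.2.1, h.2.2.trans_le (hv' n)⟩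
  · refine h1.congr fun n => (hfd n _ _ (hle ha hx n) (hle hb hy n)).symm

/-! ### Iterated Lebesgue differentiation -/

/-- Rational increments are dense and `φ` is continuous off 0, so they decide the limit. With
countably many difference quotients the set of points where they converge to a given measurable
function becomes measurable. -/
theorem tendsto_nhdsNE_zero_of_rat {φ : ℝ → ℝ} {c : ℝ} (hφ : ContinuousOn φ {0}ᶜ)
    (h : Tendsto (fun q : ℚ => φ q) (comap (fun q : ℚ => (q : ℝ)) (𝓝[≠] 0)) (𝓝 c)) :
    Tendsto φ (𝓝[≠] 0) (𝓝 c) := by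
  refine Metric.tendsto_nhds.2 fun ε hε => ?_
  have h1 := Metric.tendsto_nhds.1 h (ε / 2) (half_pos hε)
  rw [eventually_comap] at h1
  obtain ⟨O, hO, hO0, hOs⟩ := mem_nhdsWithin.1 h1
  filter_upwards [inter_mem_nhdsWithin _ (hO.mem_nhds hO0)] with x hx
  have hopen : IsOpen (O ∩ {0}ᶜ : Set ℝ) := hO.inter isOpen_compl_singleton
  have hcl : x ∈ closure (O ∩ {0}ᶜ ∩ range ((↑) : ℚ → ℝ)) :=
    (Rat.denseRange_cast (𝕜 := ℝ)).open_subset_closure_inter hopen ⟨hx.2, hx.1⟩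
  have hmem := mem_closure_image (hφ.continuousAt (isOpen_compl_singleton.mem_nhds hx.1)) hcl
  have hsub : φ '' (O ∩ {0}ᶜ ∩ range ((↑) : ℚ → ℝ)) ⊆ Metric.closedBall c (ε / 2) := by
    rintro _ ⟨_, ⟨hz, q, rfl⟩, rfl⟩
    exact (hOs hz q rfl).le
  have := closure_minimal hsub Metric.isClosed_closedBall hmem
  exact lt_of_le_of_lt this (half_lt_self hε)

/-- Squeeze principle: pointwise convergence of monotone functions at the positive rational points
to a continuous function gives convergence at all positive points. -/
theorem tendsto_of_monotoneOn_of_rat {ι : Type*} {F : Filter ι} {f : ι → ℝ → ℝ} {g : ℝ → ℝ}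
    (hf : ∀ i, MonotoneOn (f i) (Ioi 0)) (hg : Continuous g)
    (h : ∀ q : ℚ, 0 < (q : ℝ) → Tendsto (fun i => f i q) F (𝓝 (g q))) {t : ℝ} (ht : 0 < t) :
    Tendsto (fun i => f i t) F (𝓝 (g t)) := by
  refine Metric.tendsto_nhds.2 fun ε hε => ?_
  obtain ⟨δ, hδ, hgδ⟩ := Metric.continuousAt_iff.1 hg.continuousAt (ε / 2) (half_pos hε)
  obtain ⟨q, hq1, hq2⟩ := exists_rat_btwn (max_lt ht (sub_lt_self t hδ))
  obtain ⟨s, hs1, hs2⟩ := exists_rat_btwn (lt_add_of_pos_right t hδ)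
  have hq0 : 0 < (q : ℝ) := (le_max_left _ _).trans_lt hq1
  have c1 := hgδ (show dist (q : ℝ) t < δ by
    rw [Real.dist_eq, abs_lt]; constructor <;> linarith [(le_max_right 0 (t - δ)).trans_lt hq1])
  have c2 := hgδ (show dist (s : ℝ) t < δ by
    rw [Real.dist_eq, abs_lt]; constructor <;> linarith)
  filter_upwards [Metric.tendsto_nhds.1 (h q hq0) (ε / 2) (half_pos hε),
    Metric.tendsto_nhds.1 (h s (ht.trans hs1)) (ε / 2) (half_pos hε)] with i h1 h2
  have m1 := hf i hq0 ht hq2.le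
  have m2 := hf i ht (ht.trans hs1) hs1.le
  rw [Real.dist_eq, abs_lt] at *
  constructor <;> linarith

/-- Lebesgue differentiation of the primitives of the sections of an integrable function. -/
theorem MeasureTheory.Integrable.ae_hasDerivAt_section {g : ℝ × ℝ → ℝ} (hg : Integrable g) :
    ∀ᵐ p : ℝ × ℝ, HasDerivAt (fun t => ∫ η in (0 : ℝ)..t, g (p.1, η)) (g p) p.2 := by
  -- On almost every vertical line `g` agrees almost everywhere with a measurable representative, so
  -- the primitives there do not change.
  wlog hgm : StronglyMeasurable g generalizing g
  · have h1 := this (hg.congr hg.1.ae_eq_mk) hg.1.stronglyMeasurable_mk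
    have h2 : ∀ᵐ p : ℝ × ℝ, ∀ᵐ η, g (p.1, η) = hg.1.mk g (p.1, η) :=
      Measure.quasiMeasurePreserving_fst.ae (Measure.ae_ae_of_ae_prod hg.1.ae_eq_mk)
    filter_upwards [h1, h2, hg.1.ae_eq_mk] with p a1 a2 a3
    rw [a3]
    convert! a1 using 1
    funext t
    exact intervalIntegral.integral_congr_ae (a2.mono fun η h _ => h)
  let φ : ℝ → ℝ × ℝ → ℝ := fun h p => h⁻¹ * ∫ s in (0 : ℝ)..h, g (p.1, p.2 + s)
  have hφm : ∀ h, Measurable (φ h) := by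
    intro h
    have hm : StronglyMeasurable fun z : (ℝ × ℝ) × ℝ => g (z.1.1, z.1.2 + z.2) :=
      hgm.comp_measurable (by fun_prop)
    refine Measurable.const_mul ?_ _
    exact (hm.integral_prod_right'.sub hm.integral_prod_right').measurable
  have hφ : ∀ p : ℝ × ℝ, Integrable (fun η => g (p.1, η)) → ∀ h, φ h p =
      h⁻¹ • ((∫ η in (0 : ℝ)..p.2 + h, g (p.1, η)) - ∫ η in (0 : ℝ)..p.2, g (p.1, η)) := by
    intro p hp h
    rw [intervalIntegral.integral_interval_sub_left hp.intervalIntegrable hp.intervalIntegrable]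
    simp only [φ, smul_eq_mul]
    rw [intervalIntegral.integral_comp_add_left (fun η => g (p.1, η)), add_zero]
  -- Measurability allows the almost everywhere statement in the plane to be checked line by line,
  -- where it is the one-dimensional Lebesgue theorem.
  have hE : MeasurableSet {p : ℝ × ℝ | Tendsto (fun q : ℚ => φ q p)
      (comap (fun q : ℚ => (q : ℝ)) (𝓝[≠] 0)) (𝓝 (g p))} :=
    measurableSet_tendsto_fun (f := fun q : ℚ => φ q) (fun q => hφm q) hgm.measurable
  have hint : ∀ᵐ ξ : ℝ, Integrable fun η => g (ξ, η) := hg.prod_right_ae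
  have hae : ∀ᵐ p : ℝ × ℝ, p ∈ {p : ℝ × ℝ | Tendsto (fun q : ℚ => φ q p)
      (comap (fun q : ℚ => (q : ℝ)) (𝓝[≠] 0)) (𝓝 (g p))} := by
    rw [Measure.volume_eq_prod, Measure.ae_prod_mem_iff_ae_ae_mem hE]
    filter_upwards [hint] with ξ hξ
    filter_upwards [LocallyIntegrable.ae_hasDerivAt_integral hξ.locallyIntegrable] with η hη
    have := hasDerivAt_iff_tendsto_slope_zero.1 (hη 0)
    refine (this.comp tendsto_comap).congr fun q => ?_
    exact (hφ (ξ, η) hξ q).symm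
  filter_upwards [hae, Measure.quasiMeasurePreserving_fst.ae hint] with p h1 h2
  refine hasDerivAt_iff_tendsto_slope_zero.2 ?_
  simp only [← hφ p h2]
  refine tendsto_nhdsNE_zero_of_rat ?_ h1
  have hc := h2.continuous_primitive 0
  refine ContinuousOn.congr (f := fun h => h⁻¹ •
    ((∫ η in (0 : ℝ)..p.2 + h, g (p.1, η)) - ∫ η in (0 : ℝ)..p.2, g (p.1, η))) ?_
    fun h _ => hφ p h2 h
  refine (continuousOn_inv₀).smul (Continuous.continuousOn ?_)
  exact (hc.comp (by fun_prop)).sub continuous_const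

theorem MeasureTheory.Integrable.integrable_section_primitive {g : ℝ × ℝ → ℝ} (hg : Integrable g)
    (t : ℝ) : Integrable fun ξ => ∫ η in (0 : ℝ)..t, g (ξ, η) := by
  have h : ∀ s : Set ℝ, Integrable fun ξ => ∫ η in s, g (ξ, η) := by
    intro s
    have h1 : Integrable g ((volume : Measure ℝ).prod (volume.restrict s)) := by
      have := hg.restrict (s := univ ×ˢ s)
      rwa [Measure.volume_eq_prod, ← Measure.prod_restrict, Measure.restrict_univ] at this
    exact h1.integral_prod_left
  exact (h _).sub (h _)

/-- The primitive in the first variable of an integrable function of two variables, integrated in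
the second variable up to `t`, is differentiable almost everywhere, with an exceptional set which
does not depend on `t`. -/
theorem MeasureTheory.Integrable.ae_forall_hasDerivAt_primitive {g : ℝ × ℝ → ℝ}
    (hg : Integrable g) : ∀ᵐ ξ : ℝ, ∀ t > 0,
      HasDerivAt (fun x => ∫ ζ in (0 : ℝ)..x, ∫ η in (0 : ℝ)..t, g (ζ, η))
        (∫ η in (0 : ℝ)..t, g (ξ, η)) ξ := by
  -- The positive and negative parts are treated separately; nonnegativity makes everything monotone
  -- in `t`.
  wlog hpos : ∀ p, 0 ≤ g p generalizing g
  · have h1 := this hg.pos_part fun p => le_max_right _ _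
    have h2 := this hg.neg_part fun p => le_max_right _ _
    have hsplit : ∀ᵐ ξ : ℝ, ∀ t, ∫ η in (0 : ℝ)..t, g (ξ, η) =
        (∫ η in (0 : ℝ)..t, max (g (ξ, η)) 0) - ∫ η in (0 : ℝ)..t, max (-g (ξ, η)) 0 := by
      filter_upwards [hg.prod_right_ae] with ξ hξ t
      rw [← intervalIntegral.integral_sub hξ.pos_part.intervalIntegrable
        hξ.neg_part.intervalIntegrable]
      refine intervalIntegral.integral_congr fun η _ => ?_
      rcases le_total (g (ξ, η)) 0 with h | h <;> simp [h]
    filter_upwards [h1, h2, hsplit] with ξ a1 a2 a3 t ht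
    rw [a3]
    convert! (a1 t ht).sub (a2 t ht) using 1
    funext x
    change _ = (∫ ζ in (0 : ℝ)..x, ∫ η in (0 : ℝ)..t, max (g (ζ, η)) 0) -
      ∫ ζ in (0 : ℝ)..x, ∫ η in (0 : ℝ)..t, max (-g (ζ, η)) 0
    rw [← intervalIntegral.integral_sub
      (hg.pos_part.integrable_section_primitive t).intervalIntegrable
      (hg.neg_part.integrable_section_primitive t).intervalIntegrable]
    exact intervalIntegral.integral_congr_ae (hsplit.mono fun ζ h _ => h t)
  have hrat : ∀ᵐ ξ : ℝ, ∀ q : ℚ,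
      HasDerivAt (fun x => ∫ ζ in (0 : ℝ)..x, ∫ η in (0 : ℝ)..(q : ℝ), g (ζ, η))
        (∫ η in (0 : ℝ)..(q : ℝ), g (ξ, η)) ξ :=
    ae_all_iff.2 fun q => (LocallyIntegrable.ae_hasDerivAt_integral
      (hg.integrable_section_primitive q).locallyIntegrable).mono
      fun ξ h => h 0
  have hsec : ∀ᵐ ξ : ℝ, Integrable fun η => g (ξ, η) := hg.prod_right_ae
  filter_upwards [hrat, hsec] with ξ h1 h2 t ht
  rw [hasDerivAt_iff_tendsto_slope]
  -- For `g ≥ 0` the slopes in `x` increase with `t`, so convergence at rational `t` squeezes all `t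
  -- > 0`. Hence one null set of abscissas serves uncountably many `t`.
  refine tendsto_of_monotoneOn_of_rat (f := fun x t => slope (fun x => ∫ ζ in (0 : ℝ)..x,
    ∫ η in (0 : ℝ)..t, g (ζ, η)) ξ x) (g := fun t => ∫ η in (0 : ℝ)..t, g (ξ, η)) ?_
    (h2.continuous_primitive 0) (fun q _ => hasDerivAt_iff_tendsto_slope.1 (h1 q)) ht
  intro x s hs t ht hst
  have hmono : ∀ᵐ ζ : ℝ, ∫ η in (0 : ℝ)..s, g (ζ, η) ≤ ∫ η in (0 : ℝ)..t, g (ζ, η) := by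
    filter_upwards [hsec] with ζ hζ
    exact intervalIntegral.integral_mono_interval le_rfl (le_of_lt hs) hst
      (Eventually.of_forall fun η => hpos _) hζ.intervalIntegrable
  have i1 := fun t : ℝ => hg.integrable_section_primitive t
  simp only [slope, vsub_eq_sub, smul_eq_mul]
  rw [intervalIntegral.integral_interval_sub_left (i1 s).intervalIntegrable (i1 s).intervalIntegrable,
    intervalIntegral.integral_interval_sub_left (i1 t).intervalIntegrable (i1 t).intervalIntegrable]
  rcases le_total ξ x with h | h
  · refine mul_le_mul_of_nonneg_left ?_ (inv_nonneg.2 (sub_nonneg.2 h))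
    exact intervalIntegral.integral_mono_ae h (i1 s).intervalIntegrable (i1 t).intervalIntegrable hmono
  · refine mul_le_mul_of_nonpos_left ?_ (inv_nonpos.2 (sub_nonpos.2 h))
    rw [intervalIntegral.integral_symm x ξ, intervalIntegral.integral_symm x ξ]
    exact neg_le_neg (intervalIntegral.integral_mono_ae h (i1 s).intervalIntegrable
      (i1 t).intervalIntegrable hmono)

/-- The iterated derivatives of `(x, t) ↦ ∫∫_{(0,x) × (0,t)} g` at `p` are given by the sections of
`g`. -/
structure HasMixedIntegralDeriv (a b : ℝ) (g : ℝ × ℝ → ℝ) (p : ℝ × ℝ) : Prop where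
  integrableOn_section : IntegrableOn (fun η => g (p.1, η)) (Ioo 0 b)
  deriv_fst : ∀ t ∈ Ioc 0 b, HasDerivWithinAt (fun x => ∫ q in Ioo 0 x ×ˢ Ioo 0 t, g q)
    (∫ η in Ioo 0 t, g (p.1, η)) (Ioc 0 a) p.1
  deriv_snd : HasDerivWithinAt (fun t => ∫ η in Ioo 0 t, g (p.1, η)) (g p) (Ioc 0 b) p.2

theorem setIntegral_Ioo_eq_intervalIntegral {x : ℝ} (hx : 0 ≤ x) (f : ℝ → ℝ) :
    ∫ η in Ioo 0 x, f η = ∫ η in (0 : ℝ)..x, f η := by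
  rw [intervalIntegral.integral_of_le hx, integral_Ioc_eq_integral_Ioo]

theorem integral_Ioo_prod {a b : ℝ} {g : ℝ × ℝ → ℝ} (hg : IntegrableOn g (Ioo 0 a ×ˢ Ioo 0 b))
    {x t : ℝ} (hx : x ≤ a) (ht : t ≤ b) :
    ∫ q in Ioo 0 x ×ˢ Ioo 0 t, g q = ∫ ζ in Ioo 0 x, ∫ η in Ioo 0 t, g (ζ, η) :=
  setIntegral_prod g (hg.mono_set (prod_mono (Ioo_subset_Ioo_right hx) (Ioo_subset_Ioo_right ht)))

theorem ae_hasMixedIntegralDeriv {a b : ℝ} {g : ℝ × ℝ → ℝ}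
    (hg : IntegrableOn g (Ioo 0 a ×ˢ Ioo 0 b)) :
    ∀ᵐ p ∂(volume.restrict (Ioc 0 a ×ˢ Ioc 0 b)), HasMixedIntegralDeriv a b g p := by
  have hR : MeasurableSet (Ioo 0 a ×ˢ Ioo 0 b : Set (ℝ × ℝ)) := measurableSet_Ioo.prod measurableSet_Ioo
  -- The edges x = a and y = b are null; in the open rectangle `g` may be replaced by its extension
  -- by zero.
  rw [← Measure.restrict_congr_set (Ioo_prod_ae_eq_Ioc a b), ae_restrict_iff' hR]
  have hG : Integrable ((Ioo 0 a ×ˢ Ioo 0 b).indicator g) := hg.integrable_indicator hR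
  have hval : ∀ ζ ∈ Ioo 0 a, ∀ t ∈ Icc 0 b,
      ∫ η in (0 : ℝ)..t, (Ioo 0 a ×ˢ Ioo 0 b).indicator g (ζ, η) = ∫ η in Ioo 0 t, g (ζ, η) := by
    intro ζ hζ t ht
    rw [← setIntegral_Ioo_eq_intervalIntegral ht.1]
    refine setIntegral_congr_fun measurableSet_Ioo fun η hη => ?_
    exact indicator_of_mem (mk_mem_prod hζ (Ioo_subset_Ioo_right ht.2 hη)) g
  have hfst : Measure.QuasiMeasurePreserving (Prod.fst : ℝ × ℝ → ℝ) volume volume :=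
    Measure.quasiMeasurePreserving_fst
  have h2 := hfst.ae hG.ae_forall_hasDerivAt_primitive
  have h3 : ∀ᵐ ξ : ℝ, Integrable fun η => (Ioo 0 a ×ˢ Ioo 0 b).indicator g (ξ, η) :=
    hG.prod_right_ae
  have h3 := hfst.ae h3
  filter_upwards [hG.ae_hasDerivAt_section, h2, h3] with p h1 h2 h3 hp
  refine ⟨?_, fun t ht => ?_, ?_⟩
  · exact h3.integrableOn.congr_fun
      (fun η hη => indicator_of_mem (mk_mem_prod hp.1 hη) g) measurableSet_Ioo
  · have := (h2 t ht.1).hasDerivWithinAt (s := Ioc 0 a)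
    rw [hval p.1 hp.1 t ⟨ht.1.le, ht.2⟩] at this
    have hx : ∀ x ∈ Ioc 0 a, ∫ q in Ioo 0 x ×ˢ Ioo 0 t, g q =
        ∫ ζ in (0 : ℝ)..x, ∫ η in (0 : ℝ)..t, (Ioo 0 a ×ˢ Ioo 0 b).indicator g (ζ, η) := by
      intro x hx
      rw [integral_Ioo_prod hg hx.2 ht.2, ← setIntegral_Ioo_eq_intervalIntegral hx.1.le]
      exact setIntegral_congr_fun measurableSet_Ioo fun ζ hζ =>
        (hval ζ (Ioo_subset_Ioo_right hx.2 hζ) t ⟨ht.1.le, ht.2⟩).symm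
    exact this.congr_of_mem hx ⟨hp.1.1, hp.1.2.le⟩
  · rw [indicator_of_mem hp] at h1
    exact (h1.hasDerivWithinAt (s := Ioc 0 b)).congr_of_mem
      (fun t ht => (hval p.1 hp.1 t ⟨ht.1.le, ht.2⟩).symm) ⟨hp.2.1, hp.2.2.le⟩

theorem hasDerivWithinAt_integral_Ioo {a : ℝ} {h : ℝ → ℝ} (hc : ContinuousOn h (Ioc 0 a))
    (hi : IntegrableOn h (Ioo 0 a)) {x : ℝ} (hx : x ∈ Ioc 0 a) :
    HasDerivWithinAt (fun u => ∫ ζ in Ioo 0 u, h ζ) (h x) (Ioc 0 a) x := by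
  have hint : IntervalIntegrable h volume 0 x := by
    rw [intervalIntegrable_iff_integrableOn_Ioo_of_le hx.1.le]
    exact hi.mono_set (Ioo_subset_Ioo_right hx.2)
  have key : HasDerivWithinAt (fun u => ∫ ζ in (0 : ℝ)..u, h ζ) (h x) (Ioc 0 a) x := by
    rcases hx.2.lt_or_eq with hxa | rfl
    · have hc' : ContinuousOn h (Ioo 0 a) := hc.mono Ioo_subset_Ioc_self
      exact (intervalIntegral.integral_hasDerivAt_right hint
        (hc'.stronglyMeasurableAtFilter isOpen_Ioo x ⟨hx.1, hxa⟩)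
        (hc'.continuousAt (isOpen_Ioo.mem_nhds ⟨hx.1, hxa⟩))).hasDerivWithinAt
    -- At the right end of the interval only the left derivative is meant, and one-sided continuity
    -- suffices.
    · have e : 𝓝[Ioc 0 x] x = 𝓝[≤] x := nhdsWithin_Ioc_eq_nhdsLE hx.1
      have hm := hc.stronglyMeasurableAtFilter_nhdsWithin (μ := volume) measurableSet_Ioc x
      have hcw := hc x hx
      rw [ContinuousWithinAt, e] at hcw
      rw [e] at hm
      exact (intervalIntegral.integral_hasDerivWithinAt_right hint (s := Iic x) (t := Iic x)
        hm hcw).mono Ioc_subset_Iic_self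
  exact key.congr_of_mem (fun u hu => setIntegral_Ioo_eq_intervalIntegral hu.1.le h) hx

theorem integrableOn_Ioo_prod_of_bounded {a b C : ℝ} {g : ℝ × ℝ → ℝ}
    (hg : ContinuousOn g (Ioc 0 a ×ˢ Ioc 0 b)) (hC : ∀ q ∈ Ioc 0 a ×ˢ Ioc 0 b, |g q| ≤ C) :
    IntegrableOn g (Ioo 0 a ×ˢ Ioo 0 b) := by
  have hR : MeasurableSet (Ioo 0 a ×ˢ Ioo 0 b : Set (ℝ × ℝ)) :=
    measurableSet_Ioo.prod measurableSet_Ioo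
  have hsub : (Ioo 0 a ×ˢ Ioo 0 b : Set (ℝ × ℝ)) ⊆ Ioc 0 a ×ˢ Ioc 0 b :=
    prod_mono Ioo_subset_Ioc_self Ioo_subset_Ioc_self
  refine IntegrableOn.of_bound ?_ ?_ C ?_
  · rw [Measure.volume_eq_prod, Measure.prod_prod]
    simp [ENNReal.mul_lt_top]
  · exact (hg.mono hsub).aestronglyMeasurable hR
  · exact (ae_restrict_mem hR).mono fun q hq => hC q (hsub hq)

/-- Boundedness gives dominated convergence, so the section integrals depend continuously on the
first variable; the fundamental theorem then applies in each variable at every point, the edges x =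
a and y = b included. -/
theorem ContinuousOn.hasMixedIntegralDeriv {a b C : ℝ} {g : ℝ × ℝ → ℝ}
    (hg : ContinuousOn g (Ioc 0 a ×ˢ Ioc 0 b)) (hC : ∀ q ∈ Ioc 0 a ×ˢ Ioc 0 b, |g q| ≤ C)
    {p : ℝ × ℝ} (hp : p ∈ Ioc 0 a ×ˢ Ioc 0 b) : HasMixedIntegralDeriv a b g p := by
  have hint := integrableOn_Ioo_prod_of_bounded hg hC
  have hsec : ∀ ζ ∈ Ioc 0 a, ContinuousOn (fun η => g (ζ, η)) (Ioc 0 b) := fun ζ hζ =>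
    hg.comp (by fun_prop) fun η hη => mk_mem_prod hζ hη
  have hsint : ∀ ζ ∈ Ioc 0 a, IntegrableOn (fun η => g (ζ, η)) (Ioo 0 b) := by
    intro ζ hζ
    refine IntegrableOn.of_bound (by simp)
      (((hsec ζ hζ).mono Ioo_subset_Ioc_self).aestronglyMeasurable measurableSet_Ioo) C ?_
    exact (ae_restrict_mem measurableSet_Ioo).mono fun η hη =>
      hC _ (mk_mem_prod hζ (Ioo_subset_Ioc_self hη))
  refine ⟨hsint p.1 hp.1, fun t ht => ?_, hasDerivWithinAt_integral_Ioo (hsec p.1 hp.1)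
    (hsint p.1 hp.1) hp.2⟩
  have hcont : ContinuousOn (fun ζ => ∫ η in Ioo 0 t, g (ζ, η)) (Ioc 0 a) := by
    refine continuousOn_of_dominated (bound := fun _ => C) (fun ζ hζ => ?_) (fun ζ hζ => ?_) ?_ ?_
    · exact ((hsint ζ hζ).mono_set (Ioo_subset_Ioo_right ht.2)).aestronglyMeasurable
    · exact (ae_restrict_mem measurableSet_Ioo).mono fun η hη =>
        hC _ (mk_mem_prod hζ ⟨hη.1, hη.2.le.trans ht.2⟩)
    · exact integrableOn_const (by simp)
    · exact (ae_restrict_mem measurableSet_Ioo).mono fun η hη =>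
        hg.comp (by fun_prop) fun ζ hζ => mk_mem_prod hζ ⟨hη.1, hη.2.le.trans ht.2⟩
  have hi : IntegrableOn (fun ζ => ∫ η in Ioo 0 t, g (ζ, η)) (Ioo 0 a) := by
    have h1 := hint.mono_set (Set.prod_mono (Subset.refl (Ioo 0 a))
      (Ioo_subset_Ioo_right ht.2 : Ioo 0 t ⊆ Ioo 0 b))
    rw [IntegrableOn, Measure.volume_eq_prod, ← Measure.prod_restrict] at h1
    exact h1.integral_prod_left
  exact (hasDerivWithinAt_integral_Ioo hcont hi hp.1).congr_of_mem
    (fun x hx => integral_Ioo_prod hint hx.2 ht.2) hp.1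

/-! ### Levelwise integrals of fuzzy functions -/

namespace FuzzyNumber

/-- Levelwise integrability of an almost everywhere level-continuous fuzzy function. -/
structure FuzzyIntegrable {X : Type*} [MeasurableSpace X] (μ : Measure X) (U : X → FuzzyNumber) :
    Prop where
  lo : ∀ r ∈ Icc (0 : ℝ) 1, Integrable (fun x => (U x).lo r) μ
  hi : ∀ r ∈ Icc (0 : ℝ) 1, Integrable (fun x => (U x).hi r) μ
  levelContinuous : ∀ᵐ x ∂μ, (U x).LevelContinuous

/-- Monotonicity in the level bounds every level by the levels 0 and 1, which gives one dominating
function for all levels at once. -/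
theorem abs_lo_le (u : FuzzyNumber) {r : ℝ} (hr : r ∈ Icc (0 : ℝ) 1) :
    |u.lo r| ≤ |u.lo 0| + |u.lo 1| := by
  have h1 := u.lo_mono hr.1 hr.2
  have h2 := u.lo_mono hr.2 le_rfl
  rw [abs_le]
  constructor
  · linarith [neg_abs_le (u.lo 0), abs_nonneg (u.lo 1)]
  · linarith [le_abs_self (u.lo 1), abs_nonneg (u.lo 0)]

theorem abs_hi_le (u : FuzzyNumber) {r : ℝ} (hr : r ∈ Icc (0 : ℝ) 1) :
    |u.hi r| ≤ |u.hi 0| + |u.hi 1| := by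
  have h1 := u.hi_anti hr.1 hr.2
  have h2 := u.hi_anti hr.2 le_rfl
  rw [abs_le]
  constructor
  · linarith [neg_abs_le (u.hi 1), abs_nonneg (u.hi 0)]
  · linarith [le_abs_self (u.hi 0), abs_nonneg (u.hi 1)]

section Integral

variable {X : Type*} [MeasurableSpace X] {μ : Measure X} {U : X → FuzzyNumber}

/-- Other levels are almost everywhere limits of rational ones, which gives measurability;
domination by the levels 0 and 1 gives integrability. Thus almost everywhere arguments need only
countably many levels. -/
theorem FuzzyIntegrable.of_rat
    (h : ∀ q : ℚ, (q : ℝ) ∈ Icc (0 : ℝ) 1 →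
      Integrable (fun x => (U x).lo q) μ ∧ Integrable (fun x => (U x).hi q) μ)
    (hc : ∀ᵐ x ∂μ, (U x).LevelContinuous) : FuzzyIntegrable μ U := by
  have h0 := h 0 (by simp)
  have h1 := h 1 (by simp)
  push_cast at h0 h1
  have hseq : ∀ r ∈ Icc (0 : ℝ) 1, ∃ q : ℕ → ℚ, (∀ n, (q n : ℝ) ∈ Icc (0 : ℝ) 1) ∧
      Tendsto (fun n => (q n : ℝ)) atTop (𝓝 r) := by
    intro r hr
    refine ⟨fun n => (⌊r * (n + 1 : ℝ)⌋₊ : ℚ) / (n + 1), fun n => ?_, ?_⟩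
    · push_cast
      have hn : (0 : ℝ) < n + 1 := by positivity
      refine ⟨by positivity, (div_le_one hn).2 ?_⟩
      refine (Nat.floor_le (mul_nonneg hr.1 hn.le)).trans ?_
      nlinarith [hr.2]
    · push_cast
      exact (tendsto_nat_floor_mul_div_atTop hr.1).comp
        (tendsto_atTop_add_const_right _ 1 tendsto_natCast_atTop_atTop)
  refine ⟨fun r hr => ?_, fun r hr => ?_, hc⟩ <;> obtain ⟨q, hq, hqr⟩ := hseq r hr
  · refine Integrable.mono' (h0.1.abs.add h1.1.abs) ?_
      (Eventually.of_forall fun x => abs_lo_le (U x) hr)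
    refine aestronglyMeasurable_of_tendsto_ae atTop (fun n => (h (q n) (hq n)).1.1) ?_
    filter_upwards [hc] with x hx
    exact (hx.1 r hr).tendsto.comp (tendsto_nhdsWithin_iff.2 ⟨hqr, Eventually.of_forall hq⟩)
  · refine Integrable.mono' (h0.2.abs.add h1.2.abs) ?_
      (Eventually.of_forall fun x => abs_hi_le (U x) hr)
    refine aestronglyMeasurable_of_tendsto_ae atTop (fun n => (h (q n) (hq n)).2.1) ?_
    filter_upwards [hc] with x hx
    exact (hx.2 r hr).tendsto.comp (tendsto_nhdsWithin_iff.2 ⟨hqr, Eventually.of_forall hq⟩)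

theorem FuzzyIntegrable.continuousOn (h : FuzzyIntegrable μ U) :
    ContinuousOn (fun r => ∫ x, (U x).lo r ∂μ) (Icc 0 1) ∧
      ContinuousOn (fun r => ∫ x, (U x).hi r ∂μ) (Icc 0 1) := by
  have i0 : (0 : ℝ) ∈ Icc (0 : ℝ) 1 := by simp
  have i1 : (1 : ℝ) ∈ Icc (0 : ℝ) 1 := by simp
  constructor
  · exact continuousOn_of_dominated (fun r hr => (h.lo r hr).1)
      (fun r hr => Eventually.of_forall fun x => abs_lo_le (U x) hr)
      ((h.lo 0 i0).abs.add (h.lo 1 i1).abs) (h.levelContinuous.mono fun x hx => hx.1)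
  · exact continuousOn_of_dominated (fun r hr => (h.hi r hr).1)
      (fun r hr => Eventually.of_forall fun x => abs_hi_le (U x) hr)
      ((h.hi 0 i0).abs.add (h.hi 1 i1).abs) (h.levelContinuous.mono fun x hx => hx.2)

/-- Integration preserves monotonicity in the level and the order of the end points, and dominated
convergence preserves continuity, so the integrals are again end points of a fuzzy number. -/
theorem FuzzyIntegrable.exists_integral (h : FuzzyIntegrable μ U) :
    ∃ w : FuzzyNumber, ∀ r ∈ Icc (0 : ℝ) 1,
      w.lo r = ∫ x, (U x).lo r ∂μ ∧ w.hi r = ∫ x, (U x).hi r ∂μ := by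
  have i1 : (1 : ℝ) ∈ Icc (0 : ℝ) 1 := by simp
  exact exists_ofEnds
    (fun r hr s hs hrs => integral_mono (h.lo r hr) (h.lo s hs) fun x => (U x).lo_mono hrs hs.2)
    (fun r hr s hs hrs => integral_mono (h.hi s hs) (h.hi r hr) fun x => (U x).hi_anti hrs hs.2)
    (integral_mono (h.lo 1 i1) (h.hi 1 i1) fun x => (U x).lo_le_hi le_rfl)
    h.continuousOn.1 h.continuousOn.2

/-- The levelwise integral of a fuzzy function. -/
noncomputable def fuzzyIntegral (μ : Measure X) (U : X → FuzzyNumber) : FuzzyNumber :=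
  Classical.epsilon fun w => ∀ r ∈ Icc (0 : ℝ) 1,
    w.lo r = ∫ x, (U x).lo r ∂μ ∧ w.hi r = ∫ x, (U x).hi r ∂μ

theorem FuzzyIntegrable.lo_integral (h : FuzzyIntegrable μ U) {r : ℝ} (hr : r ∈ Icc (0 : ℝ) 1) :
    (fuzzyIntegral μ U).lo r = ∫ x, (U x).lo r ∂μ :=
  (Classical.epsilon_spec h.exists_integral r hr).1

theorem FuzzyIntegrable.hi_integral (h : FuzzyIntegrable μ U) {r : ℝ} (hr : r ∈ Icc (0 : ℝ) 1) :
    (fuzzyIntegral μ U).hi r = ∫ x, (U x).hi r ∂μ :=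
  (Classical.epsilon_spec h.exists_integral r hr).2

theorem FuzzyIntegrable.levelContinuous_integral (h : FuzzyIntegrable μ U) :
    (fuzzyIntegral μ U).LevelContinuous :=
  ⟨h.continuousOn.1.congr fun _ hr => h.lo_integral hr,
    h.continuousOn.2.congr fun _ hr => h.hi_integral hr⟩

theorem FuzzyIntegrable.mono_measure {ν : Measure X} (h : FuzzyIntegrable μ U) (hν : ν ≤ μ) :
    FuzzyIntegrable ν U :=
  ⟨fun r hr => (h.lo r hr).mono_measure hν, fun r hr => (h.hi r hr).mono_measure hν,
    h.levelContinuous.filter_mono (MeasureTheory.ae_mono hν)⟩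

theorem FuzzyIntegrable.mono_set {s t : Set X} (h : FuzzyIntegrable (μ.restrict t) U)
    (hst : s ⊆ t) : FuzzyIntegrable (μ.restrict s) U :=
  h.mono_measure (Measure.restrict_mono hst le_rfl)

theorem FuzzyIntegrable.integral_union {s t : Set X} (h : FuzzyIntegrable (μ.restrict (s ∪ t)) U)
    (hst : Disjoint s t) (ht : MeasurableSet t) :
    fuzzyIntegral (μ.restrict (s ∪ t)) U =
      fuzzyIntegral (μ.restrict s) U + fuzzyIntegral (μ.restrict t) U := by
  have h1 := h.mono_set subset_union_left
  have h2 := h.mono_set subset_union_right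
  refine eq_of_ends fun r hr => ⟨?_, ?_⟩
  · rw [lo_add _ _ hr.2, h.lo_integral hr, h1.lo_integral hr, h2.lo_integral hr]
    exact setIntegral_union hst ht (h1.lo r hr) (h2.lo r hr)
  · rw [hi_add _ _ hr.2, h.hi_integral hr, h1.hi_integral hr, h2.hi_integral hr]
    exact setIntegral_union hst ht (h1.hi r hr) (h2.hi r hr)

theorem FuzzyIntegrable.smul {c : X → ℝ} (h : FuzzyIntegrable μ U) (hc : ∀ᵐ x ∂μ, 0 < c x)
    (hi : ∀ q : ℚ, (q : ℝ) ∈ Icc (0 : ℝ) 1 → Integrable (fun x => c x * (U x).lo q) μ ∧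
      Integrable (fun x => c x * (U x).hi q) μ) :
    FuzzyIntegrable μ (fun x => c x • U x) := by
  refine FuzzyIntegrable.of_rat (fun q hq => ⟨?_, ?_⟩) ?_
  · exact (hi q hq).1.congr (hc.mono fun x hx => (lo_smul_of_pos _ hx q).symm)
  · exact (hi q hq).2.congr (hc.mono fun x hx => (hi_smul_of_pos _ hx q).symm)
  · filter_upwards [hc, h.levelContinuous] with x hx hU using hU.smul hx.ne'

theorem FuzzyIntegrable.integral_smul {c : X → ℝ} (h : FuzzyIntegrable μ fun x => c x • U x)
    (hc : ∀ᵐ x ∂μ, 0 < c x) {r : ℝ} (hr : r ∈ Icc (0 : ℝ) 1) :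
    (fuzzyIntegral μ fun x => c x • U x).lo r = ∫ x, c x * (U x).lo r ∂μ ∧
      (fuzzyIntegral μ fun x => c x • U x).hi r = ∫ x, c x * (U x).hi r ∂μ := by
  rw [h.lo_integral hr, h.hi_integral hr]
  exact ⟨integral_congr_ae (hc.mono fun x hx => lo_smul_of_pos _ hx r),
    integral_congr_ae (hc.mono fun x hx => hi_smul_of_pos _ hx r)⟩

end Integral

theorem FuzzyIntegrable.hasFuzzyIntegral {S : Set (ℝ × ℝ)} {U : ℝ × ℝ → FuzzyNumber}
    (h : FuzzyIntegrable (volume.restrict S) U) :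
    HasFuzzyIntegral S U (fuzzyIntegral (volume.restrict S) U) :=
  fun r hr => ⟨h.lo r hr, h.hi r hr, h.lo_integral hr, h.hi_integral hr⟩

theorem HasFuzzyIntegral.congr {S : Set (ℝ × ℝ)} {U U' : ℝ × ℝ → FuzzyNumber} {w : FuzzyNumber}
    (h : HasFuzzyIntegral S U w) (hS : MeasurableSet S) (he : EqOn U U' S) :
    HasFuzzyIntegral S U' w := by
  intro r hr
  obtain ⟨h1, h2, h3, h4⟩ := h r hr
  refine ⟨h1.congr_fun (fun q hq => by simp only [he hq]) hS,
    h2.congr_fun (fun q hq => by simp only [he hq]) hS, h3.trans ?_, h4.trans ?_⟩ <;>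
  exact setIntegral_congr_fun hS fun q hq => by simp only [he hq]

/-- The mixed gH-derivative of an indefinite double integral. -/
theorem FuzzyIntegrable.hasMixedGHDeriv {a b : ℝ} {G : ℝ × ℝ → FuzzyNumber}
    (hG : FuzzyIntegrable (volume.restrict (Ioo 0 a ×ˢ Ioo 0 b)) G) {p : ℝ × ℝ}
    (hp : p ∈ rect a b) (hpc : (G p).LevelContinuous)
    (hsec : ∀ᵐ η ∂(volume.restrict (Ioo 0 b)), (G (p.1, η)).LevelContinuous)
    (hd : ∀ q : ℚ, (q : ℝ) ∈ Icc (0 : ℝ) 1 →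
      HasMixedIntegralDeriv a b (fun z => (G z).lo q) p ∧
      HasMixedIntegralDeriv a b (fun z => (G z).hi q) p) :
    HasMixedGHDeriv a b
      (fun z => fuzzyIntegral (volume.restrict (Ioo 0 z.1 ×ˢ Ioo 0 z.2)) G) p (G p) := by
  have hS : FuzzyIntegrable (volume.restrict (Ioo 0 b)) fun η => G (p.1, η) :=
    FuzzyIntegrable.of_rat
      (fun q hq => ⟨(hd q hq).1.integrableOn_section, (hd q hq).2.integrableOn_section⟩) hsec
  have hSt : ∀ t ≤ b, FuzzyIntegrable (volume.restrict (Ioo 0 t)) fun η => G (p.1, η) :=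
    fun t ht => hS.mono_set (Ioo_subset_Ioo_right ht)
  have hGxt : ∀ x ≤ a, ∀ t ≤ b, FuzzyIntegrable (volume.restrict (Ioo 0 x ×ˢ Ioo 0 t)) G :=
    fun x hx t ht => hG.mono_set (Set.prod_mono (Ioo_subset_Ioo_right hx) (Ioo_subset_Ioo_right ht))
  have hunion : ∀ x₁ x₂ : ℝ, 0 < x₁ → x₁ < x₂ → Ioo 0 x₂ = Ioo 0 x₁ ∪ Ico x₁ x₂ := fun x₁ x₂ h1 h2 =>
    (Ioo_union_Ico_eq_Ioo h1 h2.le).symm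
  -- The x-derivative is the integral of the section at `p.1`. In both variables the increments are
  -- integrals over the added strip or interval, hence genuine Hukuhara differences.
  refine ⟨fun t => fuzzyIntegral (volume.restrict (Ioo 0 t)) fun η => G (p.1, η), ?_, ?_⟩
  · filter_upwards [self_mem_nhdsWithin] with t ht
    refine hasGHDerivWithin_of_increments hp.1 (fun x₁ h1 x₂ h2 h12 => ?_)
      (hSt t ht.2).levelContinuous_integral fun q hq => ?_
    · have e : Ioo 0 x₂ ×ˢ Ioo 0 t = (Ioo 0 x₁ ×ˢ Ioo 0 t) ∪ (Ico x₁ x₂ ×ˢ Ioo 0 t) := by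
        rw [hunion x₁ x₂ h1.1 h12, union_prod]
      refine ⟨fuzzyIntegral (volume.restrict (Ico x₁ x₂ ×ˢ Ioo 0 t)) G, ?_⟩
      have h3 := hGxt x₂ h2.2 t ht.2
      simp only [e] at h3 ⊢
      refine h3.integral_union ?_ (measurableSet_Ico.prod measurableSet_Ioo)
      refine Set.disjoint_prod.2 (Or.inl ?_)
      exact Set.disjoint_left.2 fun z hz hz' => absurd hz.2 (not_lt.2 hz'.1)
    · constructor
      · rw [(hSt t ht.2).lo_integral hq]
        exact ((hd q hq).1.deriv_fst t ht).congr_of_mem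
          (fun x hx => (hGxt x hx.2 t ht.2).lo_integral hq) hp.1
      · rw [(hSt t ht.2).hi_integral hq]
        exact ((hd q hq).2.deriv_fst t ht).congr_of_mem
          (fun x hx => (hGxt x hx.2 t ht.2).hi_integral hq) hp.1
  · refine hasGHDerivWithin_of_increments hp.2 (fun t₁ h1 t₂ h2 h12 => ?_) hpc fun q hq => ?_
    · refine ⟨fuzzyIntegral (volume.restrict (Ico t₁ t₂)) fun η => G (p.1, η), ?_⟩
      have h3 := hSt t₂ h2.2
      simp only [hunion t₁ t₂ h1.1 h12] at h3 ⊢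
      refine h3.integral_union ?_ measurableSet_Ico
      exact Set.disjoint_left.2 fun z hz hz' => absurd hz.2 (not_lt.2 hz'.1)
    · exact ⟨(hd q hq).1.deriv_snd.congr_of_mem (fun t ht => (hSt t ht.2).lo_integral hq) hp.2,
        (hd q hq).2.deriv_snd.congr_of_mem (fun t ht => (hSt t ht.2).hi_integral hq) hp.2⟩

end FuzzyNumber

/-! ### The mixed gH-derivative as a density -/

theorem Ioo_prod_subset {a b x y : ℝ} (hx : x ≤ a) (hy : y ≤ b) :
    (Ioo 0 x ×ˢ Ioo 0 y : Set (ℝ × ℝ)) ⊆ Ioo 0 a ×ˢ Ioo 0 b :=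
  Set.prod_mono (Ioo_subset_Ioo_right hx) (Ioo_subset_Ioo_right hy)

theorem neBot_nhdsWithin_Ioc_sdiff {a x : ℝ} (hx : x ∈ Ioc 0 a) :
    (𝓝[Ioc 0 a \ {x}] x).NeBot := by
  have h : (𝓝[Ioo 0 x] x).NeBot := by
    rw [← mem_closure_iff_nhdsWithin_neBot, closure_Ioo hx.1.ne]
    exact ⟨hx.1.le, le_rfl⟩
  exact h.mono (nhdsWithin_mono _ fun z hz => ⟨⟨hz.1, hz.2.le.trans hx.2⟩, hz.2.ne⟩)

theorem HasDerivWithinAt.unique_Ioc {a x c d : ℝ} {f : ℝ → ℝ} (hx : x ∈ Ioc 0 a)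
    (h : HasDerivWithinAt f c (Ioc 0 a) x) (h' : HasDerivWithinAt f d (Ioc 0 a) x) : c = d := by
  have := neBot_nhdsWithin_Ioc_sdiff hx
  exact tendsto_nhds_unique (hasDerivWithinAt_iff_tendsto_slope.1 h)
    (hasDerivWithinAt_iff_tendsto_slope.1 h')

/-- `d` is the mixed derivative `∂/∂y ∂F/∂x` of the real function `F` at `p`. -/
def HasMixedDeriv (a b : ℝ) (F : ℝ × ℝ → ℝ) (p : ℝ × ℝ) (d : ℝ) : Prop :=
  ∃ v : ℝ → ℝ, (∀ᶠ t in 𝓝[Ioc 0 b] p.2,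
    HasDerivWithinAt (fun x => F (x, t)) (v t) (Ioc 0 a) p.1) ∧
    HasDerivWithinAt v d (Ioc 0 b) p.2

/-- `F` is the double integral of `f` plus F(x,0) + F(0,y) - F(0,0), and x ↦ F(x,0) is not known to
be differentiable at `p.1`. Comparing the x-derivatives at heights `t` and `p.2` removes it: `v t -
v p.2` is the integral of the section of `f` between these heights. -/
theorem HasMixedDeriv.eq_density {a b d : ℝ} {F f : ℝ × ℝ → ℝ} {p : ℝ × ℝ}
    (hp : p ∈ Ioc 0 a ×ˢ Ioc 0 b) (hF : HasMixedDeriv a b F p d)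
    (hf : ∀ x ∈ Icc 0 a, ∀ y ∈ Icc 0 b,
      ∫ q in Ioo 0 x ×ˢ Ioo 0 y, f q = mixedIncrement F (0, 0) (x, y))
    (hd : HasMixedIntegralDeriv a b f p) : d = f p := by
  obtain ⟨v, hv, hvd⟩ := hF
  have hy := hv.self_of_nhdsWithin hp.2
  refine HasDerivWithinAt.unique_Ioc hp.2 hvd ?_
  have key : ∀ᶠ t in 𝓝[Ioc 0 b] p.2, v t =
      (v p.2 - ∫ η in Ioo 0 p.2, f (p.1, η)) + ∫ η in Ioo 0 t, f (p.1, η) := by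
    filter_upwards [hv, self_mem_nhdsWithin] with t h1 ht
    have h2 := h1.sub hy
    have h3 := ((hd.deriv_fst t ht).sub (hd.deriv_fst p.2 hp.2)).add_const (F (0, t) - F (0, p.2))
    have h4 := HasDerivWithinAt.unique_Ioc hp.1 h2 (h3.congr_of_mem (fun x hx => ?_) hp.1)
    · linarith
    · simp only [Pi.sub_apply]
      rw [hf x ⟨hx.1.le, hx.2⟩ t ⟨ht.1.le, ht.2⟩, hf x ⟨hx.1.le, hx.2⟩ p.2 ⟨hp.2.1.le, hp.2.2⟩]
      simp only [mixedIncrement]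
      ring
  refine (hd.deriv_snd.const_add (v p.2 - ∫ η in Ioo 0 p.2, f (p.1, η))).congr_of_eventuallyEq
    key ?_
  ring

/-- The difference `v₂ - v₁` has an interior minimum at `y`; this is why `y < b` is required. -/
theorem HasDerivWithinAt.eq_of_le {b y d₁ d₂ : ℝ} {v₁ v₂ : ℝ → ℝ} (hy : y ∈ Ioo 0 b)
    (h₁ : HasDerivWithinAt v₁ d₁ (Ioc 0 b) y) (h₂ : HasDerivWithinAt v₂ d₂ (Ioc 0 b) y)
    (hle : ∀ t, v₁ t ≤ v₂ t) (he : v₁ y = v₂ y) : d₁ = d₂ := by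
  have hnhds : Ioc 0 b ∈ 𝓝 y := Filter.mem_of_superset (isOpen_Ioo.mem_nhds hy) Ioo_subset_Ioc_self
  have h := (h₂.hasDerivAt hnhds).sub (h₁.hasDerivAt hnhds)
  have hmin : IsLocalMin (v₂ - v₁) y := Eventually.of_forall fun t => by
    simp only [Pi.sub_apply, he, sub_self]
    exact sub_nonneg.2 (hle t)
  linarith [hmin.hasDerivAt_eq_zero h]

namespace FuzzyNumber

/-- A nondecreasing diameter means that the slope of the left end never exceeds that of the right
end, which resolves the `min` and `max` in `tendsto_slope`. -/
theorem HasGHDerivWithin.hasDerivWithinAt_of_monotoneOn {f : ℝ → FuzzyNumber} {s : Set ℝ} {x : ℝ}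
    {L : FuzzyNumber} (h : HasGHDerivWithin f s x L) (hx : x ∈ s) {r : ℝ} (hr : r ∈ Icc (0 : ℝ) 1)
    (hm : MonotoneOn (fun z => (f z).diam r) s) :
    HasDerivWithinAt (fun z => (f z).lo r) (L.lo r) s x ∧
      HasDerivWithinAt (fun z => (f z).hi r) (L.hi r) s x := by
  obtain ⟨h1, h2⟩ := h.tendsto_slope hr
  have hle : ∀ᶠ x' in 𝓝[s \ {x}] x,
      slope (fun z => (f z).lo r) x x' ≤ slope (fun z => (f z).hi r) x x' := by
    filter_upwards [self_mem_nhdsWithin] with x' hx'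
    simp only [slope, vsub_eq_sub, smul_eq_mul]
    rcases le_total x x' with h | h
    · have := hm hx hx'.1 h
      simp only [diam] at this
      exact mul_le_mul_of_nonneg_left (by linarith) (inv_nonneg.2 (sub_nonneg.2 h))
    · have := hm hx'.1 hx h
      simp only [diam] at this
      exact mul_le_mul_of_nonpos_left (by linarith) (inv_nonpos.2 (sub_nonpos.2 h))
  exact ⟨hasDerivWithinAt_iff_tendsto_slope.2 (h1.congr' (hle.mono fun x' h => min_eq_left h)),
    hasDerivWithinAt_iff_tendsto_slope.2 (h2.congr' (hle.mono fun x' h => max_eq_right h))⟩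

theorem HasGHDerivWithin.hasDerivWithinAt_of_antitoneOn {f : ℝ → FuzzyNumber} {s : Set ℝ} {x : ℝ}
    {L : FuzzyNumber} (h : HasGHDerivWithin f s x L) (hx : x ∈ s) {r : ℝ} (hr : r ∈ Icc (0 : ℝ) 1)
    (hm : AntitoneOn (fun z => (f z).diam r) s) :
    HasDerivWithinAt (fun z => (f z).hi r) (L.lo r) s x ∧
      HasDerivWithinAt (fun z => (f z).lo r) (L.hi r) s x := by
  obtain ⟨h1, h2⟩ := h.tendsto_slope hr
  have hle : ∀ᶠ x' in 𝓝[s \ {x}] x,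
      slope (fun z => (f z).hi r) x x' ≤ slope (fun z => (f z).lo r) x x' := by
    filter_upwards [self_mem_nhdsWithin] with x' hx'
    simp only [slope, vsub_eq_sub, smul_eq_mul]
    rcases le_total x x' with h | h
    · have := hm hx hx'.1 h
      simp only [diam] at this
      exact mul_le_mul_of_nonneg_left (by linarith) (inv_nonneg.2 (sub_nonneg.2 h))
    · have := hm hx'.1 hx h
      simp only [diam] at this
      exact mul_le_mul_of_nonpos_left (by linarith) (inv_nonpos.2 (sub_nonpos.2 h))
  exact ⟨hasDerivWithinAt_iff_tendsto_slope.2 (h1.congr' (hle.mono fun x' h => min_eq_right h)),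
    hasDerivWithinAt_iff_tendsto_slope.2 (h2.congr' (hle.mono fun x' h => max_eq_left h))⟩

section Identification

variable {a b : ℝ} {U : ℝ × ℝ → FuzzyNumber} {p : ℝ × ℝ}

/-- For a d-monotone function the end points of the gH-partial derivative are the partial
derivatives of the end points, in an order which does not depend on the point. -/
theorem HasGHPartialX.ends {V : ℝ → FuzzyNumber} (h : HasGHPartialX a b U p V)
    (hm : DMonotone a b U) (hp : p.1 ∈ Ioc 0 a) {r : ℝ} (hr : r ∈ Icc (0 : ℝ) 1) :
    (∀ᶠ t in 𝓝[Ioc 0 b] p.2,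
      HasDerivWithinAt (fun x => (U (x, t)).lo r) ((V t).lo r) (Ioc 0 a) p.1 ∧
      HasDerivWithinAt (fun x => (U (x, t)).hi r) ((V t).hi r) (Ioc 0 a) p.1) ∨
    (∀ᶠ t in 𝓝[Ioc 0 b] p.2,
      HasDerivWithinAt (fun x => (U (x, t)).hi r) ((V t).lo r) (Ioc 0 a) p.1 ∧
      HasDerivWithinAt (fun x => (U (x, t)).lo r) ((V t).hi r) (Ioc 0 a) p.1) := by
  rcases hm with hm | hm
  · left
    filter_upwards [h, self_mem_nhdsWithin] with t h1 ht
    exact h1.hasDerivWithinAt_of_monotoneOn hp hr fun x hx y hy hxy =>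
      hm r hr (mk_mem_prod hx ht) (mk_mem_prod hy ht) ⟨hxy, le_rfl⟩
  · right
    filter_upwards [h, self_mem_nhdsWithin] with t h1 ht
    exact h1.hasDerivWithinAt_of_antitoneOn hp hr fun x hx y hy hxy =>
      hm r hr (mk_mem_prod hx ht) (mk_mem_prod hy ht) ⟨hxy, le_rfl⟩

/-- The type is known at `p.2` only, whereas the order of the ends of `V t` near `p.2` comes from
the diameters. If they agree, two swaps or none occur. If they disagree, the ends of `V p.2`
coincide, and as the ends of `V t` are ordered for all `t`, their derivatives coincide as well, so
`L.lo r = L.hi r`. -/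
theorem HasMixedGHDerivSame.hasMixedDeriv {L : FuzzyNumber} (h : HasMixedGHDerivSame a b U p L)
    (hm : DMonotone a b U) (hp : p ∈ Ioo 0 a ×ˢ Ioo 0 b) {r : ℝ} (hr : r ∈ Icc (0 : ℝ) 1) :
    HasMixedDeriv a b (fun z => (U z).lo r) p (L.lo r) ∧
      HasMixedDeriv a b (fun z => (U z).hi r) p (L.hi r) := by
  obtain ⟨V, hV, hT⟩ := h
  have hp1 : p.1 ∈ Ioc 0 a := Ioo_subset_Ioc_self hp.1
  have hp2 : p.2 ∈ Ioc 0 b := Ioo_subset_Ioc_self hp.2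
  have hVle : ∀ t, (V t).lo r ≤ (V t).hi r := fun t => (V t).lo_le_hi hr.2
  rcases hV.ends hm hp1 hr with hE | hE <;> have hEy := hE.self_of_nhdsWithin hp2 <;>
    rcases hT with ⟨⟨-, hU⟩, -, hVd⟩ | ⟨⟨-, hU⟩, -, hVd⟩ <;>
    obtain ⟨hU1, hU2⟩ := hU r hr <;> obtain ⟨hV1, hV2⟩ := hVd r hr
  · exact ⟨⟨_, hE.mono fun t h => h.1, hV1⟩, ⟨_, hE.mono fun t h => h.2, hV2⟩⟩
  · have e := HasDerivWithinAt.unique_Ioc hp1 hU1 hEy.2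
    have := HasDerivWithinAt.eq_of_le hp.2 hV2 hV1 hVle e
    exact ⟨⟨_, hE.mono fun t h => h.1, this ▸ hV2⟩, ⟨_, hE.mono fun t h => h.2, this ▸ hV1⟩⟩
  · have e := HasDerivWithinAt.unique_Ioc hp1 hU1 hEy.2
    have := HasDerivWithinAt.eq_of_le hp.2 hV1 hV2 hVle e
    exact ⟨⟨_, hE.mono fun t h => h.2, this ▸ hV2⟩, ⟨_, hE.mono fun t h => h.1, this ▸ hV1⟩⟩
  · exact ⟨⟨_, hE.mono fun t h => h.2, hV1⟩, ⟨_, hE.mono fun t h => h.1, hV2⟩⟩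

theorem HasMixedGHDerivDiff.hasMixedDeriv {L : FuzzyNumber} (h : HasMixedGHDerivDiff a b U p L)
    (hm : DMonotone a b U) (hp : p ∈ Ioo 0 a ×ˢ Ioo 0 b) {r : ℝ} (hr : r ∈ Icc (0 : ℝ) 1) :
    HasMixedDeriv a b (fun z => (U z).lo r) p (L.hi r) ∧
      HasMixedDeriv a b (fun z => (U z).hi r) p (L.lo r) := by
  obtain ⟨V, hV, hT⟩ := h
  have hp1 : p.1 ∈ Ioc 0 a := Ioo_subset_Ioc_self hp.1
  have hp2 : p.2 ∈ Ioc 0 b := Ioo_subset_Ioc_self hp.2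
  have hVle : ∀ t, (V t).lo r ≤ (V t).hi r := fun t => (V t).lo_le_hi hr.2
  rcases hV.ends hm hp1 hr with hE | hE <;> have hEy := hE.self_of_nhdsWithin hp2 <;>
    rcases hT with ⟨⟨-, hU⟩, -, hVd⟩ | ⟨⟨-, hU⟩, -, hVd⟩ <;>
    obtain ⟨hU1, hU2⟩ := hU r hr <;> obtain ⟨hV1, hV2⟩ := hVd r hr
  · exact ⟨⟨_, hE.mono fun t h => h.1, hV2⟩, ⟨_, hE.mono fun t h => h.2, hV1⟩⟩
  · have e := HasDerivWithinAt.unique_Ioc hp1 hU1 hEy.2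
    have := HasDerivWithinAt.eq_of_le hp.2 hV1 hV2 hVle e
    exact ⟨⟨_, hE.mono fun t h => h.1, this ▸ hV1⟩, ⟨_, hE.mono fun t h => h.2, this ▸ hV2⟩⟩
  · have e := HasDerivWithinAt.unique_Ioc hp1 hU1 hEy.2
    have := HasDerivWithinAt.eq_of_le hp.2 hV2 hV1 hVle e
    exact ⟨⟨_, hE.mono fun t h => h.2, this ▸ hV1⟩, ⟨_, hE.mono fun t h => h.1, this ▸ hV2⟩⟩
  · exact ⟨⟨_, hE.mono fun t h => h.2, hV2⟩, ⟨_, hE.mono fun t h => h.1, hV1⟩⟩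

theorem HasMixedGHDerivSame.hasMixedGHDeriv {L : FuzzyNumber}
    (h : HasMixedGHDerivSame a b U p L) : HasMixedGHDeriv a b U p L := by
  obtain ⟨V, hV, h | h⟩ := h
  · exact ⟨V, hV, h.2.1⟩
  · exact ⟨V, hV, h.2.1⟩

theorem HasMixedGHDerivDiff.hasMixedGHDeriv {L : FuzzyNumber}
    (h : HasMixedGHDerivDiff a b U p L) : HasMixedGHDeriv a b U p L := by
  obtain ⟨V, hV, h | h⟩ := h
  · exact ⟨V, hV, h.2.1⟩
  · exact ⟨V, hV, h.2.1⟩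

/-- Ê is closed under gH-differences and limits, hence under both successive derivatives. -/
theorem HasMixedGHDeriv.levelContinuous {L : FuzzyNumber} (h : HasMixedGHDeriv a b U p L)
    (hU : ∀ q ∈ rect a b, (U q).LevelContinuous) (hp : p ∈ rect a b) : L.LevelContinuous := by
  obtain ⟨V, hV, hL⟩ := h
  have := neBot_nhdsWithin_Ioc_sdiff hp.1
  have := neBot_nhdsWithin_Ioc_sdiff hp.2
  have hVc : ∀ᶠ t in 𝓝[Ioc 0 b] p.2, (V t).LevelContinuous := by
    filter_upwards [hV, self_mem_nhdsWithin] with t h1 ht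
    refine h1.levelContinuous ?_ (hU _ (mk_mem_prod hp.1 ht))
    filter_upwards [self_mem_nhdsWithin] with x hx using hU _ (mk_mem_prod hx ht)
  exact hL.levelContinuous hVc (hVc.self_of_nhdsWithin hp.2)

theorem AbsCont.mixedAbsCont (h : AbsCont a b U) {r : ℝ} (hr : r ∈ Icc (0 : ℝ) 1) :
    MixedAbsCont a b (fun z => (U z).lo r) ∧ MixedAbsCont a b (fun z => (U z).hi r) := by
  constructor <;> intro ε hε <;> obtain ⟨δ, hδ, hd⟩ := h.1 ε hε <;>
    refine ⟨δ, hδ, fun n p q h1 h2 h3 => ?_⟩ <;>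
    refine lt_of_le_of_lt (Finset.sum_le_sum fun i _ => ?_) (hd n p q h1 h2 h3)
  · have := abs_lo_sub_le (U (q i) + U (p i)) (U ((p i).1, (q i).2) + U ((q i).1, (p i).2)) hr
    rw [lo_add _ _ hr.2, lo_add _ _ hr.2, ← sub_sub] at this
    exact this
  · have := abs_hi_sub_le (U (q i) + U (p i)) (U ((p i).1, (q i).2) + U ((q i).1, (p i).2)) hr
    rw [hi_add _ _ hr.2, hi_add _ _ hr.2, ← sub_sub] at this
    exact this

/-- An absolutely continuous real function is recovered from its mixed derivative. -/
theorem _root_.MixedAbsCont.integral_mixedDeriv {F d : ℝ × ℝ → ℝ} (ha : 0 < a) (hb : 0 < b)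
    (hF : MixedAbsCont a b F)
    (hd : ∀ᵐ p ∂(volume.restrict (Ioo 0 a ×ˢ Ioo 0 b)), HasMixedDeriv a b F p (d p)) :
    IntegrableOn d (Ioo 0 a ×ˢ Ioo 0 b) ∧ ∀ x ∈ Icc 0 a, ∀ y ∈ Icc 0 b,
      ∫ p in Ioo 0 x ×ˢ Ioo 0 y, d p = mixedIncrement F (0, 0) (x, y) := by
  obtain ⟨f, hf, hfi⟩ := hF.exists_density ha hb
  -- Measurability of `d` is not assumed; it follows from this identity.
  have hae : f =ᵐ[volume.restrict (Ioo 0 a ×ˢ Ioo 0 b)] d := by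
    have h1 := ae_hasMixedIntegralDeriv hf
    rw [← Measure.restrict_congr_set (Ioo_prod_ae_eq_Ioc a b)] at h1
    filter_upwards [hd, h1, ae_restrict_mem (measurableSet_Ioo.prod measurableSet_Ioo)]
      with p h2 h3 hp
    exact (h2.eq_density ⟨Ioo_subset_Ioc_self hp.1, Ioo_subset_Ioc_self hp.2⟩ hfi h3).symm
  refine ⟨hf.congr hae, fun x hx y hy => ?_⟩
  rw [← hfi x hx y hy]
  exact integral_congr_ae (EventuallyEq.symm
    (ae_restrict_of_ae_restrict_of_subset (Ioo_prod_subset hx.2 hy.2) hae))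

/-- The mixed gH-derivative of an absolutely continuous d-monotone function is integrable, and its
double integral is the mixed gH-increment. -/
theorem AbsCont.isGHDiff_integral {D : ℝ × ℝ → FuzzyNumber} (ha : 0 < a) (hb : 0 < b)
    (hU : ∀ p ∈ Icc (0 : ℝ) a ×ˢ Icc (0 : ℝ) b, (U p).LevelContinuous)
    (hac : AbsCont a b U) (hm : DMonotone a b U)
    (hD : (∀ᵐ p ∂(volume.restrict (rect a b)), HasMixedGHDerivSame a b U p (D p)) ∨
      (∀ᵐ p ∂(volume.restrict (rect a b)), HasMixedGHDerivDiff a b U p (D p))) :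
    FuzzyIntegrable (volume.restrict (Ioo 0 a ×ˢ Ioo 0 b)) D ∧ ∀ q ∈ rect a b,
      IsGHDiff (U q + U (0, 0)) (U (q.1, 0) + U (0, q.2))
        (fuzzyIntegral (volume.restrict (Ioo 0 q.1 ×ˢ Ioo 0 q.2)) D) := by
  have hUr : ∀ q ∈ rect a b, (U q).LevelContinuous := fun q hq =>
    hU q ⟨Ioc_subset_Icc_self hq.1, Ioc_subset_Icc_self hq.2⟩
  have hR : MeasurableSet (Ioo 0 a ×ˢ Ioo 0 b : Set (ℝ × ℝ)) :=
    measurableSet_Ioo.prod measurableSet_Ioo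
  have hsub : (Ioo 0 a ×ˢ Ioo 0 b : Set (ℝ × ℝ)) ⊆ rect a b :=
    Set.prod_mono Ioo_subset_Ioc_self Ioo_subset_Ioc_self
  have e := neg_one_lt_zero (R := ℝ)
  rcases hD with hD | hD <;>
    replace hD := (ae_restrict_of_ae_restrict_of_subset hsub hD).and (ae_restrict_mem hR)
  · have hlo := fun r (hr : r ∈ Icc (0 : ℝ) 1) =>
      (hac.mixedAbsCont hr).1.integral_mixedDeriv ha hb (hD.mono fun p h => (h.1.hasMixedDeriv hm h.2 hr).1)
    have hhi := fun r (hr : r ∈ Icc (0 : ℝ) 1) =>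
      (hac.mixedAbsCont hr).2.integral_mixedDeriv ha hb (hD.mono fun p h => (h.1.hasMixedDeriv hm h.2 hr).2)
    have hDi : FuzzyIntegrable (volume.restrict (Ioo 0 a ×ˢ Ioo 0 b)) D :=
      ⟨fun r hr => (hlo r hr).1, fun r hr => (hhi r hr).1,
        hD.mono fun p h => h.1.hasMixedGHDeriv.levelContinuous hUr (hsub h.2)⟩
    -- Same types: the mixed derivative keeps the order of the end points, which is the first form
    -- of the gH-difference.
    refine ⟨hDi, fun q hq => Or.inl (eq_of_ends fun r hr => ?_)⟩
    have hDq := hDi.mono_set (Ioo_prod_subset hq.1.2 hq.2.2)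
    simp only [lo_add _ _ hr.2, hi_add _ _ hr.2, hDq.lo_integral hr, hDq.hi_integral hr,
      (hlo r hr).2 q.1 (Ioc_subset_Icc_self hq.1) q.2 (Ioc_subset_Icc_self hq.2),
      (hhi r hr).2 q.1 (Ioc_subset_Icc_self hq.1) q.2 (Ioc_subset_Icc_self hq.2), mixedIncrement]
    constructor <;> ring
  · have hlo := fun r (hr : r ∈ Icc (0 : ℝ) 1) =>
      (hac.mixedAbsCont hr).2.integral_mixedDeriv ha hb (hD.mono fun p h => (h.1.hasMixedDeriv hm h.2 hr).2)
    have hhi := fun r (hr : r ∈ Icc (0 : ℝ) 1) =>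
      (hac.mixedAbsCont hr).1.integral_mixedDeriv ha hb (hD.mono fun p h => (h.1.hasMixedDeriv hm h.2 hr).1)
    have hDi : FuzzyIntegrable (volume.restrict (Ioo 0 a ×ˢ Ioo 0 b)) D :=
      ⟨fun r hr => (hlo r hr).1, fun r hr => (hhi r hr).1,
        hD.mono fun p h => h.1.hasMixedGHDeriv.levelContinuous hUr (hsub h.2)⟩
    -- Different types: the end points are swapped, which is the second form.
    refine ⟨hDi, fun q hq => Or.inr (eq_of_ends fun r hr => ?_)⟩
    have hDq := hDi.mono_set (Ioo_prod_subset hq.1.2 hq.2.2)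
    simp only [lo_add _ _ hr.2, hi_add _ _ hr.2, hDq.lo_integral hr, hDq.hi_integral hr,
      lo_smul_of_neg _ e, hi_smul_of_neg _ e,
      (hlo r hr).2 q.1 (Ioc_subset_Icc_self hq.1) q.2 (Ioc_subset_Icc_self hq.2),
      (hhi r hr).2 q.1 (Ioc_subset_Icc_self hq.1) q.2 (Ioc_subset_Icc_self hq.2), mixedIncrement]
    constructor <;> ring

end Identification

end FuzzyNumber

/-! ### Fubini's theorem for the Katugampola kernels -/

/-- A nonnegative kernel `k σ s`, `0 < s < σ < x`, whose integral in `σ` is the bounded function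
`H s`. -/
structure IsBoundedKernel (x : ℝ) (k : ℝ → ℝ → ℝ) (H : ℝ → ℝ) (C : ℝ) : Prop where
  measurable : Measurable (Function.uncurry k)
  nonneg : ∀ s ∈ Ioo 0 x, ∀ σ ∈ Ioo s x, 0 ≤ k σ s
  integrable : ∀ s ∈ Ioo 0 x, IntegrableOn (fun σ => k σ s) (Ioo s x)
  integral : ∀ s ∈ Ioo 0 x, ∫ σ in Ioo s x, k σ s = H s
  le : ∀ s ∈ Ioo 0 x, H s ≤ C

/-- The indicator moves the constraint s < σ from the domain into the kernel, so that Fubini can be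
applied on a fixed product. -/
theorem IsBoundedKernel.truncated {x C : ℝ} {k : ℝ → ℝ → ℝ} {H : ℝ → ℝ}
    (h : IsBoundedKernel x k H C) {s : ℝ} (hs : s ∈ Ioo 0 x) :
    Integrable (fun σ => (Iio σ).indicator (k σ) s) (volume.restrict (Ioo 0 x)) ∧
      (∀ᵐ σ ∂(volume.restrict (Ioo 0 x)), 0 ≤ (Iio σ).indicator (k σ) s) ∧
      ∫ σ in Ioo 0 x, (Iio σ).indicator (k σ) s = H s := by
  have e : (fun σ => (Iio σ).indicator (k σ) s) = (Ioi s).indicator fun σ => k σ s := by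
    funext σ
    by_cases hσ : s < σ <;> simp [indicator, hσ]
  have e2 : Ioo 0 x ∩ Ioi s = Ioo s x := by
    ext σ
    simp only [mem_inter_iff, mem_Ioo, mem_Ioi]
    exact ⟨fun h => ⟨h.2, h.1.2⟩, fun h => ⟨⟨hs.1.trans h.1, h.2⟩, h.1⟩⟩
  refine ⟨?_, ?_, ?_⟩
  · rw [e, integrable_indicator_iff measurableSet_Ioi, IntegrableOn,
      Measure.restrict_restrict measurableSet_Ioi, inter_comm, e2]
    exact h.integrable s hs
  · filter_upwards [ae_restrict_mem measurableSet_Ioo] with σ hσ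
    by_cases hσs : s < σ
    · simpa [indicator, hσs] using h.nonneg s hs σ ⟨hσs, hσ.2⟩
    · simp [indicator, hσs]
  · rw [e, setIntegral_indicator measurableSet_Ioi, e2, h.integral s hs]

theorem measurable_truncated {k : ℝ → ℝ → ℝ} (hk : Measurable (Function.uncurry k)) :
    Measurable fun z : ℝ × ℝ => (Iio z.1).indicator (k z.1) z.2 := by
  have : (fun z : ℝ × ℝ => (Iio z.1).indicator (k z.1) z.2) =
      {z : ℝ × ℝ | z.2 < z.1}.indicator (Function.uncurry k) := by
    funext z
    by_cases hz : z.2 < z.1 <;> simp [indicator, hz, Function.uncurry]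
  rw [this]
  exact hk.indicator (measurableSet_lt measurable_snd measurable_fst)

section KernelFubini

variable {x y C₁ C₂ : ℝ} {k₁ k₂ : ℝ → ℝ → ℝ} {H₁ H₂ : ℝ → ℝ} {f : ℝ × ℝ → ℝ}

/-- Fubini's theorem for a product of two truncated kernels. -/
theorem IsBoundedKernel.integrable_prod (h₁ : IsBoundedKernel x k₁ H₁ C₁)
    (h₂ : IsBoundedKernel y k₂ H₂ C₂) (hf : IntegrableOn f (Ioo 0 x ×ˢ Ioo 0 y)) :
    Integrable (fun Z : (ℝ × ℝ) × (ℝ × ℝ) => (Iio Z.1.1).indicator (k₁ Z.1.1) Z.2.1 *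
        (Iio Z.1.2).indicator (k₂ Z.1.2) Z.2.2 * f Z.2)
      ((volume.restrict (Ioo 0 x ×ˢ Ioo 0 y)).prod (volume.restrict (Ioo 0 x ×ˢ Ioo 0 y))) ∧
    ∫ z in Ioo 0 x ×ˢ Ioo 0 y, ∫ w in Ioo 0 x ×ˢ Ioo 0 y,
        (Iio z.1).indicator (k₁ z.1) w.1 * (Iio z.2).indicator (k₂ z.2) w.2 * f w =
      ∫ w in Ioo 0 x ×ˢ Ioo 0 y, H₁ w.1 * H₂ w.2 * f w := by
  have hR : MeasurableSet (Ioo 0 x ×ˢ Ioo 0 y : Set (ℝ × ℝ)) :=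
    measurableSet_Ioo.prod measurableSet_Ioo
  have hprod : volume.restrict (Ioo 0 x ×ˢ Ioo 0 y : Set (ℝ × ℝ)) =
      (volume.restrict (Ioo 0 x)).prod (volume.restrict (Ioo 0 y)) := by
    rw [Measure.volume_eq_prod, Measure.prod_restrict]
  have hmeas : AEStronglyMeasurable (fun Z : (ℝ × ℝ) × (ℝ × ℝ) =>
      (Iio Z.1.1).indicator (k₁ Z.1.1) Z.2.1 * (Iio Z.1.2).indicator (k₂ Z.1.2) Z.2.2 * f Z.2)
      ((volume.restrict (Ioo 0 x ×ˢ Ioo 0 y)).prod (volume.restrict (Ioo 0 x ×ˢ Ioo 0 y))) := by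
    have m1 : Measurable fun Z : (ℝ × ℝ) × (ℝ × ℝ) => (Iio Z.1.1).indicator (k₁ Z.1.1) Z.2.1 :=
      (measurable_truncated h₁.measurable).comp
        (by fun_prop : Measurable fun Z : (ℝ × ℝ) × (ℝ × ℝ) => (Z.1.1, Z.2.1))
    have m2 : Measurable fun Z : (ℝ × ℝ) × (ℝ × ℝ) => (Iio Z.1.2).indicator (k₂ Z.1.2) Z.2.2 :=
      (measurable_truncated h₂.measurable).comp
        (by fun_prop : Measurable fun Z : (ℝ × ℝ) × (ℝ × ℝ) => (Z.1.2, Z.2.2))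
    exact (m1.mul m2).aestronglyMeasurable.mul hf.1.comp_snd
  have hin : ∀ w ∈ Ioo 0 x ×ˢ Ioo 0 y,
      Integrable (fun z : ℝ × ℝ => (Iio z.1).indicator (k₁ z.1) w.1 *
        (Iio z.2).indicator (k₂ z.2) w.2) (volume.restrict (Ioo 0 x ×ˢ Ioo 0 y)) ∧
      (∀ᵐ z ∂(volume.restrict (Ioo 0 x ×ˢ Ioo 0 y)), 0 ≤ (Iio z.1).indicator (k₁ z.1) w.1 *
        (Iio z.2).indicator (k₂ z.2) w.2) ∧
      ∫ z in Ioo 0 x ×ˢ Ioo 0 y, (Iio z.1).indicator (k₁ z.1) w.1 *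
        (Iio z.2).indicator (k₂ z.2) w.2 = H₁ w.1 * H₂ w.2 := by
    intro w hw
    obtain ⟨a1, a2, a3⟩ := h₁.truncated hw.1
    obtain ⟨b1, b2, b3⟩ := h₂.truncated hw.2
    rw [hprod]
    refine ⟨a1.mul_prod b1, ?_, ?_⟩
    · filter_upwards [Measure.quasiMeasurePreserving_fst.ae a2,
        Measure.quasiMeasurePreserving_snd.ae b2] with z c1 c2 using mul_nonneg c1 c2
    · rw [← a3, ← b3]
      exact integral_prod_mul (fun σ => (Iio σ).indicator (k₁ σ) w.1)
        fun τ => (Iio τ).indicator (k₂ τ) w.2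
  have hnorm : ∀ w ∈ Ioo 0 x ×ˢ Ioo 0 y, ∫ z in Ioo 0 x ×ˢ Ioo 0 y,
      ‖(Iio z.1).indicator (k₁ z.1) w.1 * (Iio z.2).indicator (k₂ z.2) w.2 * f w‖ =
        H₁ w.1 * H₂ w.2 * |f w| := by
    intro w hw
    obtain ⟨-, a2, a3⟩ := hin w hw
    rw [← a3, ← integral_mul_const]
    refine integral_congr_ae (a2.mono fun z hz => ?_)
    simp only [norm_mul _ (f w), Real.norm_eq_abs, abs_of_nonneg hz]
  have hint : Integrable (fun Z : (ℝ × ℝ) × (ℝ × ℝ) =>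
      (Iio Z.1.1).indicator (k₁ Z.1.1) Z.2.1 * (Iio Z.1.2).indicator (k₂ Z.1.2) Z.2.2 * f Z.2)
      ((volume.restrict (Ioo 0 x ×ˢ Ioo 0 y)).prod (volume.restrict (Ioo 0 x ×ˢ Ioo 0 y))) := by
    -- Integrating the absolute value first in the outer variables leaves `H₁ H₂ |f|`, at most `C₁
    -- C₂ |f|`, even though the kernels themselves may be unbounded.
    refine (integrable_prod_iff' hmeas).2 ⟨?_, ?_⟩
    · filter_upwards [ae_restrict_mem hR] with w hw
      exact (hin w hw).1.mul_const _
    · refine Integrable.mono' (hf.abs.const_mul (C₁ * C₂))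
        hmeas.norm.prod_swap.integral_prod_right' ?_
      filter_upwards [ae_restrict_mem hR] with w hw
      rw [hnorm w hw]
      have p1 : 0 ≤ H₁ w.1 := by
        rw [← (h₁.truncated hw.1).2.2]
        exact integral_nonneg_of_ae (h₁.truncated hw.1).2.1
      have p2 : 0 ≤ H₂ w.2 := by
        rw [← (h₂.truncated hw.2).2.2]
        exact integral_nonneg_of_ae (h₂.truncated hw.2).2.1
      rw [Real.norm_eq_abs, abs_of_nonneg (by positivity)]
      have q1 := h₁.le w.1 hw.1
      have q2 := h₂.le w.2 hw.2
      have : 0 ≤ C₁ := p1.trans q1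
      gcongr
  refine ⟨hint, ?_⟩
  rw [integral_integral_swap hint]
  refine setIntegral_congr_fun hR fun w hw => ?_
  simp only [integral_mul_const, (hin w hw).2.2]

theorem indicator_mul_indicator (z w : ℝ × ℝ) :
    (Iio z.1).indicator (k₁ z.1) w.1 * (Iio z.2).indicator (k₂ z.2) w.2 * f w =
      (Iio z.1 ×ˢ Iio z.2).indicator (fun w => k₁ z.1 w.1 * k₂ z.2 w.2 * f w) w := by
  by_cases h1 : w.1 < z.1 <;> by_cases h2 : w.2 < z.2 <;> simp [indicator, mem_prod, h1, h2]

theorem Ioo_prod_inter_Iio {z : ℝ × ℝ} (hz : z ∈ Ioo 0 x ×ˢ Ioo 0 y) :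
    (Ioo 0 x ×ˢ Ioo 0 y ∩ Iio z.1 ×ˢ Iio z.2 : Set (ℝ × ℝ)) = Ioo 0 z.1 ×ˢ Ioo 0 z.2 := by
  rw [prod_inter_prod, Ioo_inter_Iio, Ioo_inter_Iio, min_eq_right hz.1.2.le, min_eq_right hz.2.2.le]

theorem IsBoundedKernel.fubini (h₁ : IsBoundedKernel x k₁ H₁ C₁)
    (h₂ : IsBoundedKernel y k₂ H₂ C₂) (hf : IntegrableOn f (Ioo 0 x ×ˢ Ioo 0 y)) :
    (∀ᵐ z ∂(volume.restrict (Ioo 0 x ×ˢ Ioo 0 y)),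
      IntegrableOn (fun w => k₁ z.1 w.1 * k₂ z.2 w.2 * f w) (Ioo 0 z.1 ×ˢ Ioo 0 z.2)) ∧
    IntegrableOn (fun z => ∫ w in Ioo 0 z.1 ×ˢ Ioo 0 z.2, k₁ z.1 w.1 * k₂ z.2 w.2 * f w)
      (Ioo 0 x ×ˢ Ioo 0 y) ∧
    ∫ z in Ioo 0 x ×ˢ Ioo 0 y, ∫ w in Ioo 0 z.1 ×ˢ Ioo 0 z.2, k₁ z.1 w.1 * k₂ z.2 w.2 * f w =
      ∫ w in Ioo 0 x ×ˢ Ioo 0 y, H₁ w.1 * H₂ w.2 * f w := by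
  have hR : MeasurableSet (Ioo 0 x ×ˢ Ioo 0 y : Set (ℝ × ℝ)) :=
    measurableSet_Ioo.prod measurableSet_Ioo
  have hI : ∀ z : ℝ × ℝ, MeasurableSet (Iio z.1 ×ˢ Iio z.2 : Set (ℝ × ℝ)) := fun z =>
    measurableSet_Iio.prod measurableSet_Iio
  obtain ⟨hint, hval⟩ := h₁.integrable_prod h₂ hf
  have hinner : ∀ z ∈ Ioo 0 x ×ˢ Ioo 0 y, ∫ w in Ioo 0 x ×ˢ Ioo 0 y,
      (Iio z.1).indicator (k₁ z.1) w.1 * (Iio z.2).indicator (k₂ z.2) w.2 * f w =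
      ∫ w in Ioo 0 z.1 ×ˢ Ioo 0 z.2, k₁ z.1 w.1 * k₂ z.2 w.2 * f w := by
    intro z hz
    simp only [indicator_mul_indicator]
    rw [setIntegral_indicator (hI z), Ioo_prod_inter_Iio hz]
  refine ⟨?_, ?_, ?_⟩
  · filter_upwards [hint.prod_right_ae, ae_restrict_mem hR] with z h1 hz
    simp only [indicator_mul_indicator] at h1
    rw [integrable_indicator_iff (hI z), IntegrableOn, Measure.restrict_restrict (hI z),
      inter_comm, Ioo_prod_inter_Iio hz] at h1
    exact h1
  · exact IntegrableOn.congr_fun hint.integral_prod_left hinner hR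
  · rw [← hval]
    exact (setIntegral_congr_fun hR hinner).symm

end KernelFubini

/-- The Katugampola kernels are singular at one end. A nonnegative derivative of a function
continuous up to the ends is automatically integrable, so no separate estimate is needed. -/
theorem integral_Ioo_of_hasDerivAt_nonneg {s x : ℝ} (hsx : s ≤ x) {P k : ℝ → ℝ}
    (hc : ContinuousOn P (Icc s x)) (hd : ∀ σ ∈ Ioo s x, HasDerivAt P (k σ) σ)
    (hk : ∀ σ ∈ Ioo s x, 0 ≤ k σ) :
    IntegrableOn k (Ioo s x) ∧ ∫ σ in Ioo s x, k σ = P x - P s := by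
  have hi := intervalIntegral.integrableOn_deriv_of_nonneg hc hd hk
  refine ⟨hi.mono_set Ioo_subset_Ioc_self, ?_⟩
  rw [← integral_Ioc_eq_integral_Ioo, ← intervalIntegral.integral_of_le hsx]
  exact intervalIntegral.integral_eq_sub_of_hasDerivAt_of_le hsx hc hd
    ((intervalIntegrable_iff_integrableOn_Ioc_of_le hsx).2 hi)

/-- The primitive common to the two Katugampola kernels. -/
noncomputable def katugampolaPrimitive (ρ φ x s : ℝ) : ℝ :=
  (x ^ ρ - s ^ ρ) ^ (1 - φ) / (ρ * (1 - φ))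

section Kernels

variable {ρ φ x : ℝ}

theorem continuous_katugampolaPrimitive (hρ : 0 < ρ) (hφ : φ ∈ Ioo (0 : ℝ) 1) :
    Continuous fun z : ℝ × ℝ => katugampolaPrimitive ρ φ z.1 z.2 := by
  unfold katugampolaPrimitive
  have h1 : 0 ≤ 1 - φ := by linarith [hφ.2]
  exact (((continuous_fst.rpow_const fun _ => Or.inr hρ.le).sub
    (continuous_snd.rpow_const fun _ => Or.inr hρ.le)).rpow_const fun _ => Or.inr h1).div_const _

theorem katugampolaPrimitive_self (hφ : φ ∈ Ioo (0 : ℝ) 1) (ρ x : ℝ) : katugampolaPrimitive ρ φ x x = 0 := by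
  have h1 : 1 - φ ≠ 0 := by linarith [hφ.2]
  simp [katugampolaPrimitive, Real.zero_rpow h1]

theorem katugampolaPrimitive_le (hρ : 0 < ρ) (hφ : φ ∈ Ioo (0 : ℝ) 1) {s : ℝ} (hs : s ∈ Ioo 0 x) :
    katugampolaPrimitive ρ φ x s ≤ (x ^ ρ) ^ (1 - φ) / (ρ * (1 - φ)) := by
  have h1 : 0 < 1 - φ := by linarith [hφ.2]
  have h2 : s ^ ρ ≤ x ^ ρ := Real.rpow_le_rpow hs.1.le hs.2.le hρ.le
  have h3 : 0 ≤ s ^ ρ := Real.rpow_nonneg hs.1.le _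
  unfold katugampolaPrimitive
  gcongr
  linarith

/-- An antiderivative in σ is minus `katugampolaPrimitive ρ φ x σ`; it vanishes at the singular end
σ = x. -/
theorem isBoundedKernel_left (hρ : 0 < ρ) (hφ : φ ∈ Ioo (0 : ℝ) 1) : IsBoundedKernel x
    (fun σ _ => σ ^ (ρ - 1) / (x ^ ρ - σ ^ ρ) ^ φ) (katugampolaPrimitive ρ φ x)
    ((x ^ ρ) ^ (1 - φ) / (ρ * (1 - φ))) := by
  have h1 : 0 < 1 - φ := by linarith [hφ.2]
  have hnn : ∀ s ∈ Ioo 0 x, ∀ σ ∈ Ioo s x, 0 ≤ σ ^ (ρ - 1) / (x ^ ρ - σ ^ ρ) ^ φ := by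
    intro s hs σ hσ
    have := sub_nonneg.2 (Real.rpow_le_rpow (hs.1.trans hσ.1).le hσ.2.le hρ.le)
    have := (hs.1.trans hσ.1).le
    positivity
  have key : ∀ s ∈ Ioo 0 x, IntegrableOn (fun σ => σ ^ (ρ - 1) / (x ^ ρ - σ ^ ρ) ^ φ) (Ioo s x) ∧
      ∫ σ in Ioo s x, σ ^ (ρ - 1) / (x ^ ρ - σ ^ ρ) ^ φ = katugampolaPrimitive ρ φ x s := by
    intro s hs
    have h2 := integral_Ioo_of_hasDerivAt_nonneg (P := fun σ => -katugampolaPrimitive ρ φ x σ)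
      (k := fun σ => σ ^ (ρ - 1) / (x ^ ρ - σ ^ ρ) ^ φ) hs.2.le ?_ ?_ (hnn s hs)
    · refine ⟨h2.1, h2.2.trans ?_⟩
      rw [katugampolaPrimitive_self hφ]
      ring
    · exact ((continuous_katugampolaPrimitive hρ hφ).comp
        (by fun_prop : Continuous fun σ : ℝ => (x, σ))).neg.continuousOn
    · intro σ hσ
      have hσ0 := hs.1.trans hσ.1
      have hpos : 0 < x ^ ρ - σ ^ ρ := sub_pos.2 (Real.rpow_lt_rpow hσ0.le hσ.2 hρ)
      have hd := ((((Real.hasDerivAt_rpow_const (p := ρ) (Or.inl hσ0.ne')).const_sub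
        (x ^ ρ)).rpow_const (p := 1 - φ) (Or.inl hpos.ne')).div_const (ρ * (1 - φ))).neg
      refine hd.congr_deriv ?_
      rw [show 1 - φ - 1 = -φ by ring, Real.rpow_neg hpos.le]
      field_simp
  refine ⟨?_, hnn, fun s hs => (key s hs).1, fun s hs => (key s hs).2,
    fun s hs => katugampolaPrimitive_le hρ hφ hs⟩
  change Measurable fun z : ℝ × ℝ => z.1 ^ (ρ - 1) / (x ^ ρ - z.1 ^ ρ) ^ φ
  fun_prop

/-- An antiderivative in σ is `katugampolaPrimitive ρ φ σ s`, vanishing at σ = s. The total mass is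
the same as for the left kernel, and this coincidence is the source of the Caputo formula. -/
theorem isBoundedKernel_right (hρ : 0 < ρ) (hφ : φ ∈ Ioo (0 : ℝ) 1) : IsBoundedKernel x
    (fun σ s => σ ^ (ρ - 1) / (σ ^ ρ - s ^ ρ) ^ φ) (katugampolaPrimitive ρ φ x)
    ((x ^ ρ) ^ (1 - φ) / (ρ * (1 - φ))) := by
  have h1 : 0 < 1 - φ := by linarith [hφ.2]
  have hnn : ∀ s ∈ Ioo 0 x, ∀ σ ∈ Ioo s x, 0 ≤ σ ^ (ρ - 1) / (σ ^ ρ - s ^ ρ) ^ φ := by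
    intro s hs σ hσ
    have := sub_nonneg.2 (Real.rpow_le_rpow hs.1.le hσ.1.le hρ.le)
    have := (hs.1.trans hσ.1).le
    positivity
  have key : ∀ s ∈ Ioo 0 x, IntegrableOn (fun σ => σ ^ (ρ - 1) / (σ ^ ρ - s ^ ρ) ^ φ) (Ioo s x) ∧
      ∫ σ in Ioo s x, σ ^ (ρ - 1) / (σ ^ ρ - s ^ ρ) ^ φ = katugampolaPrimitive ρ φ x s := by
    intro s hs
    have h2 := integral_Ioo_of_hasDerivAt_nonneg (P := fun σ => katugampolaPrimitive ρ φ σ s)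
      (k := fun σ => σ ^ (ρ - 1) / (σ ^ ρ - s ^ ρ) ^ φ) hs.2.le ?_ ?_ (hnn s hs)
    · refine ⟨h2.1, h2.2.trans ?_⟩
      rw [katugampolaPrimitive_self hφ, sub_zero]
    · exact ((continuous_katugampolaPrimitive hρ hφ).comp
        (by fun_prop : Continuous fun σ : ℝ => (σ, s))).continuousOn
    · intro σ hσ
      have hσ0 := hs.1.trans hσ.1
      have hpos : 0 < σ ^ ρ - s ^ ρ := sub_pos.2 (Real.rpow_lt_rpow hs.1.le hσ.1 hρ)
      have hd := (((Real.hasDerivAt_rpow_const (p := ρ) (Or.inl hσ0.ne')).sub_const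
        (s ^ ρ)).rpow_const (p := 1 - φ) (Or.inl hpos.ne')).div_const (ρ * (1 - φ))
      refine hd.congr_deriv ?_
      rw [show 1 - φ - 1 = -φ by ring, Real.rpow_neg hpos.le]
      field_simp
  refine ⟨?_, hnn, fun s hs => (key s hs).1, fun s hs => (key s hs).2,
    fun s hs => katugampolaPrimitive_le hρ hφ hs⟩
  change Measurable fun z : ℝ × ℝ => z.1 ^ (ρ - 1) / (z.1 ^ ρ - z.2 ^ ρ) ^ φ
  fun_prop

end Kernels

/-! ### The density of the Katugampola integral and the formula almost everywhere -/

namespace FuzzyNumber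

theorem smul_smul_of_pos (u : FuzzyNumber) {c d : ℝ} (hc : 0 < c) (hd : 0 < d) :
    c • d • u = (c * d) • u :=
  eq_of_ends fun r _ => by
    simp [lo_smul_of_pos _ hc, lo_smul_of_pos _ hd, lo_smul_of_pos _ (mul_pos hc hd),
      hi_smul_of_pos _ hc, hi_smul_of_pos _ hd, hi_smul_of_pos _ (mul_pos hc hd), mul_assoc]

theorem one_smul' (u : FuzzyNumber) : (1 : ℝ) • u = u :=
  eq_of_ends fun r _ => by simp [lo_smul_of_pos _ one_pos, hi_smul_of_pos _ one_pos]

/-- Admissible orders and parameters of the Katugampola operators. -/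
structure KatugampolaParams (φ ρ : ℝ × ℝ) : Prop where
  order_fst : φ.1 ∈ Ioo (0 : ℝ) 1
  order_snd : φ.2 ∈ Ioo (0 : ℝ) 1
  param_fst : 0 < ρ.1
  param_snd : 0 < ρ.2

/-- The weight of the Caputo-Katugampola double integral. -/
noncomputable def katugampolaWeight (φ ρ p q : ℝ × ℝ) : ℝ :=
  1 / ((p.1 ^ ρ.1 - q.1 ^ ρ.1) ^ φ.1 * (p.2 ^ ρ.2 - q.2 ^ ρ.2) ^ φ.2)

/-- The kernel of the Katugampola integral of order `1 - φ`. -/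
noncomputable def katugampolaKernel (φ ρ p q : ℝ × ℝ) : ℝ :=
  q.1 ^ (ρ.1 - 1) * q.2 ^ (ρ.2 - 1) /
    ((p.1 ^ ρ.1 - q.1 ^ ρ.1) ^ φ.1 * (p.2 ^ ρ.2 - q.2 ^ ρ.2) ^ φ.2)

/-- The normalizing constant of the Katugampola integral of order `1 - φ`. -/
noncomputable def katugampolaConst (φ ρ : ℝ × ℝ) : ℝ :=
  ρ.1 ^ φ.1 * ρ.2 ^ φ.2 / (Real.Gamma (1 - φ.1) * Real.Gamma (1 - φ.2))

/-- The open rectangle `(0, x) × (0, y)`. -/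
def below (p : ℝ × ℝ) : Set (ℝ × ℝ) := Ioo 0 p.1 ×ˢ Ioo 0 p.2

/-- The value of the Caputo-Katugampola derivative, in terms of the mixed gH-derivative `D`. -/
noncomputable def caputoValue (φ ρ : ℝ × ℝ) (D : ℝ × ℝ → FuzzyNumber) (p : ℝ × ℝ) : FuzzyNumber :=
  katugampolaConst φ ρ •
    fuzzyIntegral (volume.restrict (below p)) fun q => katugampolaWeight φ ρ p q • D q

/-- The density of the Katugampola integral of the mixed increment. -/
noncomputable def caputoDensity (φ ρ : ℝ × ℝ) (D : ℝ × ℝ → FuzzyNumber) (p : ℝ × ℝ) :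
    FuzzyNumber :=
  (p.1 ^ (ρ.1 - 1) * p.2 ^ (ρ.2 - 1)) • caputoValue φ ρ D p

/-- The end points of `caputoDensity`, as a functional of the end points of `D`. -/
noncomputable def caputoDensityReal (φ ρ : ℝ × ℝ) (d : ℝ × ℝ → ℝ) (p : ℝ × ℝ) : ℝ :=
  p.1 ^ (ρ.1 - 1) * p.2 ^ (ρ.2 - 1) *
    (katugampolaConst φ ρ * ∫ q in below p, katugampolaWeight φ ρ p q * d q)

theorem measurableSet_below (p : ℝ × ℝ) : MeasurableSet (below p) :=
  measurableSet_Ioo.prod measurableSet_Ioo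

theorem below_subset_rect (a b : ℝ) : below (a, b) ⊆ rect a b :=
  Set.prod_mono Ioo_subset_Ioc_self Ioo_subset_Ioc_self

theorem below_subset {a b : ℝ} {p : ℝ × ℝ} (hp : p ∈ rect a b) : below p ⊆ below (a, b) :=
  Ioo_prod_subset hp.1.2 hp.2.2

section Scalars

variable {φ ρ : ℝ × ℝ}

theorem KatugampolaParams.const_pos (h : KatugampolaParams φ ρ) : 0 < katugampolaConst φ ρ := by
  have h1 := Real.Gamma_pos_of_pos (sub_pos.2 h.order_fst.2)
  have h2 := Real.Gamma_pos_of_pos (sub_pos.2 h.order_snd.2)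
  have h3 := h.param_fst
  have h4 := h.param_snd
  unfold katugampolaConst
  positivity

theorem KatugampolaParams.sub_pos (h : KatugampolaParams φ ρ) {p q : ℝ × ℝ} (hq : q ∈ below p) :
    0 < (p.1 ^ ρ.1 - q.1 ^ ρ.1) ^ φ.1 * (p.2 ^ ρ.2 - q.2 ^ ρ.2) ^ φ.2 :=
  mul_pos
    (Real.rpow_pos_of_pos (_root_.sub_pos.2 (Real.rpow_lt_rpow hq.1.1.le hq.1.2 h.param_fst)) _)
    (Real.rpow_pos_of_pos (_root_.sub_pos.2 (Real.rpow_lt_rpow hq.2.1.le hq.2.2 h.param_snd)) _)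

theorem KatugampolaParams.weight_pos (h : KatugampolaParams φ ρ) {p q : ℝ × ℝ}
    (hq : q ∈ below p) : 0 < katugampolaWeight φ ρ p q := one_div_pos.2 (h.sub_pos hq)

theorem rpow_mul_rpow_pos {p : ℝ × ℝ} (h1 : 0 < p.1) (h2 : 0 < p.2) (e : ℝ × ℝ) :
    0 < p.1 ^ e.1 * p.2 ^ e.2 := by positivity

theorem KatugampolaParams.kernel_pos (h : KatugampolaParams φ ρ) {p q : ℝ × ℝ}
    (hq : q ∈ below p) : 0 < katugampolaKernel φ ρ p q :=
  div_pos (rpow_mul_rpow_pos hq.1.1 hq.2.1 (ρ.1 - 1, ρ.2 - 1)) (h.sub_pos hq)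

theorem rpow_mul_rpow_cancel {p : ℝ × ℝ} (h1 : 0 < p.1) (h2 : 0 < p.2) (ρ : ℝ × ℝ) :
    p.1 ^ (1 - ρ.1) * p.2 ^ (1 - ρ.2) * (p.1 ^ (ρ.1 - 1) * p.2 ^ (ρ.2 - 1)) = 1 := by
  rw [mul_mul_mul_comm, ← Real.rpow_add h1, ← Real.rpow_add h2]
  simp

theorem kernel_mul_rpow {p q : ℝ × ℝ} (h1 : 0 < q.1) (h2 : 0 < q.2) (φ ρ : ℝ × ℝ) :
    katugampolaKernel φ ρ p q * (q.1 ^ (1 - ρ.1) * q.2 ^ (1 - ρ.2)) =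
      katugampolaWeight φ ρ p q := by
  rw [katugampolaKernel, katugampolaWeight, div_mul_eq_mul_div, mul_comm (_ * _) (_ * _),
    rpow_mul_rpow_cancel h1 h2]

theorem right_kernel_eq (φ ρ z w : ℝ × ℝ) (t : ℝ) :
    z.1 ^ (ρ.1 - 1) / (z.1 ^ ρ.1 - w.1 ^ ρ.1) ^ φ.1 *
        (z.2 ^ (ρ.2 - 1) / (z.2 ^ ρ.2 - w.2 ^ ρ.2) ^ φ.2) * t =
      z.1 ^ (ρ.1 - 1) * z.2 ^ (ρ.2 - 1) * (katugampolaWeight φ ρ z w * t) := by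
  rw [div_mul_div_comm, katugampolaWeight]
  ring

theorem left_kernel_eq (φ ρ p z : ℝ × ℝ) (t : ℝ) :
    z.1 ^ (ρ.1 - 1) / (p.1 ^ ρ.1 - z.1 ^ ρ.1) ^ φ.1 *
        (z.2 ^ (ρ.2 - 1) / (p.2 ^ ρ.2 - z.2 ^ ρ.2) ^ φ.2) * t =
      katugampolaKernel φ ρ p z * t := by
  rw [div_mul_div_comm, katugampolaKernel]

/-- The Katugampola integral of a double integral is the double integral of the density. -/
theorem KatugampolaParams.fubini (h : KatugampolaParams φ ρ) {p : ℝ × ℝ} {d : ℝ × ℝ → ℝ}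
    (hd : IntegrableOn d (below p)) :
    (∀ᵐ z ∂(volume.restrict (below p)),
      IntegrableOn (fun w => katugampolaWeight φ ρ z w * d w) (below z)) ∧
    IntegrableOn (caputoDensityReal φ ρ d) (below p) ∧
    IntegrableOn (fun z => katugampolaKernel φ ρ p z * ∫ w in below z, d w) (below p) ∧
    ∫ z in below p, caputoDensityReal φ ρ d z =
      katugampolaConst φ ρ * ∫ z in below p, katugampolaKernel φ ρ p z * ∫ w in below z, d w := by
  -- The right kernels produce the density, the left kernels the Katugampola integral; both double
  -- integrals reduce to the same single integral against `d`.
  obtain ⟨r1, r2, r3⟩ := (isBoundedKernel_right (x := p.1) h.param_fst h.order_fst).fubini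
    (isBoundedKernel_right (x := p.2) h.param_snd h.order_snd) hd
  obtain ⟨-, l2, l3⟩ := (isBoundedKernel_left (x := p.1) h.param_fst h.order_fst).fubini
    (isBoundedKernel_left (x := p.2) h.param_snd h.order_snd) hd
  simp only [right_kernel_eq, left_kernel_eq, integral_const_mul] at r1 r2 r3 l2 l3
  have e : caputoDensityReal φ ρ d = fun z => katugampolaConst φ ρ *
      (z.1 ^ (ρ.1 - 1) * z.2 ^ (ρ.2 - 1) * ∫ w in below z, katugampolaWeight φ ρ z w * d w) := by
    funext z
    simp only [caputoDensityReal]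
    ring
  refine ⟨?_, ?_, l2, ?_⟩
  · filter_upwards [r1, ae_restrict_mem (measurableSet_below p)] with z hz hzp
    have hpos := rpow_mul_rpow_pos hzp.1.1 hzp.2.1 (ρ.1 - 1, ρ.2 - 1)
    have := hz.const_mul (z.1 ^ (ρ.1 - 1) * z.2 ^ (ρ.2 - 1))⁻¹
    simpa only [inv_mul_cancel_left₀ hpos.ne'] using! this
  · rw [e]
    exact r2.const_mul _
  · rw [e, integral_const_mul]
    congr 1
    exact r3.trans l3.symm

end Scalars

section Caputo

variable {φ ρ : ℝ × ℝ} {a b : ℝ} {D : ℝ × ℝ → FuzzyNumber}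

theorem weight_pos_ae (h : KatugampolaParams φ ρ) (p : ℝ × ℝ) :
    ∀ᵐ q ∂(volume.restrict (below p)), 0 < katugampolaWeight φ ρ p q :=
  (ae_restrict_mem (measurableSet_below p)).mono fun _ hq => h.weight_pos hq

theorem caputoDensity_ends (h : KatugampolaParams φ ρ) {p : ℝ × ℝ} (hp : p ∈ rect a b)
    (hi : FuzzyIntegrable (volume.restrict (below p)) fun q => katugampolaWeight φ ρ p q • D q)
    {r : ℝ} (hr : r ∈ Icc (0 : ℝ) 1) :
    (caputoDensity φ ρ D p).lo r = caputoDensityReal φ ρ (fun q => (D q).lo r) p ∧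
      (caputoDensity φ ρ D p).hi r = caputoDensityReal φ ρ (fun q => (D q).hi r) p := by
  have hpos := rpow_mul_rpow_pos hp.1.1 hp.2.1 (ρ.1 - 1, ρ.2 - 1)
  have hw := hi.integral_smul (weight_pos_ae h p) hr
  simp only [caputoDensity, caputoValue, caputoDensityReal, lo_smul_of_pos _ hpos,
    hi_smul_of_pos _ hpos, lo_smul_of_pos _ h.const_pos, hi_smul_of_pos _ h.const_pos, hw.1, hw.2]
  exact ⟨trivial, trivial⟩

theorem caputoDensity_levelContinuous (h : KatugampolaParams φ ρ) {p : ℝ × ℝ} (hp : p ∈ rect a b)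
    (hi : FuzzyIntegrable (volume.restrict (below p)) fun q => katugampolaWeight φ ρ p q • D q) :
    (caputoDensity φ ρ D p).LevelContinuous :=
  (hi.levelContinuous_integral.smul h.const_pos.ne').smul
    (rpow_mul_rpow_pos hp.1.1 hp.2.1 (ρ.1 - 1, ρ.2 - 1)).ne'

/-- Fubini gives a null set for each level; rational levels keep their union null and suffice by
`FuzzyIntegrable.of_rat`. -/
theorem ae_fuzzyIntegrable_weight (h : KatugampolaParams φ ρ)
    (hD : FuzzyIntegrable (volume.restrict (below (a, b))) D) :
    ∀ᵐ p ∂(volume.restrict (below (a, b))),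
      FuzzyIntegrable (volume.restrict (below p)) fun q => katugampolaWeight φ ρ p q • D q := by
  have h1 : ∀ᵐ p ∂(volume.restrict (below (a, b))), ∀ q : ℚ, (q : ℝ) ∈ Icc (0 : ℝ) 1 →
      IntegrableOn (fun w => katugampolaWeight φ ρ p w * (D w).lo q) (below p) ∧
      IntegrableOn (fun w => katugampolaWeight φ ρ p w * (D w).hi q) (below p) := by
    refine ae_all_iff.2 fun q => ?_
    by_cases hq : (q : ℝ) ∈ Icc (0 : ℝ) 1
    · filter_upwards [(h.fubini (hD.lo q hq)).1, (h.fubini (hD.hi q hq)).1] with p h1 h2 _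
      exact ⟨h1, h2⟩
    · exact Eventually.of_forall fun p h => absurd h hq
  filter_upwards [h1, ae_restrict_mem (measurableSet_below (a, b))] with p hp hpm
  exact (hD.mono_set (below_subset (below_subset_rect a b hpm))).smul (weight_pos_ae h p) hp

theorem fuzzyIntegrable_caputoDensity (h : KatugampolaParams φ ρ)
    (hD : FuzzyIntegrable (volume.restrict (below (a, b))) D) :
    FuzzyIntegrable (volume.restrict (below (a, b))) (caputoDensity φ ρ D) := by
  have hae := (ae_fuzzyIntegrable_weight h hD).and (ae_restrict_mem (measurableSet_below (a, b)))
  refine ⟨fun r hr => ?_, fun r hr => ?_, ?_⟩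
  · exact (h.fubini (hD.lo r hr)).2.1.congr (hae.mono fun p hp =>
      (caputoDensity_ends h (below_subset_rect a b hp.2) hp.1 hr).1.symm)
  · exact (h.fubini (hD.hi r hr)).2.1.congr (hae.mono fun p hp =>
      (caputoDensity_ends h (below_subset_rect a b hp.2) hp.1 hr).2.symm)
  · exact hae.mono fun p hp => caputoDensity_levelContinuous h (below_subset_rect a b hp.2) hp.1

/-- Fubini is applied to the end points at each level. The identity holds at every point of the
rectangle, although the density is controlled only almost everywhere; this matters because the
derivative needs the integral on the whole rectangle. -/
theorem hasKatugampolaIntegral_fuzzyIntegral (h : KatugampolaParams φ ρ)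
    (hD : FuzzyIntegrable (volume.restrict (below (a, b))) D) {p : ℝ × ℝ} (hp : p ∈ rect a b) :
    HasKatugampolaIntegral (1 - φ) ρ (fun q => fuzzyIntegral (volume.restrict (below q)) D) p
      (fuzzyIntegral (volume.restrict (below p)) (caputoDensity φ ρ D)) := by
  have hDp := hD.mono_set (below_subset hp)
  have hG := (fuzzyIntegrable_caputoDensity h hD).mono_set (below_subset hp)
  have hsub : ∀ q ∈ below p, below q ⊆ below (a, b) := fun q hq =>
    below_subset (below_subset_rect a b (below_subset hp hq))
  have hkpos : ∀ᵐ q ∂(volume.restrict (below p)), 0 < katugampolaKernel φ ρ p q :=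
    (ae_restrict_mem (measurableSet_below p)).mono fun q hq => h.kernel_pos hq
  have hlo : ∀ r ∈ Icc (0 : ℝ) 1, ∀ q ∈ below p,
      katugampolaKernel φ ρ p q * (fuzzyIntegral (volume.restrict (below q)) D).lo r =
        katugampolaKernel φ ρ p q * ∫ w in below q, (D w).lo r := fun r hr q hq => by
    rw [(hD.mono_set (hsub q hq)).lo_integral hr]
  have hhi : ∀ r ∈ Icc (0 : ℝ) 1, ∀ q ∈ below p,
      katugampolaKernel φ ρ p q * (fuzzyIntegral (volume.restrict (below q)) D).hi r =
        katugampolaKernel φ ρ p q * ∫ w in below q, (D w).hi r := fun r hr q hq => by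
    rw [(hD.mono_set (hsub q hq)).hi_integral hr]
  have hm := measurableSet_below p
  have hW : FuzzyIntegrable (volume.restrict (below p)) fun q =>
      katugampolaKernel φ ρ p q • fuzzyIntegral (volume.restrict (below q)) D := by
    refine FuzzyIntegrable.of_rat (fun q hq => ⟨?_, ?_⟩) ?_
    · refine (((h.fubini (hDp.lo q hq)).2.2.1.congr_fun
        (fun z hz => (hlo q hq z hz).symm) hm).integrable).congr ?_
      exact hkpos.mono fun z hz => (lo_smul_of_pos _ hz q).symm
    · refine (((h.fubini (hDp.hi q hq)).2.2.1.congr_fun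
        (fun z hz => (hhi q hq z hz).symm) hm).integrable).congr ?_
      exact hkpos.mono fun z hz => (hi_smul_of_pos _ hz q).symm
    · filter_upwards [hkpos, ae_restrict_mem hm] with z hz hzm
      exact ((hD.mono_set (hsub z hzm)).levelContinuous_integral).smul hz.ne'
  have hae := (ae_fuzzyIntegrable_weight h hD).filter_mono
    (MeasureTheory.ae_mono (Measure.restrict_mono (below_subset hp) le_rfl))
  refine ⟨fuzzyIntegral (volume.restrict (below p)) fun q =>
    katugampolaKernel φ ρ p q • fuzzyIntegral (volume.restrict (below q)) D, ?_, ?_⟩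
  · have := hW.hasFuzzyIntegral
    simpa [katugampolaKernel, below] using this
  · have hc : ρ.1 ^ (1 - (1 - φ).1) * ρ.2 ^ (1 - (1 - φ).2) /
        (Real.Gamma (1 - φ).1 * Real.Gamma (1 - φ).2) = katugampolaConst φ ρ := by
      simp [katugampolaConst]
    rw [hc]
    refine eq_of_ends fun r hr => ?_
    have e1 : ∀ᵐ z ∂(volume.restrict (below p)),
        (caputoDensity φ ρ D z).lo r = caputoDensityReal φ ρ (fun q => (D q).lo r) z ∧
        (caputoDensity φ ρ D z).hi r = caputoDensityReal φ ρ (fun q => (D q).hi r) z := by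
      filter_upwards [hae, ae_restrict_mem hm] with z hz hzm
      exact caputoDensity_ends h (below_subset_rect a b (below_subset hp hzm)) hz hr
    rw [lo_smul_of_pos _ h.const_pos, hi_smul_of_pos _ h.const_pos, hG.lo_integral hr,
      hG.hi_integral hr, (hW.integral_smul hkpos hr).1, (hW.integral_smul hkpos hr).2,
      setIntegral_congr_fun hm (hlo r hr), setIntegral_congr_fun hm (hhi r hr),
      ← (h.fubini (hDp.lo r hr)).2.2.2, ← (h.fubini (hDp.hi r hr)).2.2.2]
    exact ⟨integral_congr_ae (e1.mono fun z hz => hz.1),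
      integral_congr_ae (e1.mono fun z hz => hz.2)⟩

/-- The Caputo-Katugampola formula at a point where the density of the Katugampola integral is
well-behaved. -/
theorem caputoKatugampolaFormula_of_density (h : KatugampolaParams φ ρ)
    {U : ℝ × ℝ → FuzzyNumber}
    (hD : FuzzyIntegrable (volume.restrict (below (a, b))) D)
    (hU : ∀ q ∈ rect a b, IsGHDiff (U q + U (0, 0)) (U (q.1, 0) + U (0, q.2))
      (fuzzyIntegral (volume.restrict (below q)) D))
    {p : ℝ × ℝ} (hp : p ∈ rect a b)
    (hi : FuzzyIntegrable (volume.restrict (below p)) fun q => katugampolaWeight φ ρ p q • D q)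
    (hsec : ∀ᵐ η ∂(volume.restrict (Ioo 0 b)), (caputoDensity φ ρ D (p.1, η)).LevelContinuous)
    (hd : ∀ q : ℚ, (q : ℝ) ∈ Icc (0 : ℝ) 1 →
      HasMixedIntegralDeriv a b (fun z => (caputoDensity φ ρ D z).lo q) p ∧
      HasMixedIntegralDeriv a b (fun z => (caputoDensity φ ρ D z).hi q) p) :
    CaputoKatugampolaFormula φ ρ a b U D p := by
  have hm := measurableSet_below p
  have hc : ρ.1 ^ (1 - (1 - φ).1) * ρ.2 ^ (1 - (1 - φ).2) /
      (Real.Gamma (1 - φ).1 * Real.Gamma (1 - φ).2) = katugampolaConst φ ρ := by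
    simp [katugampolaConst]
  refine ⟨caputoValue φ ρ D p, hi.levelContinuous_integral.smul h.const_pos.ne',
    ⟨fun q => fuzzyIntegral (volume.restrict (below q)) D, hU,
      fun q => fuzzyIntegral (volume.restrict (below q)) (caputoDensity φ ρ D),
      caputoDensity φ ρ D p, fun q hq => hasKatugampolaIntegral_fuzzyIntegral h hD hq,
      (fuzzyIntegrable_caputoDensity h hD).hasMixedGHDeriv hp
        (caputoDensity_levelContinuous h hp hi) hsec hd, ?_⟩,
    ⟨fuzzyIntegral (volume.restrict (below p)) fun q => katugampolaWeight φ ρ p q • D q, ?_, ?_⟩,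
    ⟨fuzzyIntegral (volume.restrict (below p)) fun q => katugampolaWeight φ ρ p q • D q, ?_, rfl⟩⟩
  -- The outer powers with exponents 1 - ρ cancel the powers with exponents ρ - 1 in the density.
  · rw [caputoDensity, smul_smul_of_pos _ (rpow_mul_rpow_pos hp.1.1 hp.2.1 (1 - ρ.1, 1 - ρ.2))
      (rpow_mul_rpow_pos hp.1.1 hp.2.1 (ρ.1 - 1, ρ.2 - 1)),
      rpow_mul_rpow_cancel hp.1.1 hp.2.1, one_smul']
  · refine hi.hasFuzzyIntegral.congr hm fun q hq => ?_
    have := smul_smul_of_pos (D q) (h.kernel_pos hq)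
      (rpow_mul_rpow_pos hq.1.1 hq.2.1 (1 - ρ.1, 1 - ρ.2))
    rw [kernel_mul_rpow hq.1.1 hq.2.1] at this
    refine this.symm.trans ?_
    simp [katugampolaKernel]
  · rw [hc]; rfl
  · exact hi.hasFuzzyIntegral

theorem ae_caputoKatugampolaFormula (h : KatugampolaParams φ ρ) {U : ℝ × ℝ → FuzzyNumber}
    (hD : FuzzyIntegrable (volume.restrict (below (a, b))) D)
    (hU : ∀ q ∈ rect a b, IsGHDiff (U q + U (0, 0)) (U (q.1, 0) + U (0, q.2))
      (fuzzyIntegral (volume.restrict (below q)) D)) :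
    ∀ᵐ p ∂(volume.restrict (rect a b)), CaputoKatugampolaFormula φ ρ a b U D p := by
  have hG := fuzzyIntegrable_caputoDensity h hD
  have hae : volume.restrict (rect a b) = volume.restrict (below (a, b)) :=
    (Measure.restrict_congr_set (Ioo_prod_ae_eq_Ioc a b)).symm
  have hprod : volume.restrict (below (a, b)) =
      (volume.restrict (Ioo 0 a)).prod (volume.restrict (Ioo 0 b)) := by
    rw [below, Measure.volume_eq_prod, Measure.prod_restrict]
  have h1 := ae_fuzzyIntegrable_weight h hD
  have h2 : ∀ᵐ p ∂(volume.restrict (below (a, b))), ∀ᵐ η ∂(volume.restrict (Ioo 0 b)),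
      (caputoDensity φ ρ D (p.1, η)).LevelContinuous := by
    have h3 := hG.levelContinuous
    rw [hprod] at h3 ⊢
    -- Differentiating in the second variable requires level continuity along almost the whole
    -- section through `p`, which Fubini provides for almost every abscissa.
    exact Measure.quasiMeasurePreserving_fst.ae (Measure.ae_ae_of_ae_prod h3)
  have h3 : ∀ᵐ p ∂(volume.restrict (below (a, b))), ∀ q : ℚ, (q : ℝ) ∈ Icc (0 : ℝ) 1 →
      HasMixedIntegralDeriv a b (fun z => (caputoDensity φ ρ D z).lo q) p ∧
      HasMixedIntegralDeriv a b (fun z => (caputoDensity φ ρ D z).hi q) p := by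
    refine ae_all_iff.2 fun q => ?_
    by_cases hq : (q : ℝ) ∈ Icc (0 : ℝ) 1
    · have l1 := ae_hasMixedIntegralDeriv (hG.lo q hq)
      have l2 := ae_hasMixedIntegralDeriv (hG.hi q hq)
      rw [← hae]
      filter_upwards [l1, l2] with p h1 h2 _
      exact ⟨h1, h2⟩
    · exact Eventually.of_forall fun p h => absurd h hq
  rw [hae]
  filter_upwards [h1, h2, h3, ae_restrict_mem (measurableSet_below (a, b))] with p c1 c2 c3 hp
  exact caputoKatugampolaFormula_of_density h hD hU (below_subset_rect a b hp) c1 c2 c3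

end Caputo

end FuzzyNumber

/-! ### The formula at every point for continuous bounded derivatives -/

namespace FuzzyNumber

/-- For ρ ≥ 1 this follows from u^ρ ≤ u, for ρ ≤ 1 from Bernoulli's inequality. It compares the
singularity of the weight at u = 1 with the integrable (1 - u)^(-φ). -/
theorem min_mul_one_sub_le_one_sub_rpow {ρ u : ℝ} (hρ : 0 < ρ) (hu : u ∈ Ioo (0 : ℝ) 1) :
    min 1 ρ * (1 - u) ≤ 1 - u ^ ρ := by
  rcases le_total 1 ρ with h | h
  · rw [min_eq_left h]
    have := Real.rpow_le_rpow_of_exponent_ge hu.1 hu.2.le h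
    rw [Real.rpow_one] at this
    linarith
  · rw [min_eq_right h]
    have := rpow_one_add_le_one_add_mul_self (s := u - 1) (by linarith [hu.1]) hρ.le h
    rw [add_sub_cancel] at this
    linarith

theorem integrableOn_one_div_one_sub_rpow {φ ρ : ℝ} (hρ : 0 < ρ) (hφ : φ ∈ Ioo (0 : ℝ) 1) :
    IntegrableOn (fun u : ℝ => 1 / (1 - u ^ ρ) ^ φ) (Ioo 0 1) := by
  have hm : 0 < min 1 ρ := lt_min one_pos hρ
  have h1 : IntervalIntegrable (fun u : ℝ => (1 - u) ^ (-φ)) volume 0 1 := by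
    have h := (intervalIntegral.intervalIntegrable_rpow' (a := 1) (b := 0) (r := -φ)
      (by linarith [hφ.2])).comp_sub_left 1
    simpa using h
  have h2 : IntegrableOn (fun u : ℝ => min 1 ρ ^ (-φ) * (1 - u) ^ (-φ)) (Ioo 0 1) := by
    refine Integrable.const_mul ?_ _
    exact (((intervalIntegrable_iff_integrableOn_Ioc_of_le zero_le_one).1 h1).mono_set
      Ioo_subset_Ioc_self)
  refine Integrable.mono' h2 (Measurable.aestronglyMeasurable (by fun_prop)) ?_
  filter_upwards [ae_restrict_mem measurableSet_Ioo] with u hu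
  have hu1 : 0 < 1 - u := sub_pos.2 hu.2
  have hle := min_mul_one_sub_le_one_sub_rpow hρ hu
  have hpos : 0 < min 1 ρ * (1 - u) := mul_pos hm hu1
  have hnn : 0 ≤ 1 / (1 - u ^ ρ) ^ φ :=
    one_div_nonneg.2 (Real.rpow_nonneg (hpos.le.trans hle) _)
  rw [Real.norm_of_nonneg hnn, ← Real.mul_rpow hm.le hu1.le, Real.rpow_neg hpos.le, one_div]
  exact inv_anti₀ (Real.rpow_pos_of_pos hpos _) (Real.rpow_le_rpow hpos.le hle hφ.1.le)

theorem integral_Ioo_scale {x : ℝ} (hx : 0 < x) (f : ℝ → ℝ) :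
    ∫ s in Ioo 0 x, f s = x * ∫ u in Ioo 0 1, f (x * u) := by
  rw [setIntegral_Ioo_eq_intervalIntegral hx.le, setIntegral_Ioo_eq_intervalIntegral zero_le_one,
    intervalIntegral.mul_integral_comp_mul_left]
  simp

theorem integrableOn_Ioo_of_scale {x : ℝ} (hx : 0 < x) {f : ℝ → ℝ}
    (hf : IntegrableOn (fun u => f (x * u)) (Ioo 0 1)) : IntegrableOn f (Ioo 0 x) := by
  rw [← intervalIntegrable_iff_integrableOn_Ioo_of_le zero_le_one] at hf
  rw [← intervalIntegrable_iff_integrableOn_Ioo_of_le hx.le]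
  have := hf.comp_mul_left (c := x⁻¹)
  simpa [mul_inv_cancel_left₀ hx.ne'] using this

theorem one_div_rpow_sub_rpow_scale {φ ρ x u : ℝ} (hρ : 0 < ρ) (hx : 0 < x)
    (hu : u ∈ Ioo (0 : ℝ) 1) :
    1 / (x ^ ρ - (x * u) ^ ρ) ^ φ = x ^ (-(ρ * φ)) * (1 / (1 - u ^ ρ) ^ φ) := by
  have h1 : 0 ≤ 1 - u ^ ρ := sub_nonneg.2 (Real.rpow_le_one hu.1.le hu.2.le hρ.le)
  have e : x ^ ρ - (x * u) ^ ρ = x ^ ρ * (1 - u ^ ρ) := by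
    rw [Real.mul_rpow hx.le hu.1.le]
    ring
  rw [e, Real.mul_rpow (Real.rpow_nonneg hx.le _) h1, ← Real.rpow_mul hx.le, Real.rpow_neg hx.le,
    one_div, one_div, mul_inv]

theorem integrableOn_one_div_rpow_sub_rpow {φ ρ x : ℝ} (hρ : 0 < ρ) (hφ : φ ∈ Ioo (0 : ℝ) 1)
    (hx : 0 < x) : IntegrableOn (fun s : ℝ => 1 / (x ^ ρ - s ^ ρ) ^ φ) (Ioo 0 x) :=
  integrableOn_Ioo_of_scale hx (IntegrableOn.congr_fun
    (Integrable.const_mul (integrableOn_one_div_one_sub_rpow hρ hφ) (x ^ (-(ρ * φ))))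
    (fun _ hu => (one_div_rpow_sub_rpow_scale hρ hx hu).symm) measurableSet_Ioo)

section Bounded

variable {φ ρ p : ℝ × ℝ} {a b C : ℝ} {d : ℝ × ℝ → ℝ}

/-- The weight on the unit square. -/
noncomputable def unitWeight (φ ρ w : ℝ × ℝ) : ℝ :=
  1 / (1 - w.1 ^ ρ.1) ^ φ.1 * (1 / (1 - w.2 ^ ρ.2) ^ φ.2)

theorem unitWeight_nonneg (h : KatugampolaParams φ ρ) {w : ℝ × ℝ} (hw : w ∈ below (1, 1)) :
    0 ≤ unitWeight φ ρ w := by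
  have h1 := sub_nonneg.2 (Real.rpow_le_one hw.1.1.le hw.1.2.le h.param_fst.le)
  have h2 := sub_nonneg.2 (Real.rpow_le_one hw.2.1.le hw.2.2.le h.param_snd.le)
  unfold unitWeight
  positivity

theorem restrict_below (p : ℝ × ℝ) : volume.restrict (below p) =
    (volume.restrict (Ioo 0 p.1)).prod (volume.restrict (Ioo 0 p.2)) := by
  rw [below, Measure.volume_eq_prod, Measure.prod_restrict]

theorem integrableOn_unitWeight (h : KatugampolaParams φ ρ) :
    IntegrableOn (unitWeight φ ρ) (below (1, 1)) := by
  rw [IntegrableOn, restrict_below]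
  exact (integrableOn_one_div_one_sub_rpow h.param_fst h.order_fst).integrable.mul_prod
    (integrableOn_one_div_one_sub_rpow h.param_snd h.order_snd).integrable

theorem integrableOn_katugampolaWeight (h : KatugampolaParams φ ρ) (hp : p ∈ rect a b) :
    IntegrableOn (katugampolaWeight φ ρ p) (below p) := by
  rw [IntegrableOn, restrict_below]
  refine ((integrableOn_one_div_rpow_sub_rpow h.param_fst h.order_fst hp.1.1).integrable.mul_prod
    (integrableOn_one_div_rpow_sub_rpow h.param_snd h.order_snd hp.2.1).integrable).congr ?_
  exact Eventually.of_forall fun q => by simp [katugampolaWeight, mul_comm]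

theorem IntegrableOn.mul_of_bounded {S : Set (ℝ × ℝ)} {k f : ℝ × ℝ → ℝ} (hS : MeasurableSet S)
    (hk : IntegrableOn k S) (hf : ContinuousOn f S) (hC : ∀ q ∈ S, |f q| ≤ C) :
    IntegrableOn (fun q => k q * f q) S :=
  Integrable.mul_bdd (c := C) hk (hf.aestronglyMeasurable hS)
    ((ae_restrict_mem hS).mono fun q hq => hC q hq)

theorem integrableOn_weight_mul (h : KatugampolaParams φ ρ) (hd : ContinuousOn d (rect a b))
    (hC : ∀ q ∈ rect a b, |d q| ≤ C) (hp : p ∈ rect a b) :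
    IntegrableOn (fun q => katugampolaWeight φ ρ p q * d q) (below p) := by
  have hsub : below p ⊆ rect a b := (below_subset hp).trans (below_subset_rect a b)
  exact IntegrableOn.mul_of_bounded (measurableSet_below p) (integrableOn_katugampolaWeight h hp)
    (hd.mono hsub) fun q hq => hC q (hsub hq)

theorem scale_mem_rect (hp : p ∈ rect a b) {w : ℝ × ℝ} (hw : w ∈ below (1, 1)) :
    (p.1 * w.1, p.2 * w.2) ∈ rect a b :=
  ⟨⟨mul_pos hp.1.1 hw.1.1, (mul_le_of_le_one_right hp.1.1.le hw.1.2.le).trans hp.1.2⟩,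
    ⟨mul_pos hp.2.1 hw.2.1, (mul_le_of_le_one_right hp.2.1.le hw.2.2.le).trans hp.2.2⟩⟩

theorem continuousOn_scale (hd : ContinuousOn d (rect a b)) (hp : p ∈ rect a b) :
    ContinuousOn (fun w : ℝ × ℝ => d (p.1 * w.1, p.2 * w.2)) (below (1, 1)) :=
  hd.comp (by fun_prop) fun _ hw => scale_mem_rect hp hw

theorem integrableOn_unitWeight_mul (h : KatugampolaParams φ ρ) (hd : ContinuousOn d (rect a b))
    (hC : ∀ q ∈ rect a b, |d q| ≤ C) (hp : p ∈ rect a b) :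
    IntegrableOn (fun w => unitWeight φ ρ w * d (p.1 * w.1, p.2 * w.2)) (below (1, 1)) :=
  IntegrableOn.mul_of_bounded (measurableSet_below _) (integrableOn_unitWeight h)
    (continuousOn_scale hd hp) fun _ hw => hC _ (scale_mem_rect hp hw)

/-- The weighted double integral, rescaled to the unit square. -/
theorem integral_weight_mul (h : KatugampolaParams φ ρ) (hd : ContinuousOn d (rect a b))
    (hC : ∀ q ∈ rect a b, |d q| ≤ C) (hp : p ∈ rect a b) :
    ∫ q in below p, katugampolaWeight φ ρ p q * d q =
      p.1 * p.1 ^ (-(ρ.1 * φ.1)) * (p.2 * p.2 ^ (-(ρ.2 * φ.2))) *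
        ∫ w in below (1, 1), unitWeight φ ρ w * d (p.1 * w.1, p.2 * w.2) := by
  have e1 := setIntegral_prod _ (integrableOn_weight_mul h hd hC hp)
  have e2 := setIntegral_prod _ (integrableOn_unitWeight_mul h hd hC hp)
  rw [← Measure.volume_eq_prod] at e1 e2
  refine e1.trans ?_
  rw [show ∫ w in below (1, 1), unitWeight φ ρ w * d (p.1 * w.1, p.2 * w.2) = _ from e2,
    integral_Ioo_scale hp.1.1, mul_assoc p.1, mul_assoc p.1]
  congr 1
  rw [← integral_const_mul]
  refine setIntegral_congr_fun measurableSet_Ioo fun u hu => ?_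
  simp only
  rw [integral_Ioo_scale hp.2.1, ← integral_const_mul, ← integral_const_mul]
  refine setIntegral_congr_fun measurableSet_Ioo fun v hv => ?_
  have s1 := one_div_rpow_sub_rpow_scale (φ := φ.1) h.param_fst hp.1.1 hu
  have s2 := one_div_rpow_sub_rpow_scale (φ := φ.2) h.param_snd hp.2.1 hv
  simp only [katugampolaWeight, unitWeight]
  rw [← one_div_mul_one_div, s1, s2]
  ring

/-- Each variable collects x^(ρ-1) · x · x^(-ρφ) = x^(ρ(1-φ)). The exponent is positive, so the
density stays bounded near the axes even when ρ < 1. -/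
theorem caputoDensityReal_eq (h : KatugampolaParams φ ρ) (hd : ContinuousOn d (rect a b))
    (hC : ∀ q ∈ rect a b, |d q| ≤ C) (hp : p ∈ rect a b) :
    caputoDensityReal φ ρ d p = katugampolaConst φ ρ *
      (p.1 ^ (ρ.1 * (1 - φ.1)) * p.2 ^ (ρ.2 * (1 - φ.2))) *
        ∫ w in below (1, 1), unitWeight φ ρ w * d (p.1 * w.1, p.2 * w.2) := by
  have e : ∀ {x : ℝ}, 0 < x → ∀ ρ φ : ℝ,
      x ^ (ρ - 1) * (x * x ^ (-(ρ * φ))) = x ^ (ρ * (1 - φ)) := fun {x} hx ρ φ => by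
    have e1 : x * x ^ (-(ρ * φ)) = x ^ (1 + -(ρ * φ)) := by
      rw [Real.rpow_add hx, Real.rpow_one]
    rw [e1, ← Real.rpow_add hx]
    ring_nf
  rw [caputoDensityReal, integral_weight_mul h hd hC hp, ← e hp.1.1, ← e hp.2.1]
  ring

/-- After rescaling, neither the domain nor the singular weight depends on the point; only the
bounded factor `d` does, and dominated convergence applies. -/
theorem continuousOn_caputoDensityReal (h : KatugampolaParams φ ρ)
    (hd : ContinuousOn d (rect a b)) (hC : ∀ q ∈ rect a b, |d q| ≤ C) :
    ContinuousOn (caputoDensityReal φ ρ d) (rect a b) := by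
  have hQ : ContinuousOn (fun p : ℝ × ℝ =>
      ∫ w in below (1, 1), unitWeight φ ρ w * d (p.1 * w.1, p.2 * w.2)) (rect a b) := by
    refine continuousOn_of_dominated (bound := fun w => unitWeight φ ρ w * C)
      (fun p hp => (integrableOn_unitWeight_mul h hd hC hp).aestronglyMeasurable)
      (fun p hp => ?_) ((integrableOn_unitWeight h).mul_const C) ?_
    · filter_upwards [ae_restrict_mem (measurableSet_below (1, 1))] with w hw
      rw [norm_mul, Real.norm_of_nonneg (unitWeight_nonneg h hw)]
      exact mul_le_mul_of_nonneg_left (hC _ (scale_mem_rect hp hw)) (unitWeight_nonneg h hw)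
    · filter_upwards [ae_restrict_mem (measurableSet_below (1, 1))] with w hw
      exact continuousOn_const.mul
        (hd.comp (by fun_prop) fun p hp => scale_mem_rect hp hw)
  refine ContinuousOn.congr (ContinuousOn.mul (continuousOn_const.mul (ContinuousOn.mul ?_ ?_)) hQ)
    fun p hp => caputoDensityReal_eq h hd hC hp
  · exact continuousOn_fst.rpow_const fun p hp => Or.inl hp.1.1.ne'
  · exact continuousOn_snd.rpow_const fun p hp => Or.inl hp.2.1.ne'

theorem exists_abs_caputoDensityReal_le (h : KatugampolaParams φ ρ)
    (hd : ContinuousOn d (rect a b)) (hC : ∀ q ∈ rect a b, |d q| ≤ C) :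
    ∃ M, ∀ p ∈ rect a b, |caputoDensityReal φ ρ d p| ≤ M := by
  refine ⟨katugampolaConst φ ρ * (a ^ (ρ.1 * (1 - φ.1)) * b ^ (ρ.2 * (1 - φ.2))) *
    ∫ w in below (1, 1), unitWeight φ ρ w * C, fun p hp => ?_⟩
  have h1 : 0 ≤ ρ.1 * (1 - φ.1) := mul_nonneg h.param_fst.le (sub_nonneg.2 h.order_fst.2.le)
  have h2 : 0 ≤ ρ.2 * (1 - φ.2) := mul_nonneg h.param_snd.le (sub_nonneg.2 h.order_snd.2.le)
  have hx := Real.rpow_le_rpow hp.1.1.le hp.1.2 h1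
  have hy := Real.rpow_le_rpow hp.2.1.le hp.2.2 h2
  have hx0 := Real.rpow_nonneg hp.1.1.le (ρ.1 * (1 - φ.1))
  have hy0 := Real.rpow_nonneg hp.2.1.le (ρ.2 * (1 - φ.2))
  have hc := h.const_pos.le
  rw [caputoDensityReal_eq h hd hC hp, abs_mul, abs_of_nonneg (mul_nonneg hc (mul_nonneg hx0 hy0))]
  have hQ : |∫ w in below (1, 1), unitWeight φ ρ w * d (p.1 * w.1, p.2 * w.2)| ≤
      ∫ w in below (1, 1), unitWeight φ ρ w * C := by
    refine norm_integral_le_of_norm_le (G := ℝ)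
      (Integrable.mul_const (integrableOn_unitWeight h) C) ?_
    filter_upwards [ae_restrict_mem (measurableSet_below (1, 1))] with w hw
    rw [norm_mul, Real.norm_of_nonneg (unitWeight_nonneg h hw)]
    exact mul_le_mul_of_nonneg_left (hC _ (scale_mem_rect hp hw)) (unitWeight_nonneg h hw)
  have hx1 := hx0.trans hx
  have hy1 := hy0.trans hy
  gcongr

theorem hasMixedIntegralDeriv_caputoDensityReal (h : KatugampolaParams φ ρ)
    (hd : ContinuousOn d (rect a b)) (hC : ∀ q ∈ rect a b, |d q| ≤ C) (hp : p ∈ rect a b)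
    {g : ℝ × ℝ → ℝ} (hg : EqOn g (caputoDensityReal φ ρ d) (rect a b)) :
    HasMixedIntegralDeriv a b g p := by
  obtain ⟨M, hM⟩ := exists_abs_caputoDensityReal_le h hd hC
  exact ContinuousOn.hasMixedIntegralDeriv ((continuousOn_caputoDensityReal h hd hC).congr hg)
    (fun q hq => by rw [hg hq]; exact hM q hq) hp

end Bounded

theorem caputoKatugampolaFormula_of_continuousOn {φ ρ : ℝ × ℝ} {a b : ℝ}
    {D U : ℝ × ℝ → FuzzyNumber} (h : KatugampolaParams φ ρ)
    (hD : FuzzyIntegrable (volume.restrict (below (a, b))) D)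
    (hU : ∀ q ∈ rect a b, IsGHDiff (U q + U (0, 0)) (U (q.1, 0) + U (0, q.2))
      (fuzzyIntegral (volume.restrict (below q)) D))
    (hc : ContinuousOn D (rect a b)) (hb : Bornology.IsBounded (D '' rect a b))
    {p : ℝ × ℝ} (hp : p ∈ rect a b) : CaputoKatugampolaFormula φ ρ a b U D p := by
  have hends : ∀ {f : FuzzyNumber → ℝ}, LipschitzWith 1 f →
      ContinuousOn (fun q => f (D q)) (rect a b) ∧ ∃ C, ∀ q ∈ rect a b, |f (D q)| ≤ C := by
    intro f hf
    -- The end point maps are 1-Lipschitz for the supremum metric, so they transfer both continuity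
    -- and boundedness from `D`.
    obtain ⟨C, hC⟩ := (hf.isBounded_image hb).exists_norm_le
    exact ⟨hf.continuous.comp_continuousOn hc,
      C, fun q hq => hC _ (mem_image_of_mem f (mem_image_of_mem D hq))⟩
  have hi : ∀ q ∈ rect a b, FuzzyIntegrable (volume.restrict (below q))
      fun w => katugampolaWeight φ ρ q w • D w := by
    intro q hq
    refine (hD.mono_set (below_subset hq)).smul (weight_pos_ae h q) fun r hr => ?_
    obtain ⟨c1, C1, h1⟩ := hends (lipschitzWith_lo hr)
    obtain ⟨c2, C2, h2⟩ := hends (lipschitzWith_hi hr)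
    exact ⟨integrableOn_weight_mul h c1 h1 hq, integrableOn_weight_mul h c2 h2 hq⟩
  refine caputoKatugampolaFormula_of_density h hD hU hp (hi p hp) ?_ fun r hr => ?_
  · filter_upwards [ae_restrict_mem measurableSet_Ioo] with η hη
    have hq : (p.1, η) ∈ rect a b := ⟨hp.1, Ioo_subset_Ioc_self hη⟩
    exact caputoDensity_levelContinuous h hq (hi _ hq)
  · obtain ⟨c1, C1, h1⟩ := hends (lipschitzWith_lo hr)
    obtain ⟨c2, C2, h2⟩ := hends (lipschitzWith_hi hr)
    exact ⟨hasMixedIntegralDeriv_caputoDensityReal h c1 h1 hp fun q hq =>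
        (caputoDensity_ends h hq (hi q hq) hr).1,
      hasMixedIntegralDeriv_caputoDensityReal h c2 h2 hp fun q hq =>
        (caputoDensity_ends h hq (hi q hq) hr).2⟩

end FuzzyNumber

theorem mainTheorem7 (a b : ℝ) (ha : 0 < a) (hb : 0 < b) (φ ρ : ℝ × ℝ)
    (hφ₁ : φ.1 ∈ Ioo (0 : ℝ) 1) (hφ₂ : φ.2 ∈ Ioo (0 : ℝ) 1) (hρ₁ : 0 < ρ.1) (hρ₂ : 0 < ρ.2)
    (υ : ℝ × ℝ → FuzzyNumber)
    (hυ : ∀ p ∈ Icc (0 : ℝ) a ×ˢ Icc (0 : ℝ) b, (υ p).LevelContinuous)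
    (hac : FuzzyNumber.AbsCont a b υ) (hmono : FuzzyNumber.DMonotone a b υ)
    (D : ℝ × ℝ → FuzzyNumber)
    (hD : (∀ᵐ p ∂(volume.restrict (FuzzyNumber.rect a b)),
        FuzzyNumber.HasMixedGHDerivSame a b υ p (D p)) ∨
      (∀ᵐ p ∂(volume.restrict (FuzzyNumber.rect a b)),
        FuzzyNumber.HasMixedGHDerivDiff a b υ p (D p))) :
    (∀ᵐ p ∂(volume.restrict (FuzzyNumber.rect a b)),
      FuzzyNumber.CaputoKatugampolaFormula φ ρ a b υ D p) ∧
    (ContinuousOn D (FuzzyNumber.rect a b) →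
      Bornology.IsBounded (D '' FuzzyNumber.rect a b) →
      ∀ p ∈ FuzzyNumber.rect a b, FuzzyNumber.CaputoKatugampolaFormula φ ρ a b υ D p) := by
  have h : FuzzyNumber.KatugampolaParams φ ρ := ⟨hφ₁, hφ₂, hρ₁, hρ₂⟩
  obtain ⟨h1, h2⟩ := hac.isGHDiff_integral ha hb hυ hmono hD
  exact ⟨FuzzyNumber.ae_caputoKatugampolaFormula h h1 h2, fun hc hbd p hp =>
    FuzzyNumber.caputoKatugampolaFormula_of_continuousOn h h1 h2 hc hbd hp⟩
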